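/- Let $\mathbf{k}$ be a field of characteristic $0$. A \emph{2-disk} (pruned 2-tree, 2-ordinal) is $U=(n_1,\dots,n_k)$ with $k\ge 1$ and all $n_i\ge 1$. Its minimal balls (leaves) are the pairs $\nu=(i,j)$, $1\le i\le k$, $1\le j\le n_i$, with column $\pi(\nu)=i$ and height $j$. For ordinals $I_\nu=[k_\nu]=\{0<\dots<k_\nu\}$ and $J=[s]$, let $\mathbf{seq}(U)(\{I_\nu\};J)$ be the set of total orders on $\bigsqcup_\nu I_\nu$ together with a monotone map $W\colon\bigsqcup_\nu I_\nu\to J$, such that: (1) the order restricts to the given order of each $I_\nu$; (2) if $\nu_1,\nu_2$ lie in the same column and $\nu_1$ is lower than $\nu_2$, then $I_{\nu_1}<I_{\nu_2}$; (3) if $\pi(\nu_1)<\pi(\nu_2)$, then either $I_{\nu_1}<I_{\nu_2}$, or $I_{\nu_2}<I_{\nu_1}$, or, with $I_{\nu_2}=[n]$, there is $0\le a<n$ with $[0,a]<I_{\nu_1}<[a+1,n]$. These sets are contravariant (simplicial) in every $I_\nu$ and covariant (cosimplicial) in $J$. For a surjective map $\sigma\colon T\to S$ of 2-trees with (pruned)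 fibres $F_\mu$, where $\mu$ runs over the leaves of $S$, there is a composition of an element of $\mathbf{seq}(S)(\{J_\mu\};K)$ with elements of $\mathbf{seq}(F_\mu)(\{I_\nu\}_{\nu\in F_\mu};J_\mu)$: the total order on $\bigsqcup_\mu J_\mu$ is pulled back along the maps $W_\mu$ (elements of the same fibre being ordered as in the given order), and the maps $W$ are composed. Let $\mathbf{Breq}(U)$ be the total complex of the polysimplicial vector space $\mathbf{k}\,\mathbf{seq}(U)(\{I_\nu\};[0])$, a cell with $I_\nu=[k_\nu]$ having degree $-\sum_\nu k_\nu$ and the differential being the signed sum of all faces. Let $\mathrm{Nor}(\mathbf{Breq})(U)$ be its quotient by the subcomplex spanned by the total orders in which two consecutive elements belong to the same $I_\nu$ (the normalised complex). Let $|\mathbf{seq}|(U)$ be the non-normalised condensation, with degree $n$ part $\prod_{s\ge 0}\bigoplus_{s-\sum k_\nu=n}\mathbf{k}\,\mathbf{seq}(U)(\{[k_\nu]\};[s])$, differential given by the cofaces in $J$ and the faces in the $I_\nu$, compositions induced from those of $\mathbf{seq}$ with Koszul signs, and unit $\prod_s\mathrm{id}_{[s]}\in|\mathbf{seq}|((1))$.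 Let $\underline{\mathbf{k}}$ be the constant 2-operad, with $\underline{\mathbf{k}}(U)=\mathbf{k}$ in degree $0$ for all $U$ and compositions given by multiplication. \textbf{Theorem.} (i) For every 2-disk $U$, the cohomology of $\mathrm{Nor}(\mathbf{Breq})(U)$ is isomorphic to $\mathbf{k}$ in degree $0$ and vanishes in all other degrees. (ii) $|\mathbf{seq}|$ is a dg 2-operad (with compositions along surjective maps of pruned 2-trees), and it is quasi-isomorphic to $\underline{\mathbf{k}}$: the two are connected by a zigzag of maps of dg 2-operads all of whose components are quasi-isomorphisms of complexes. -/

import Mathlib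

open CategoryTheory Finset

noncomputable section

namespace TwoOperads

universe u

/-! ## 2-disks (pruned 2-trees, 2-ordinals) and their maps -/

/-- The 2-disk `(n_1, …, n_k)`: `k ≥ 1` columns, the `i`-th one of height `n_i ≥ 1`.
It is the pruned 2-tree with `k` vertices of level 1 and `n_i` leaves over the `i`-th of them. -/
structure TwoDisk where
  width : ℕ
  width_pos : 0 < width
  height : Fin width → ℕ
  height_pos : ∀ i, 0 < height i

/-- The minimal balls of a 2-disk (the leaves of the 2-tree).
The column `π(ν)` of a minimal ball `ν` is `ν.1`, its height within the column is `ν.2`. -/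
abbrev TwoDisk.Ball (U : TwoDisk) : Type := Σ i : Fin U.width, Fin (U.height i)

/-- The planar (lexicographic) total order of the leaves, in its strict form. -/
def TwoDisk.Before (U : TwoDisk) (x y : U.Ball) : Prop :=
  x.1 < y.1 ∨ (x.1 = y.1 ∧ x.2.val < y.2.val)

instance (U : TwoDisk) : DecidableRel U.Before :=
  fun x y => inferInstanceAs (Decidable (x.1 < y.1 ∨ (x.1 = y.1 ∧ x.2.val < y.2.val)))

/-- The one-leaf 2-disk `(1)`, the final pruned 2-tree. -/
def TwoDisk.point : TwoDisk where
  width := 1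
  width_pos := Nat.one_pos
  height := fun _ => 1
  height_pos := fun _ => Nat.one_pos

/-- A map of pruned 2-trees, given by its effect on leaves: it is monotone on columns
(in particular it maps a column into a column), and monotone within every column; it need not
be monotone for the planar order. -/
@[ext] structure TwoDisk.Hom (T S : TwoDisk) where
  toFun : T.Ball → S.Ball
  col_mono : ∀ x y : T.Ball, x.1 ≤ y.1 → (toFun x).1 ≤ (toFun y).1
  mono_in_col : ∀ x y : T.Ball, x.1 = y.1 → x.2.val ≤ y.2.val →
    (toFun x).2.val ≤ (toFun y).2.val

/-- `Fibres σ F` says that the (prunised) fibre of `σ : T ⟶ S` over the leaf `μ` of `S` is the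
2-disk `F μ`: a leaf embedding `incl μ` identifies `F μ` with the set `σ ⁻¹ μ` of leaves of `T`,
with the structure induced from `T`. As 2-disks have no nontrivial automorphisms, `F` and `incl`
are determined by `σ`; they exist exactly when `σ` is surjective. -/
structure Fibres {T S : TwoDisk} (σ : T.Hom S) (F : S.Ball → TwoDisk) where
  incl : ∀ μ, (F μ).Ball → T.Ball
  col_lt_iff : ∀ μ x y, (incl μ x).1 < (incl μ y).1 ↔ x.1 < y.1
  lt_in_col_iff : ∀ μ x y, ((incl μ x).1 = (incl μ y).1 ∧ (incl μ x).2.val < (incl μ y).2.val) ↔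
    (x.1 = y.1 ∧ x.2.val < y.2.val)
  map_incl : ∀ μ x, σ.toFun (incl μ x) = μ
  exists_incl : ∀ t, ∃ x, incl (σ.toFun t) x = t

/-! ## Tamarkin's simplicial 2-operad `seq` -/

/-- The disjoint union of the ordinals `I_ν = [k ν] = {0 < … < k ν}` over the minimal balls. -/
abbrev Elems (U : TwoDisk) (k : U.Ball → ℕ) : Type := Σ ν : U.Ball, Fin (k ν + 1)

/-- The set `seq(U)({[k ν]}_ν; [s])`: a total order on `⊔_ν [k ν]` subject to three conditions,
and a monotone map `W` from this totally ordered set to `[s]`. -/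
@[ext] structure Seq (U : TwoDisk) (k : U.Ball → ℕ) (s : ℕ) where
  le : Elems U k → Elems U k → Prop
  le_refl : ∀ x, le x x
  le_trans : ∀ x y z, le x y → le y z → le x z
  le_antisymm : ∀ x y, le x y → le y x → x = y
  le_total : ∀ x y, le x y ∨ le y x
  /-- (1) the order agrees with the order of every `I_ν` -/
  le_of_le : ∀ ν (i j : Fin (k ν + 1)), i ≤ j → le ⟨ν, i⟩ ⟨ν, j⟩
  /-- (2) in one column, a lower ball comes first -/
  same_col : ∀ ν₁ ν₂ : U.Ball, ν₁.1 = ν₂.1 → ν₁.2.val < ν₂.2.val →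
    ∀ i j, le ⟨ν₁, i⟩ ⟨ν₂, j⟩
  /-- (3) for different columns, `I_ν₁ < I_ν₂`, or `I_ν₂ < I_ν₁`, or `I_ν₁` is inserted between
  `[0, a]` and `[a + 1, n]`, where `I_ν₂ = [n]` and `0 ≤ a < n` (the brace) -/
  diff_col : ∀ ν₁ ν₂ : U.Ball, ν₁.1 < ν₂.1 →
    (∀ i j, le ⟨ν₁, i⟩ ⟨ν₂, j⟩) ∨ (∀ i j, le ⟨ν₂, j⟩ ⟨ν₁, i⟩) ∨
    ∃ a : ℕ, a < k ν₂ ∧ (∀ i (j : Fin (k ν₂ + 1)), j.val ≤ a → le ⟨ν₂, j⟩ ⟨ν₁, i⟩) ∧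
      (∀ i (j : Fin (k ν₂ + 1)), a < j.val → le ⟨ν₁, i⟩ ⟨ν₂, j⟩)
  W : Elems U k → Fin (s + 1)
  W_mono : ∀ x y, le x y → W x ≤ W y

instance (U : TwoDisk) (k : U.Ball → ℕ) (s : ℕ) : Fintype (Seq U k s) :=
  Fintype.ofInjective
    (β := (Set (Elems U k × Elems U k)) × (Elems U k → Fin (s + 1)))
    (fun w => ({p | w.le p.1 p.2}, w.W)) (by
      intro v w h
      obtain ⟨h1, h2⟩ := Prod.mk.inj h
      refine Seq.ext ?_ h2
      funext x y
      exact propext (Set.ext_iff.mp h1 (x, y)))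

namespace Seq

variable {U : TwoDisk} {k k' : U.Ball → ℕ} {s s' : ℕ}

/-- Covariance of `seq(U)({I_ν}; J)` in `J`. -/
def push (ψ : Fin (s + 1) →o Fin (s' + 1)) (w : Seq U k s) : Seq U k s' where
  le := w.le
  le_refl := w.le_refl
  le_trans := w.le_trans
  le_antisymm := w.le_antisymm
  le_total := w.le_total
  le_of_le := w.le_of_le
  same_col := w.same_col
  diff_col := w.diff_col
  W := fun x => ψ (w.W x)
  W_mono := fun x y h => ψ.monotone (w.W_mono x y h)

/-- The map of disjoint unions given by a family of maps of ordinals. -/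
def elemsMap (φ : ∀ ν, Fin (k' ν + 1) →o Fin (k ν + 1)) (x : Elems U k') : Elems U k :=
  ⟨x.1, φ x.1 x.2⟩

/-- Contravariance of `seq(U)({I_ν}; J)` in the `I_ν`: the total order is pulled back,
elements with the same image being ordered as in their `I_ν`. -/
def pull (φ : ∀ ν, Fin (k' ν + 1) →o Fin (k ν + 1)) (w : Seq U k s) : Seq U k' s where
  le := fun x y => (w.le (elemsMap φ x) (elemsMap φ y) ∧ elemsMap φ x ≠ elemsMap φ y) ∨
    (elemsMap φ x = elemsMap φ y ∧ x.2.val ≤ y.2.val)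
  le_refl := fun x => Or.inr ⟨rfl, le_rfl⟩
  le_trans := by
    rintro x y z (⟨h1, h2⟩ | ⟨h1, h2⟩) (⟨h3, h4⟩ | ⟨h3, h4⟩)
    · refine Or.inl ⟨w.le_trans _ _ _ h1 h3, fun h => h2 ?_⟩
      rw [← h] at h3
      exact w.le_antisymm _ _ h1 h3
    · rw [h3] at h1 h2
      exact Or.inl ⟨h1, h2⟩
    · rw [← h1] at h3 h4
      exact Or.inl ⟨h3, h4⟩
    · exact Or.inr ⟨h1.trans h3, h2.trans h4⟩
  le_antisymm := by
    rintro x y (⟨h1, h2⟩ | ⟨h1, h2⟩) (⟨h3, h4⟩ | ⟨h3, h4⟩)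
    · exact absurd (w.le_antisymm _ _ h1 h3) h2
    · exact absurd h3.symm h2
    · exact absurd h1.symm h4
    · obtain ⟨ν, i⟩ := x
      obtain ⟨ν', j⟩ := y
      obtain rfl : ν = ν' := congrArg Sigma.fst h1
      have : i = j := Fin.ext (_root_.le_antisymm h2 h4)
      rw [this]
  le_total := by
    intro x y
    by_cases h : elemsMap φ x = elemsMap φ y
    · rcases Nat.le_total x.2.val y.2.val with h' | h'
      · exact Or.inl (Or.inr ⟨h, h'⟩)
      · exact Or.inr (Or.inr ⟨h.symm, h'⟩)
    · rcases w.le_total (elemsMap φ x) (elemsMap φ y) with h' | h'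
      · exact Or.inl (Or.inl ⟨h', h⟩)
      · exact Or.inr (Or.inl ⟨h', fun e => h e.symm⟩)
  le_of_le := by
    intro ν i j h
    by_cases e : elemsMap φ ⟨ν, i⟩ = elemsMap φ ⟨ν, j⟩
    · exact Or.inr ⟨e, h⟩
    · exact Or.inl ⟨w.le_of_le ν _ _ ((φ ν).monotone h), e⟩
  same_col := by
    intro ν₁ ν₂ h1 h2 i j
    refine Or.inl ⟨w.same_col ν₁ ν₂ h1 h2 _ _, fun e => ?_⟩
    have e' : ν₁ = ν₂ := congrArg Sigma.fst e
    subst e'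
    exact lt_irrefl _ h2
  diff_col := by
    intro ν₁ ν₂ h
    have ne : ∀ i j, elemsMap φ ⟨ν₁, i⟩ ≠ elemsMap φ ⟨ν₂, j⟩ := by
      intro i j e
      have e' : ν₁ = ν₂ := congrArg Sigma.fst e
      subst e'
      exact lt_irrefl _ h
    rcases w.diff_col ν₁ ν₂ h with h1 | h1 | ⟨a, ha, h1, h2⟩
    · exact Or.inl fun i j => Or.inl ⟨h1 _ _, ne _ _⟩
    · exact Or.inr (Or.inl fun i j => Or.inl ⟨h1 _ _, (ne _ _).symm⟩)
    · by_cases hall : ∀ j : Fin (k' ν₂ + 1), (φ ν₂ j).val ≤ a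
      · exact Or.inr (Or.inl fun i j => Or.inl ⟨h1 _ _ (hall j), (ne _ _).symm⟩)
      by_cases hnone : ∀ j : Fin (k' ν₂ + 1), a < (φ ν₂ j).val
      · exact Or.inl fun i j => Or.inl ⟨h2 _ _ (hnone j), ne _ _⟩
      push Not at hall hnone
      obtain ⟨j₁, hj₁⟩ := hall
      obtain ⟨j₀, hj₀⟩ := hnone
      -- the last element of `[k' ν₂]` that is mapped into `[0, a]`
      obtain ⟨b, hb, hmax⟩ := Finset.exists_max_image
        (univ.filter fun j : Fin (k' ν₂ + 1) => (φ ν₂ j).val ≤ a) (fun j => j.val)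
        ⟨j₀, by simpa using hj₀⟩
      simp only [mem_filter, mem_univ, true_and] at hb hmax
      refine Or.inr (Or.inr ⟨b.val, ?_, fun i j hj => ?_, fun i j hj => ?_⟩)
      · have hbj : b.val < j₁.val := by
          by_contra hc
          have := (φ ν₂).monotone (show j₁ ≤ b from not_lt.mp hc)
          have : (φ ν₂ j₁).val ≤ (φ ν₂ b).val := this
          omega
        have := j₁.isLt
        omega
      · have : (φ ν₂ j).val ≤ (φ ν₂ b).val := (φ ν₂).monotone hj
        exact Or.inl ⟨h1 _ _ (this.trans hb), (ne _ _).symm⟩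
      · have : a < (φ ν₂ j).val := by
          by_contra hc
          have := hmax j (not_lt.mp hc)
          omega
        exact Or.inl ⟨h2 _ _ this, ne _ _⟩
  W := fun x => w.W (elemsMap φ x)
  W_mono := by
    rintro x y (⟨h1, h2⟩ | ⟨h1, h2⟩)
    · exact w.W_mono _ _ h1
    · rw [h1]

end Seq

/-- The strictly increasing map of natural numbers that misses exactly `j`. -/
def skip (j i : ℕ) : ℕ := if i < j then i else i + 1

theorem skip_mono (j : ℕ) {a b : ℕ} (h : a ≤ b) : skip j a ≤ skip j b := by
  unfold skip; split_ifs <;> omega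

theorem skip_le (j i : ℕ) : skip j i ≤ i + 1 := by
  unfold skip; split_ifs <;> omega

theorem skip_inj (j : ℕ) {a b : ℕ} (h : skip j a = skip j b) : a = b := by
  unfold skip at h; split_ifs at h <;> omega

theorem skip_skip {i j : ℕ} (h : i ≤ j) (a : ℕ) :
    skip (j + 1) (skip i a) = skip i (skip j a) := by
  unfold skip; split_ifs <;> omega

/-- The coface map `δ^j : [s] → [s + 1]`, `j = 0, …, s + 1`. -/
def coface (s j : ℕ) : Fin (s + 1) →o Fin (s + 1 + 1) where
  toFun := fun i => ⟨skip j i, by have := skip_le j i; omega⟩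
  monotone' := fun _ _ h => skip_mono j h

section Faces

variable {U : TwoDisk}

/-- Raise the dimension of the ordinal `I_ν` by one. -/
def raise (k : U.Ball → ℕ) (ν : U.Ball) : U.Ball → ℕ := Function.update k ν (k ν + 1)

theorem raise_self (k : U.Ball → ℕ) (ν : U.Ball) : raise k ν ν = k ν + 1 := by
  simp [raise]

theorem raise_of_ne (k : U.Ball → ℕ) {ν ν' : U.Ball} (h : ν' ≠ ν) : raise k ν ν' = k ν' := by
  simp [raise, h]

/-- The family of maps of ordinals that is `δ^j` for `ν` and the identity for the other balls. -/
def cofaceAt (k : U.Ball → ℕ) (ν : U.Ball) (j : ℕ) (ν' : U.Ball) :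
    Fin (k ν' + 1) →o Fin (raise k ν ν' + 1) where
  toFun := fun i => ⟨if ν' = ν then skip j i else i, by
    by_cases h : ν' = ν
    · subst h
      have := skip_le j i
      have := raise_self k ν'
      simp only [if_true]
      omega
    · have := raise_of_ne k h
      simp only [h, if_false]
      omega⟩
  monotone' := fun a b h => by
    by_cases e : ν' = ν
    · simp only [e, if_true]
      exact skip_mono j h
    · simp only [e, if_false]
      exact h

/-- The `j`-th face in the simplicial variable `I_ν`. -/
def Seq.face {k : U.Ball → ℕ} {s : ℕ} (ν : U.Ball) (j : ℕ) (w : Seq U (raise k ν) s) :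
    Seq U k s :=
  w.pull (cofaceAt k ν j)

end Faces

/-! ### The 2-operadic composition of `seq` -/

section Composition

variable {T S : TwoDisk} {σ : T.Hom S} {F : S.Ball → TwoDisk}

theorem Fibres.incl_injective (ι : Fibres σ F) (μ : S.Ball) : Function.Injective (ι.incl μ) := by
  intro x y h
  have h1 := ι.col_lt_iff μ x y
  have h2 := ι.col_lt_iff μ y x
  have h3 := ι.lt_in_col_iff μ x y
  have h4 := ι.lt_in_col_iff μ y x
  rw [h] at h1 h2 h3 h4
  simp only [lt_irrefl, and_false, false_iff, not_lt, not_and] at h1 h2 h3 h4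
  obtain ⟨i, a⟩ := x
  obtain ⟨j, b⟩ := y
  obtain rfl : i = j := le_antisymm h2 h1
  have h3 := h3 rfl
  have h4 := h4 rfl
  have : a = b := Fin.ext (le_antisymm h4 h3)
  rw [this]

/-- The disjoint union over `T` is the disjoint union, over the leaves `μ` of `S`, of the
disjoint unions over the fibres. -/
def Fibres.toElems (ι : Fibres σ F) (k : T.Ball → ℕ)
    (z : Σ μ, Elems (F μ) (fun x => k (ι.incl μ x))) : Elems T k :=
  ⟨ι.incl z.1 z.2.1, z.2.2⟩

theorem Fibres.toElems_bijective (ι : Fibres σ F) (k : T.Ball → ℕ) :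
    Function.Bijective (ι.toElems k) := by
  constructor
  · rintro ⟨μ, x, i⟩ ⟨μ', x', i'⟩ h
    have h1 : ι.incl μ x = ι.incl μ' x' := congrArg Sigma.fst h
    obtain rfl : μ = μ' := by rw [← ι.map_incl μ x, h1, ι.map_incl]
    obtain rfl : x = x' := ι.incl_injective μ h1
    have h2 : i = i' := by
      unfold Fibres.toElems at h
      simpa using h
    rw [h2]
  · rintro ⟨t, i⟩
    obtain ⟨x, hx⟩ := ι.exists_incl t
    have key : ∀ t' (_ : t' = t) , ∃ i' : Fin (k t' + 1), (⟨t', i'⟩ : Elems T k) = ⟨t, i⟩ := by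
      rintro t' rfl
      exact ⟨i, rfl⟩
    obtain ⟨i', hi'⟩ := key _ hx
    exact ⟨⟨σ.toFun t, x, i'⟩, hi'⟩

/-- The decomposition of the disjoint union over `T` along the fibres. -/
def Fibres.elemsEquiv (ι : Fibres σ F) (k : T.Ball → ℕ) :
    (Σ μ, Elems (F μ) (fun x => k (ι.incl μ x))) ≃ Elems T k :=
  Equiv.ofBijective _ (ι.toElems_bijective k)

variable {J : S.Ball → ℕ} {k : T.Ball → ℕ} {s : ℕ}

/-- The position in the middle disjoint union `⊔_μ [J μ]` of an element of `⊔_ν [k ν]`. -/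
def compPos {ι : Fibres σ F} (w : ∀ μ, Seq (F μ) (fun x => k (ι.incl μ x)) (J μ))
    (z : Σ μ, Elems (F μ) (fun x => k (ι.incl μ x))) : Elems S J :=
  ⟨z.1, (w z.1).W z.2⟩

/-- The total order of `⊔_μ [J μ]` pulled back along the maps `W_μ`: elements with the same
image lie over the same `μ`, and are ordered as in the total order given by `w μ`. -/
def compLe {ι : Fibres σ F} (v : Seq S J s)
    (w : ∀ μ, Seq (F μ) (fun x => k (ι.incl μ x)) (J μ))
    (z z' : Σ μ, Elems (F μ) (fun x => k (ι.incl μ x))) : Prop :=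
  (v.le (compPos w z) (compPos w z') ∧ compPos w z ≠ compPos w z') ∨
    (compPos w z = compPos w z' ∧ ∃ μ x y, z = ⟨μ, x⟩ ∧ z' = ⟨μ, y⟩ ∧ (w μ).le x y)

theorem compLe_same {ι : Fibres σ F} (v : Seq S J s)
    (w : ∀ μ, Seq (F μ) (fun x => k (ι.incl μ x)) (J μ)) (μ : S.Ball)
    (x y : Elems (F μ) (fun x => k (ι.incl μ x))) :
    compLe v w ⟨μ, x⟩ ⟨μ, y⟩ ↔ (w μ).le x y := by
  constructor
  · rintro (⟨h1, h2⟩ | ⟨h1, ν, a, b, ha, hb, h2⟩)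
    · rcases (w μ).le_total x y with h | h
      · exact h
      · have h3 : v.le (compPos w ⟨μ, y⟩) (compPos w ⟨μ, x⟩) :=
          v.le_of_le μ _ _ ((w μ).W_mono _ _ h)
        exact absurd (v.le_antisymm _ _ h1 h3) h2
    · cases ha
      cases hb
      exact h2
  · intro h
    by_cases e : compPos w (⟨μ, x⟩ : Σ μ, Elems (F μ) (fun x => k (ι.incl μ x))) =
        compPos w ⟨μ, y⟩
    · exact Or.inr ⟨e, μ, x, y, rfl, rfl, h⟩
    · exact Or.inl ⟨v.le_of_le μ _ _ ((w μ).W_mono _ _ h), e⟩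

theorem compLe_diff {ι : Fibres σ F} (v : Seq S J s)
    (w : ∀ μ, Seq (F μ) (fun x => k (ι.incl μ x)) (J μ))
    (z z' : Σ μ, Elems (F μ) (fun x => k (ι.incl μ x))) (h : z.1 ≠ z'.1) :
    compLe v w z z' ↔ v.le (compPos w z) (compPos w z') := by
  have ne : compPos w z ≠ compPos w z' := fun e =>
    h (congrArg (fun p : Elems S J => p.1) e)
  constructor
  · rintro (⟨h1, -⟩ | ⟨h1, -⟩)
    · exact h1
    · exact absurd h1 ne
  · exact fun h1 => Or.inl ⟨h1, ne⟩

theorem compLe_pos {ι : Fibres σ F} (v : Seq S J s)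
    (w : ∀ μ, Seq (F μ) (fun x => k (ι.incl μ x)) (J μ))
    (z z' : Σ μ, Elems (F μ) (fun x => k (ι.incl μ x))) (h : compLe v w z z') :
    v.le (compPos w z) (compPos w z') := by
  rcases h with ⟨h1, -⟩ | ⟨h1, -⟩
  · exact h1
  · rw [h1]
    exact v.le_refl _

theorem Fibres.symm_toElems (ι : Fibres σ F) (k : T.Ball → ℕ) (μ : S.Ball) (x : (F μ).Ball)
    (i : Fin (k (ι.incl μ x) + 1)) :
    (ι.elemsEquiv k).symm ⟨ι.incl μ x, i⟩ = ⟨μ, x, i⟩ :=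
  (ι.elemsEquiv k).symm_apply_apply ⟨μ, x, i⟩

theorem Fibres.exists_eq (ι : Fibres σ F) (t : T.Ball) : ∃ μ x, t = ι.incl μ x := by
  obtain ⟨x, hx⟩ := ι.exists_incl t
  exact ⟨_, x, hx.symm⟩

/-- The 2-operadic composition of `seq`, for a map `σ : T ⟶ S` of 2-trees with fibres `F μ`:
`v` is the total order on `⊔_μ [J μ]` with its map to `[s]`, and `w μ` is the total order on the
disjoint union over the fibre `F μ`, with its map to `[J μ]`. -/
def Seq.comp (ι : Fibres σ F) (v : Seq S J s)
    (w : ∀ μ, Seq (F μ) (fun x => k (ι.incl μ x)) (J μ)) : Seq T k s where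
  le := fun a b => compLe v w ((ι.elemsEquiv k).symm a) ((ι.elemsEquiv k).symm b)
  le_refl := fun a => (compLe_same v w _ _ _).2 ((w _).le_refl _)
  le_trans := by
    intro a b c
    generalize (ι.elemsEquiv k).symm a = x
    generalize (ι.elemsEquiv k).symm b = y
    generalize (ι.elemsEquiv k).symm c = z
    intro h1 h2
    obtain ⟨μ, x⟩ := x
    obtain ⟨μ', y⟩ := y
    obtain ⟨μ'', z⟩ := z
    have h3 := v.le_trans _ _ _ (compLe_pos v w _ _ h1) (compLe_pos v w _ _ h2)
    by_cases e : μ = μ''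
    · subst e
      by_cases e' : μ = μ'
      · subst e'
        rw [compLe_same] at h1 h2 ⊢
        exact (w μ).le_trans _ _ _ h1 h2
      · refine Or.inl ⟨h3, fun e => ?_⟩
        have h4 := compLe_pos v w _ _ h2
        rw [← e] at h4
        exact e' (congrArg Sigma.fst (v.le_antisymm _ _ (compLe_pos v w _ _ h1) h4))
    · exact (compLe_diff v w _ _ e).2 h3
  le_antisymm := by
    intro a b h1 h2
    apply (ι.elemsEquiv k).symm.injective
    revert h1 h2
    generalize (ι.elemsEquiv k).symm a = x
    generalize (ι.elemsEquiv k).symm b = y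
    intro h1 h2
    obtain ⟨μ, x⟩ := x
    obtain ⟨μ', y⟩ := y
    obtain rfl : μ = μ' := congrArg Sigma.fst
      (v.le_antisymm _ _ (compLe_pos v w _ _ h1) (compLe_pos v w _ _ h2))
    rw [compLe_same] at h1 h2
    rw [(w μ).le_antisymm _ _ h1 h2]
  le_total := by
    intro a b
    generalize (ι.elemsEquiv k).symm a = x
    generalize (ι.elemsEquiv k).symm b = y
    obtain ⟨μ, x⟩ := x
    obtain ⟨μ', y⟩ := y
    by_cases e : μ = μ'
    · subst e
      rw [compLe_same, compLe_same]
      exact (w μ).le_total x y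
    · rw [compLe_diff v w _ _ e, compLe_diff v w _ _ (Ne.symm e)]
      exact v.le_total _ _
  le_of_le := by
    intro t i j h
    obtain ⟨μ, x, rfl⟩ := ι.exists_eq t
    rw [ι.symm_toElems, ι.symm_toElems, compLe_same]
    exact (w μ).le_of_le x _ _ h
  same_col := by
    intro t₁ t₂ h1 h2 i j
    obtain ⟨μ₁, x₁, rfl⟩ := ι.exists_eq t₁
    obtain ⟨μ₂, x₂, rfl⟩ := ι.exists_eq t₂
    rw [ι.symm_toElems, ι.symm_toElems]
    by_cases e : μ₁ = μ₂
    · subst e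
      rw [compLe_same]
      have h3 := (ι.lt_in_col_iff μ₁ x₁ x₂).1 ⟨h1, h2⟩
      exact (w μ₁).same_col x₁ x₂ h3.1 h3.2 _ _
    · rw [compLe_diff v w _ _ e]
      have h3 := σ.col_mono _ _ (le_of_eq h1)
      have h4 := σ.col_mono _ _ (ge_of_eq h1)
      have h5 := σ.mono_in_col _ _ h1 h2.le
      rw [ι.map_incl, ι.map_incl] at h3 h4 h5
      have h6 : μ₁.1 = μ₂.1 := _root_.le_antisymm h3 h4
      refine v.same_col μ₁ μ₂ h6 (lt_of_le_of_ne h5 fun h7 => e ?_) _ _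
      obtain ⟨a, b⟩ := μ₁
      obtain ⟨c, d⟩ := μ₂
      obtain rfl : a = c := h6
      obtain rfl : b = d := Fin.ext h7
      rfl
  diff_col := by
    intro t₁ t₂ h1
    obtain ⟨μ₁, x₁, rfl⟩ := ι.exists_eq t₁
    obtain ⟨μ₂, x₂, rfl⟩ := ι.exists_eq t₂
    simp only [ι.symm_toElems]
    by_cases e : μ₁ = μ₂
    · subst e
      simp only [compLe_same]
      exact (w μ₁).diff_col x₁ x₂ ((ι.col_lt_iff μ₁ x₁ x₂).1 h1)
    · simp only [compLe_diff v w ⟨μ₁, _⟩ ⟨μ₂, _⟩ e,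
        compLe_diff v w ⟨μ₂, _⟩ ⟨μ₁, _⟩ (Ne.symm e)]
      have h3 := σ.col_mono _ _ h1.le
      rw [ι.map_incl, ι.map_incl] at h3
      rcases h3.lt_or_eq with h4 | h4
      · rcases v.diff_col μ₁ μ₂ h4 with h5 | h5 | ⟨a, ha, h5, h6⟩
        · exact Or.inl fun i j => h5 _ _
        · exact Or.inr (Or.inl fun i j => h5 _ _)
        · -- the elements of the chain over `x₂` that are mapped into `[0, a]`
          let g : Fin (k (ι.incl μ₂ x₂) + 1) → ℕ := fun j => ((w μ₂).W ⟨x₂, j⟩).val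
          have hg : ∀ i j, i ≤ j → g i ≤ g j := fun i j h =>
            (w μ₂).W_mono _ _ ((w μ₂).le_of_le x₂ i j h)
          by_cases hall : ∀ j, g j ≤ a
          · exact Or.inr (Or.inl fun i j => h5 _ _ (hall j))
          by_cases hnone : ∀ j, a < g j
          · exact Or.inl fun i j => h6 _ _ (hnone j)
          push Not at hall hnone
          obtain ⟨j₁, hj₁⟩ := hall
          obtain ⟨j₀, hj₀⟩ := hnone
          obtain ⟨b, hb, hmax⟩ := Finset.exists_max_image
            (univ.filter fun j => g j ≤ a) (fun j => j.val) ⟨j₀, by simpa using hj₀⟩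
          simp only [mem_filter, mem_univ, true_and] at hb hmax
          refine Or.inr (Or.inr ⟨b.val, ?_, fun i j hj => ?_, fun i j hj => ?_⟩)
          · have hbj : b.val < j₁.val := by
              by_contra hc
              have := hg j₁ b (not_lt.mp hc)
              omega
            have := j₁.isLt
            omega
          · exact h5 _ _ ((hg j b hj).trans hb)
          · refine h6 _ _ ?_
            by_contra hc
            have := hmax j (not_lt.mp hc)
            omega
      · rcases Nat.lt_trichotomy μ₁.2.val μ₂.2.val with h5 | h5 | h5
        · exact Or.inl fun i j => v.same_col μ₁ μ₂ h4 h5 _ _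
        · refine absurd ?_ e
          obtain ⟨a, b⟩ := μ₁
          obtain ⟨c, d⟩ := μ₂
          obtain rfl : a = c := h4
          obtain rfl : b = d := Fin.ext h5
          rfl
        · exact Or.inr (Or.inl fun i j => v.same_col μ₂ μ₁ h4.symm h5 _ _)
  W := fun a => v.W (compPos w ((ι.elemsEquiv k).symm a))
  W_mono := fun a b h => v.W_mono _ _ (compLe_pos v w _ _ h)

end Composition

/-! ## The complexes `|seq|(U)`, `Breq(U)` and `Nor(Breq)(U)` -/

section PushForward

variable {𝕜 : Type u} [Field 𝕜]

open Classical in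
/-- Identify a function on a finite set with the linear combination of the elements of the set
that has the values as coefficients; `pushForward g` is the linear extension of `g`. -/
def pushForward {A B : Type} [Fintype A] (g : A → B) (f : A → 𝕜) (b : B) : 𝕜 :=
  ∑ a, if g a = b then f a else 0

theorem pushForward_comp {A B C : Type} [Fintype A] [Fintype B] (g : A → B) (h : B → C)
    (f : A → 𝕜) : pushForward h (pushForward g f) = pushForward (fun a => h (g a)) f := by
  funext c
  unfold pushForward
  simp_rw [← Finset.sum_filter]
  rw [Finset.sum_sigma']
  refine Finset.sum_bij' (fun x _ => x.2) (fun a _ => ⟨g a, a⟩) ?_ ?_ ?_ ?_ ?_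
  · rintro ⟨b, a⟩ h
    simp only [mem_sigma, mem_filter, mem_univ, true_and] at h ⊢
    rw [h.2, h.1]
  · intro a h
    simpa using h
  · rintro ⟨b, a⟩ h
    simp only [mem_sigma, mem_filter, mem_univ, true_and] at h
    simp [h.2]
  · intros; rfl
  · intros; rfl

theorem pushForward_add {A B : Type} [Fintype A] (g : A → B) (f f' : A → 𝕜) :
    pushForward g (fun a => f a + f' a) = fun b => pushForward g f b + pushForward g f' b := by
  funext b
  simp only [pushForward, ← Finset.sum_add_distrib]
  refine Finset.sum_congr rfl fun a _ => ?_
  split_ifs <;> simp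

theorem pushForward_mul {A B : Type} [Fintype A] (g : A → B) (c : 𝕜) (f : A → 𝕜) :
    pushForward g (fun a => c * f a) = fun b => c * pushForward g f b := by
  funext b
  simp only [pushForward, Finset.mul_sum]
  refine Finset.sum_congr rfl fun a _ => ?_
  split_ifs <;> simp

theorem pushForward_sum {A B I : Type} [Fintype A] (g : A → B) (t : Finset I) (f : I → A → 𝕜) :
    pushForward g (fun a => ∑ i ∈ t, f i a) = fun b => ∑ i ∈ t, pushForward g (f i) b := by
  funext b
  simp only [pushForward]
  rw [Finset.sum_comm]
  refine Finset.sum_congr rfl fun a _ => ?_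
  split_ifs <;> simp

theorem exists_of_pushForward_ne_zero {A B : Type} [Fintype A] {g : A → B} {f : A → 𝕜} {b : B}
    (h : pushForward g f b ≠ 0) : ∃ a, g a = b ∧ f a ≠ 0 := by
  obtain ⟨a, -, ha⟩ := Finset.exists_ne_zero_of_sum_ne_zero h
  refine ⟨a, ?_⟩
  by_cases e : g a = b
  · exact ⟨e, by simpa [e] using ha⟩
  · simp [e] at ha

/-- The cancellation behind the vanishing of the square of an alternating sum of (co)faces. -/
theorem alternating_sum_eq_zero (n : ℕ) (A : ℕ → ℕ → 𝕜)
    (hA : ∀ i j, i ≤ j → j < n → A i (j + 1) = A j i) :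
    ∑ j ∈ range (n + 1), ∑ i ∈ range n, (-1 : 𝕜) ^ j * ((-1) ^ i * A i j) = 0 := by
  rw [← Finset.sum_product']
  refine Finset.sum_involution
    (fun p _ => if p.2 < p.1 then (p.2, p.1 - 1) else (p.2 + 1, p.1)) ?_ ?_ ?_ ?_
  · rintro ⟨j, i⟩ h
    simp only [mem_product, mem_range] at h
    by_cases hij : i < j
    · obtain ⟨m, rfl⟩ : ∃ m, j = m + 1 := ⟨j - 1, by omega⟩
      simp only [hij, if_true, Nat.add_sub_cancel]
      rw [hA i m (by omega) (by omega)]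
      ring
    · simp only [hij, if_false]
      rw [hA j i (by omega) (by omega)]
      ring
  · rintro ⟨j, i⟩ h -
    dsimp only
    split_ifs with hij
    · intro e
      have := congrArg Prod.fst e
      dsimp only at this
      omega
    · intro e
      have := congrArg Prod.fst e
      dsimp only at this
      omega
  · rintro ⟨j, i⟩ h
    simp only [mem_product, mem_range] at h ⊢
    split_ifs with hij
    · dsimp only
      omega
    · dsimp only
      omega
  · rintro ⟨j, i⟩ h
    dsimp only
    split_ifs with h1 h2 h2
    · dsimp only at h2
      omega
    · exact Prod.ext (by dsimp only; omega) (by dsimp only)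
    · exact Prod.ext (by dsimp only) (by dsimp only; omega)
    · dsimp only at h2
      omega

end PushForward

section Differentials

variable (𝕜 : Type u) [Field 𝕜] (U : TwoDisk)

/-- Functions on the cells `w ∈ seq(U)({[k ν]}; [s])` with `s` fixed; such a function stands for
the (possibly infinite) linear combination of the cells with the given coefficients. -/
abbrev Column (s : ℕ) : Type u := (k : U.Ball → ℕ) → Seq U k s → 𝕜

/-- Functions on all the cells `w ∈ seq(U)({[k ν]}; [s])`. -/
abbrev Cochains : Type u := (s : ℕ) → Column 𝕜 U s

variable {𝕜} {U}

/-- The sign `(-1) ^ (∑ k ν')`, over the balls `ν'` preceding `ν`. -/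
def koszulBefore (k : U.Ball → ℕ) (ν : U.Ball) : 𝕜 :=
  (-1) ^ (∑ ν', if U.Before ν' ν then k ν' else 0)

/-- The differential of the total complex of a polysimplicial vector space: the sum over `ν` of
the alternating sums of the faces in the variable `I_ν`, with the Koszul signs. -/
def faceSum {s : ℕ} (f : Column 𝕜 U s) : Column 𝕜 U s := fun k w =>
  ∑ ν, koszulBefore k ν *
    ∑ j ∈ range (k ν + 2), (-1) ^ j * pushForward (Seq.face ν j) (f (raise k ν)) w

/-- The alternating sum of the cofaces in the cosimplicial variable `J`. -/
def cofaceSum (f : Cochains 𝕜 U) : Cochains 𝕜 U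
  | 0, _, _ => 0
  | s + 1, k, w => ∑ j ∈ range (s + 2), (-1) ^ j * pushForward (Seq.push (coface s j)) (f s k) w

theorem cofaceSum_cofaceSum (f : Cochains 𝕜 U) : cofaceSum (cofaceSum f) = 0 := by
  funext s k w
  match s with
  | 0 => rfl
  | 1 =>
    simp only [cofaceSum, Pi.zero_apply]
    refine Finset.sum_eq_zero fun j _ => ?_
    have : pushForward (𝕜 := 𝕜) (Seq.push (U := U) (k := k) (coface 0 j)) (fun _ => 0) w = 0 := by
      simp [pushForward]
    rw [show cofaceSum f 0 k = fun _ => 0 from rfl, this, mul_zero]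
  | s + 2 =>
    have h1 : cofaceSum f (s + 1) k = fun w => ∑ i ∈ range (s + 2),
      (-1) ^ i * pushForward (Seq.push (coface s i)) (f s k) w := rfl
    change ∑ j ∈ range (s + 2 + 1),
      (-1) ^ j * pushForward (Seq.push (coface (s + 1) j)) (cofaceSum f (s + 1) k) w = 0
    rw [h1]
    simp_rw [pushForward_sum, pushForward_mul, pushForward_comp, Finset.mul_sum]
    refine alternating_sum_eq_zero (s + 2) (fun i j => pushForward
      (fun v => Seq.push (coface (s + 1) j) (Seq.push (coface s i) v)) (f s k) w) ?_
    intro i j hij _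
    congr 1
    funext v
    refine Seq.ext rfl ?_
    funext x
    exact Fin.ext (skip_skip hij _)

theorem cofaceAt_injective (k : U.Ball → ℕ) (ν : U.Ball) (j : ℕ) :
    Function.Injective (Seq.elemsMap (cofaceAt k ν j)) := by
  rintro ⟨ν₁, a⟩ ⟨ν₂, b⟩ e
  have e1 : ν₁ = ν₂ := congrArg Sigma.fst e
  subst e1
  have e2 : (cofaceAt k ν j ν₁ a) = (cofaceAt k ν j ν₁ b) := by
    simpa [Seq.elemsMap] using e
  have e3 := congrArg Fin.val e2
  simp only [cofaceAt] at e3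
  have e4 : a = b := by
    refine Fin.ext ?_
    split_ifs at e3
    · exact skip_inj j e3
    · exact e3
  rw [e4]

theorem face_le {k : U.Ball → ℕ} {s : ℕ} (ν : U.Ball) (j : ℕ) (w : Seq U (raise k ν) s)
    (x y : Elems U k) : (w.face ν j).le x y ↔
      w.le (Seq.elemsMap (cofaceAt k ν j) x) (Seq.elemsMap (cofaceAt k ν j) y) := by
  constructor
  · rintro (⟨h, -⟩ | ⟨h, -⟩)
    · exact h
    · rw [h]
      exact w.le_refl _
  · intro h
    by_cases e : Seq.elemsMap (cofaceAt k ν j) x = Seq.elemsMap (cofaceAt k ν j) y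
    · refine Or.inr ⟨e, le_of_eq ?_⟩
      rw [cofaceAt_injective k ν j e]
    · exact Or.inl ⟨h, e⟩

/-- Two double faces agree if the underlying maps on elements do. -/
theorem pushForward_eq_of_elems {k k₁ k₂ : U.Ball → ℕ} {s : ℕ} (hk : k₁ = k₂)
    (f : Column 𝕜 U s) (g₁ : Seq U k₁ s → Seq U k s) (g₂ : Seq U k₂ s → Seq U k s)
    (Φ₁ : Elems U k → Elems U k₁) (Φ₂ : Elems U k → Elems U k₂)
    (h₁ : ∀ v x y, (g₁ v).le x y ↔ v.le (Φ₁ x) (Φ₁ y)) (h₁' : ∀ v x, (g₁ v).W x = v.W (Φ₁ x))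
    (h₂ : ∀ v x y, (g₂ v).le x y ↔ v.le (Φ₂ x) (Φ₂ y)) (h₂' : ∀ v x, (g₂ v).W x = v.W (Φ₂ x))
    (hΦ : ∀ x, (Φ₁ x).1 = (Φ₂ x).1 ∧ (Φ₁ x).2.val = (Φ₂ x).2.val) :
    pushForward g₁ (f k₁) = pushForward g₂ (f k₂) := by
  subst hk
  have hΦ' : Φ₁ = Φ₂ := by
    funext x
    obtain ⟨h, h'⟩ := hΦ x
    rcases e : Φ₁ x with ⟨a, b⟩
    rcases e' : Φ₂ x with ⟨c, d⟩
    rw [e, e'] at h h'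
    dsimp only at h h'
    subst h
    rw [Fin.ext h']
  subst hΦ'
  congr 1
  funext v
  refine Seq.ext ?_ ?_
  · funext x y
    exact propext ((h₁ v x y).trans (h₂ v x y).symm)
  · funext x
    rw [h₁', h₂']

theorem face_face_eq {k : U.Ball → ℕ} {s : ℕ} (f : Column 𝕜 U s) (ν₁ ν₂ ν₃ ν₄ : U.Ball)
    (i₁ i₂ i₃ i₄ : ℕ) (hk : raise (raise k ν₁) ν₂ = raise (raise k ν₃) ν₄)
    (h : ∀ (ν : U.Ball) (a : ℕ),
      (if ν = ν₂ then skip i₂ (if ν = ν₁ then skip i₁ a else a)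
        else (if ν = ν₁ then skip i₁ a else a)) =
      (if ν = ν₄ then skip i₄ (if ν = ν₃ then skip i₃ a else a)
        else (if ν = ν₃ then skip i₃ a else a))) :
    pushForward (fun v : Seq U (raise (raise k ν₁) ν₂) s => (v.face ν₂ i₂).face ν₁ i₁)
        (f _) =
      pushForward (fun v : Seq U (raise (raise k ν₃) ν₄) s => (v.face ν₄ i₄).face ν₃ i₃)
        (f _) := by
  refine pushForward_eq_of_elems hk f _ _
    (fun x => Seq.elemsMap (cofaceAt _ ν₂ i₂) (Seq.elemsMap (cofaceAt k ν₁ i₁) x))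
    (fun x => Seq.elemsMap (cofaceAt _ ν₄ i₄) (Seq.elemsMap (cofaceAt k ν₃ i₃) x))
    ?_ (fun _ _ => rfl) ?_ (fun _ _ => rfl) ?_
  · intro v x y
    rw [face_le, face_le]
  · intro v x y
    rw [face_le, face_le]
  · rintro ⟨ν, a⟩
    exact ⟨rfl, h ν a.val⟩

theorem before_trichotomy {x y : U.Ball} (h : x ≠ y) :
    (U.Before x y ∧ ¬ U.Before y x) ∨ (¬ U.Before x y ∧ U.Before y x) := by
  obtain ⟨i, a⟩ := x
  obtain ⟨j, b⟩ := y
  unfold TwoDisk.Before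
  dsimp only
  rcases lt_trichotomy i j with h1 | h1 | h1
  · left
    exact ⟨Or.inl h1, fun h2 => h2.elim (fun h3 => lt_asymm h1 h3) fun h3 => h1.ne' h3.1⟩
  · subst h1
    have hab : a.val ≠ b.val := fun e => h (by rw [Fin.ext e])
    rcases Nat.lt_or_gt_of_ne hab with h2 | h2
    · left
      simp only [lt_irrefl, true_and, false_or]
      omega
    · right
      simp only [lt_irrefl, true_and, false_or]
      omega
  · right
    exact ⟨fun h2 => h2.elim (fun h3 => lt_asymm h1 h3) fun h3 => h1.ne' h3.1, Or.inl h1⟩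

theorem koszulBefore_raise (k : U.Ball → ℕ) (ν ν' : U.Ball) :
    koszulBefore (𝕜 := 𝕜) (raise k ν) ν' =
      (if U.Before ν ν' then -1 else 1) * koszulBefore k ν' := by
  have h : ∀ x, (if U.Before x ν' then raise k ν x else 0) =
      (if U.Before x ν' then k x else 0) + (if x = ν then (if U.Before ν ν' then 1 else 0) else 0) := by
    intro x
    by_cases e : x = ν
    · subst e
      rw [raise_self]
      simp only [if_true]
      split_ifs <;> simp
    · rw [raise_of_ne k e]
      simp [e]
  unfold koszulBefore
  simp_rw [h]
  rw [Finset.sum_add_distrib, Finset.sum_ite_eq' univ ν, if_pos (mem_univ _), pow_add, mul_comm]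
  split_ifs <;> simp

theorem faceSum_faceSum {s : ℕ} (f : Column 𝕜 U s) : faceSum (faceSum f) = 0 := by
  funext k w
  let D : U.Ball → U.Ball → 𝕜 := fun ν ν' =>
    ∑ j ∈ range (k ν + 2), ∑ i ∈ range (raise k ν ν' + 2), (-1) ^ j * ((-1) ^ i *
      pushForward (fun v : Seq U (raise (raise k ν) ν') s => (v.face ν' i).face ν j) (f _) w)
  have h1 : faceSum (faceSum f) k w =
      ∑ ν, ∑ ν', koszulBefore k ν * koszulBefore (raise k ν) ν' * D ν ν' := by
    unfold faceSum
    refine Finset.sum_congr rfl fun ν _ => ?_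
    simp_rw [pushForward_sum, pushForward_mul, pushForward_sum, pushForward_mul, pushForward_comp]
    simp_rw [D, Finset.mul_sum]
    rw [Finset.sum_comm]
    refine Finset.sum_congr rfl fun ν' _ => Finset.sum_congr rfl fun j _ =>
      Finset.sum_congr rfl fun i _ => ?_
    ring
  rw [h1, ← Finset.sum_product', Pi.zero_apply, Pi.zero_apply]
  have hdiag : ∀ ν, D ν ν = 0 := by
    intro ν
    simp only [D]
    rw [Finset.sum_comm, raise_self]
    have key := alternating_sum_eq_zero (𝕜 := 𝕜) (k ν + 2) (fun j i => pushForward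
      (fun v : Seq U (raise (raise k ν) ν) s => (v.face ν i).face ν j) (f _) w) (by
        intro j i hij _
        refine congrFun (face_face_eq f ν ν ν ν j (i + 1) i j rfl ?_) w
        intro x a
        by_cases e : x = ν
        · simp only [e, if_true]
          exact skip_skip hij a
        · simp only [e, if_false])
    rw [← key]
    refine Finset.sum_congr rfl fun i _ => Finset.sum_congr rfl fun j _ => ?_
    ring
  have hswap : ∀ ν ν', ν ≠ ν' → D ν ν' = D ν' ν := by
    intro ν ν' h
    simp only [D]
    rw [raise_of_ne k h, raise_of_ne k h.symm, Finset.sum_comm]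
    refine Finset.sum_congr rfl fun i _ => Finset.sum_congr rfl fun j _ => ?_
    have hk : raise (raise k ν) ν' = raise (raise k ν') ν := by
      unfold raise
      rw [Function.update_of_ne h.symm, Function.update_of_ne h, Function.update_comm h]
    rw [face_face_eq f ν ν' ν' ν j i i j hk ?_]
    · ring
    · intro x a
      by_cases e : x = ν
      · subst e
        simp [h]
      · by_cases e' : x = ν'
        · subst e'
          simp [e]
        · simp [e, e']
  refine Finset.sum_involution (fun p _ => (p.2, p.1)) ?_ ?_ ?_ ?_
  · rintro ⟨ν, ν'⟩ -
    dsimp only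
    by_cases h : ν = ν'
    · subst h
      rw [hdiag]
      ring
    · rw [koszulBefore_raise, koszulBefore_raise, hswap ν ν' h]
      rcases before_trichotomy h with ⟨h2, h3⟩ | ⟨h2, h3⟩
      · simp only [h2, h3, if_true, if_false]
        ring
      · simp only [h2, h3, if_true, if_false]
        ring
  · rintro ⟨ν, ν'⟩ - h e
    have e' : ν' = ν := congrArg Prod.fst e
    subst e'
    dsimp only at h
    rw [hdiag, mul_zero] at h
    exact h rfl
  · intro p _
    simp
  · intro p _
    rfl

theorem faceSum_cofaceSum (f : Cochains 𝕜 U) (s : ℕ) :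
    faceSum (cofaceSum f s) = cofaceSum (fun s => faceSum (f s)) s := by
  funext k w
  match s with
  | 0 =>
    simp [faceSum, pushForward, cofaceSum]
  | s + 1 =>
    have h1 : ∀ k' : U.Ball → ℕ, cofaceSum f (s + 1) k' = fun w => ∑ i ∈ range (s + 2),
      (-1) ^ i * pushForward (Seq.push (coface s i)) (f s k') w := fun _ => rfl
    change _ = ∑ j ∈ range (s + 2), (-1) ^ j *
      pushForward (Seq.push (coface s j)) (faceSum (f s) k) w
    unfold faceSum
    simp_rw [h1, pushForward_sum, pushForward_mul, pushForward_sum, pushForward_mul,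
      pushForward_comp, Finset.mul_sum]
    symm
    rw [Finset.sum_comm]
    refine Finset.sum_congr rfl fun ν _ => ?_
    rw [Finset.sum_comm]
    refine Finset.sum_congr rfl fun j _ => Finset.sum_congr rfl fun i _ => ?_
    have e : (fun v : Seq U (raise k ν) s => Seq.push (coface s i) (v.face ν j)) =
        fun v => Seq.face ν j (Seq.push (coface s i) v) := rfl
    rw [e]
    ring

theorem pushForward_smul {A B : Type} [Fintype A] (g : A → B) (c : 𝕜) (f : A → 𝕜) :
    pushForward g (c • f) = c • pushForward g f :=
  pushForward_mul g c f

theorem pushForward_add' {A B : Type} [Fintype A] (g : A → B) (f f' : A → 𝕜) :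
    pushForward g (f + f') = pushForward g f + pushForward g f' :=
  pushForward_add g f f'

theorem faceSum_add {s : ℕ} (f g : Column 𝕜 U s) : faceSum (f + g) = faceSum f + faceSum g := by
  funext k w
  simp only [faceSum, Pi.add_apply, pushForward_add', mul_add, Finset.sum_add_distrib]

theorem faceSum_smul {s : ℕ} (c : 𝕜) (f : Column 𝕜 U s) : faceSum (c • f) = c • faceSum f := by
  funext k w
  simp only [faceSum, Pi.smul_apply, pushForward_smul, smul_eq_mul, Finset.mul_sum]
  refine Finset.sum_congr rfl fun ν _ => Finset.sum_congr rfl fun j _ => ?_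
  ring

theorem cofaceSum_add (f g : Cochains 𝕜 U) : cofaceSum (f + g) = cofaceSum f + cofaceSum g := by
  funext s k w
  match s with
  | 0 => simp [cofaceSum]
  | s + 1 =>
    simp only [cofaceSum, Pi.add_apply, pushForward_add', mul_add, Finset.sum_add_distrib]

theorem cofaceSum_smul (c : 𝕜) (f : Cochains 𝕜 U) : cofaceSum (c • f) = c • cofaceSum f := by
  funext s k w
  match s with
  | 0 => simp [cofaceSum]
  | s + 1 =>
    simp only [cofaceSum, Pi.smul_apply, pushForward_smul, smul_eq_mul, Finset.mul_sum]
    refine Finset.sum_congr rfl fun j _ => ?_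
    ring

/-- The cohomological degree `s - ∑ k ν` of the cells in `seq(U)({[k ν]}; [s])`. -/
def cellDeg (s : ℕ) (k : U.Ball → ℕ) : ℤ := (s : ℤ) - ∑ ν, (k ν : ℤ)

theorem cellDeg_raise (s : ℕ) (k : U.Ball → ℕ) (ν : U.Ball) :
    cellDeg s (raise k ν) + 1 = cellDeg s k := by
  have h : ∀ x, ((raise k ν x : ℕ) : ℤ) = k x + if x = ν then 1 else 0 := by
    intro x
    by_cases e : x = ν
    · subst e
      simp [raise_self]
    · simp [raise_of_ne k e, e]
  unfold cellDeg
  simp_rw [h, Finset.sum_add_distrib, Finset.sum_ite_eq' univ ν, if_pos (mem_univ _)]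
  ring

theorem exists_of_faceSum_ne_zero {s : ℕ} {f : Column 𝕜 U s} {k : U.Ball → ℕ} {w : Seq U k s}
    (h : faceSum f k w ≠ 0) : ∃ ν v, f (raise k ν) v ≠ 0 := by
  obtain ⟨ν, -, h1⟩ := Finset.exists_ne_zero_of_sum_ne_zero h
  obtain ⟨j, -, h2⟩ := Finset.exists_ne_zero_of_sum_ne_zero (right_ne_zero_of_mul h1)
  obtain ⟨v, -, h3⟩ := exists_of_pushForward_ne_zero (right_ne_zero_of_mul h2)
  exact ⟨ν, v, h3⟩

theorem exists_of_cofaceSum_ne_zero {s : ℕ} {f : Cochains 𝕜 U} {k : U.Ball → ℕ} {w : Seq U k s}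
    (h : cofaceSum f s k w ≠ 0) : ∃ s' v, s = s' + 1 ∧ f s' k v ≠ 0 := by
  match s with
  | 0 => exact absurd rfl h
  | s + 1 =>
    obtain ⟨j, -, h2⟩ := Finset.exists_ne_zero_of_sum_ne_zero h
    obtain ⟨v, -, h3⟩ := exists_of_pushForward_ne_zero (right_ne_zero_of_mul h2)
    exact ⟨s, v, rfl, h3⟩

variable (𝕜)

/-- The scalar `(-1) ^ n`. -/
def sgn (n : ℤ) : 𝕜 := (((n.negOnePow : ℤˣ) : ℤ) : 𝕜)

theorem sgn_succ (n : ℤ) : sgn 𝕜 (n + 1) = - sgn 𝕜 n := by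
  simp [sgn, Int.negOnePow_succ]

variable (U)

/-- The degree `n` part of the condensation: `∏_s ⨁_{s - ∑ k ν = n} 𝕜 seq(U)({[k ν]}; [s])`.
For given `s` and `n` there are only finitely many cells, so that the elements are all the
functions on the cells that are supported in degree `n`. -/
def condensationX (n : ℤ) : Submodule 𝕜 (Cochains 𝕜 U) where
  carrier := {f | ∀ s k w, f s k w ≠ 0 → cellDeg s k = n}
  zero_mem' := fun _ _ _ h => absurd rfl h
  add_mem' := by
    intro f g hf hg s k w h
    by_cases e : f s k w = 0
    · exact hg s k w fun e' => h (by simp [e, e'])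
    · exact hf s k w e
  smul_mem' := fun c f hf s k w h => hf s k w (right_ne_zero_of_mul h)

/-- The differential `f ↦ d_J f - (-1) ^ n d_I f` on elements of degree `n`. -/
def condensationD (n m : ℤ) (h : n + 1 = m) : condensationX 𝕜 U n →ₗ[𝕜] condensationX 𝕜 U m where
  toFun := fun f => ⟨fun s k w => cofaceSum f.1 s k w - sgn 𝕜 n * faceSum (f.1 s) k w, by
    intro s k w hne
    beta_reduce at hne
    by_cases e : cofaceSum f.1 s k w = 0
    · rw [e, zero_sub] at hne
      obtain ⟨ν, v, hv⟩ := exists_of_faceSum_ne_zero (right_ne_zero_of_mul (neg_ne_zero.1 hne))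
      rw [← cellDeg_raise s k ν, f.2 _ _ _ hv, h]
    · obtain ⟨s', v, rfl, hv⟩ := exists_of_cofaceSum_ne_zero e
      have := f.2 _ _ _ hv
      rw [← h, ← this]
      unfold cellDeg
      push_cast
      ring⟩
  map_add' := by
    intro f g
    refine Subtype.ext ?_
    funext s k w
    change cofaceSum (f.1 + g.1) s k w - sgn 𝕜 n * faceSum (f.1 s + g.1 s) k w =
      (cofaceSum f.1 s k w - sgn 𝕜 n * faceSum (f.1 s) k w) +
      (cofaceSum g.1 s k w - sgn 𝕜 n * faceSum (g.1 s) k w)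
    rw [cofaceSum_add, faceSum_add]
    simp only [Pi.add_apply]
    ring
  map_smul' := by
    intro c f
    refine Subtype.ext ?_
    funext s k w
    change cofaceSum (c • f.1) s k w - sgn 𝕜 n * faceSum (c • f.1 s) k w =
      c * (cofaceSum f.1 s k w - sgn 𝕜 n * faceSum (f.1 s) k w)
    rw [cofaceSum_smul, faceSum_smul]
    simp only [Pi.smul_apply, smul_eq_mul]
    ring

theorem condensationD_comp (n m p : ℤ) (h : n + 1 = m) (h' : m + 1 = p) :
    (condensationD 𝕜 U m p h').comp (condensationD 𝕜 U n m h) = 0 := by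
  subst h
  refine LinearMap.ext fun f => Subtype.ext ?_
  funext s k w
  have e : (condensationD 𝕜 U n (n + 1) rfl f).1 =
      cofaceSum f.1 + (- sgn 𝕜 n) • (fun s => faceSum (f.1 s)) := by
    funext s k w
    simp only [Pi.add_apply, Pi.smul_apply, smul_eq_mul]
    change cofaceSum f.1 s k w - sgn 𝕜 n * faceSum (f.1 s) k w = _
    ring
  change cofaceSum (condensationD 𝕜 U n (n + 1) rfl f).1 s k w -
    sgn 𝕜 (n + 1) * faceSum ((condensationD 𝕜 U n (n + 1) rfl f).1 s) k w = 0
  rw [e, cofaceSum_add, cofaceSum_smul, cofaceSum_cofaceSum]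
  simp only [Pi.add_apply, Pi.smul_apply]
  rw [faceSum_add, faceSum_smul, faceSum_faceSum, faceSum_cofaceSum, sgn_succ]
  simp only [Pi.add_apply, Pi.smul_apply, smul_eq_mul, Pi.zero_apply]
  ring

/-- The component `|seq|(U)` of the dg condensation of `seq`: the totalisation in the
cosimplicial variable `J` of the realisation in the simplicial variables `I_ν`
(both non-normalised). -/
def condensationComplex : CochainComplex (ModuleCat.{u} 𝕜) ℤ where
  X := fun n => ModuleCat.of 𝕜 (condensationX 𝕜 U n)
  d := fun n m => if h : n + 1 = m then ModuleCat.ofHom (condensationD 𝕜 U n m h) else 0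
  shape := fun n m h => dif_neg h
  d_comp_d' := by
    intro n m p h h'
    have h : n + 1 = m := h
    have h' : m + 1 = p := h'
    rw [dif_pos h, dif_pos h', ← ModuleCat.ofHom_comp, condensationD_comp]
    rfl

/-- The degree `n` part of `Breq(U)`: linear combinations of the total orders on `⊔_ν [k ν]`
with the three conditions, where `-∑ k ν = n` (there are finitely many of them). -/
def breqX (n : ℤ) : Submodule 𝕜 (Column 𝕜 U 0) where
  carrier := {f | ∀ k w, f k w ≠ 0 → cellDeg 0 k = n}
  zero_mem' := fun _ _ h => absurd rfl h
  add_mem' := by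
    intro f g hf hg k w h
    by_cases e : f k w = 0
    · exact hg k w fun e' => h (by simp [e, e'])
    · exact hf k w e
  smul_mem' := fun c f hf k w h => hf k w (right_ne_zero_of_mul h)

/-- The differential of `Breq(U)`. -/
def breqD (n m : ℤ) (h : n + 1 = m) : breqX 𝕜 U n →ₗ[𝕜] breqX 𝕜 U m where
  toFun := fun f => ⟨faceSum f.1, by
    intro k w hne
    obtain ⟨ν, v, hv⟩ := exists_of_faceSum_ne_zero hne
    rw [← cellDeg_raise 0 k ν, f.2 _ _ hv, h]⟩
  map_add' := fun f g => Subtype.ext (faceSum_add f.1 g.1)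
  map_smul' := fun c f => Subtype.ext (faceSum_smul c f.1)

theorem breqD_comp (n m p : ℤ) (h : n + 1 = m) (h' : m + 1 = p) :
    (breqD 𝕜 U m p h').comp (breqD 𝕜 U n m h) = 0 :=
  LinearMap.ext fun f => Subtype.ext (faceSum_faceSum f.1)

/-- The complex `Breq(U)`: the (non-normalised) realisation of the polysimplicial set
`seq(U)({I_ν}; [0])`. -/
def breq : CochainComplex (ModuleCat.{u} 𝕜) ℤ where
  X := fun n => ModuleCat.of 𝕜 (breqX 𝕜 U n)
  d := fun n m => if h : n + 1 = m then ModuleCat.ofHom (breqD 𝕜 U n m h) else 0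
  shape := fun n m h => dif_neg h
  d_comp_d' := by
    intro n m p h h'
    have h : n + 1 = m := h
    have h' : m + 1 = p := h'
    rw [dif_pos h, dif_pos h', ← ModuleCat.ofHom_comp, breqD_comp]
    rfl

variable {𝕜} {U}

/-- A total order is degenerate if two consecutive elements have the same colour, that is, lie
in the same `I_ν`. (Equivalently, it is the image of another one under a degeneracy map.) -/
def Seq.IsDegenerate {k : U.Ball → ℕ} (w : Seq U k 0) : Prop :=
  ∃ x y : Elems U k, x ≠ y ∧ x.1 = y.1 ∧ w.le x y ∧ ∀ z, w.le x z → w.le z y → z = x ∨ z = y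

variable (𝕜) (U)

/-- The degree `n` part of the subcomplex `Breq(U)_0` of `Breq(U)`: linear combinations of
degenerate total orders. -/
def breqDegenerate (n : ℤ) : Submodule 𝕜 (breqX 𝕜 U n) where
  carrier := {f | ∀ k w, f.1 k w ≠ 0 → w.IsDegenerate}
  zero_mem' := fun _ _ h => absurd rfl h
  add_mem' := by
    intro f g hf hg k w h
    by_cases e : f.1 k w = 0
    · exact hg k w fun e' => h (by
        change f.1 k w + g.1 k w = 0
        rw [e, e', add_zero])
    · exact hf k w e
  smul_mem' := fun c f hf k w h => hf k w (right_ne_zero_of_mul h)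

variable {𝕜} {U}

/-- Everything except the `j`-th element of `I_ν` is in the image of the coface map. -/
theorem exists_elemsMap_cofaceAt (k : U.Ball → ℕ) (ν : U.Ball) (j : ℕ) (hj : j < k ν + 2)
    (p : Elems U (raise k ν)) (hp : p.1 = ν → p.2.val ≠ j) :
    ∃ q, Seq.elemsMap (cofaceAt k ν j) q = p := by
  obtain ⟨ν', c⟩ := p
  dsimp only at hp
  have hc := c.isLt
  by_cases e : ν' = ν
  · subst e
    have hp := hp rfl
    have hr := raise_self k ν'
    refine ⟨⟨ν', ⟨if c.val < j then c.val else c.val - 1, by split_ifs <;> omega⟩⟩, ?_⟩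
    refine Sigma.ext rfl (heq_of_eq (Fin.ext ?_))
    simp only [Seq.elemsMap, cofaceAt, OrderHom.coe_mk, if_true, skip]
    split_ifs <;> omega
  · have hr := raise_of_ne k e
    refine ⟨⟨ν', ⟨c.val, by omega⟩⟩, ?_⟩
    refine Sigma.ext rfl (heq_of_eq (Fin.ext ?_))
    simp [Seq.elemsMap, cofaceAt, e]

theorem isDegenerate_face {k : U.Ball → ℕ} (ν : U.Ball) (j : ℕ) (hj : j < k ν + 2)
    (v : Seq U (raise k ν) 0) (x y : Elems U (raise k ν)) (hxy : x ≠ y) (h1 : x.1 = y.1)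
    (h2 : v.le x y) (h3 : ∀ z, v.le x z → v.le z y → z = x ∨ z = y)
    (hx : x.1 = ν → x.2.val ≠ j) (hy : y.1 = ν → y.2.val ≠ j) : (v.face ν j).IsDegenerate := by
  obtain ⟨p, rfl⟩ := exists_elemsMap_cofaceAt k ν j hj x hx
  obtain ⟨q, rfl⟩ := exists_elemsMap_cofaceAt k ν j hj y hy
  refine ⟨p, q, fun e => hxy (by rw [e]), h1, (face_le ν j v p q).2 h2, fun z h4 h5 => ?_⟩
  rw [face_le] at h4 h5
  rcases h3 _ h4 h5 with h | h
  · exact Or.inl (cofaceAt_injective k ν j h)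
  · exact Or.inr (cofaceAt_injective k ν j h)

theorem face_eq_face_succ {k : U.Ball → ℕ} (ν : U.Ball) (v : Seq U (raise k ν) 0)
    (a b : Fin (raise k ν ν + 1)) (hab : b.val = a.val + 1)
    (h3 : ∀ z, v.le ⟨ν, a⟩ z → v.le z ⟨ν, b⟩ → z = ⟨ν, a⟩ ∨ z = ⟨ν, b⟩) :
    v.face ν a.val = v.face ν b.val := by
  have h2 : v.le ⟨ν, a⟩ ⟨ν, b⟩ := v.le_of_le ν a b (by
    rw [Fin.le_def]
    omega)
  have key : ∀ p : Elems U k,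
      (Seq.elemsMap (cofaceAt k ν a.val) p = ⟨ν, b⟩ ∧
        Seq.elemsMap (cofaceAt k ν b.val) p = ⟨ν, a⟩) ∨
      (Seq.elemsMap (cofaceAt k ν a.val) p = Seq.elemsMap (cofaceAt k ν b.val) p ∧
        Seq.elemsMap (cofaceAt k ν a.val) p ≠ ⟨ν, a⟩ ∧
        Seq.elemsMap (cofaceAt k ν a.val) p ≠ ⟨ν, b⟩) := by
    rintro ⟨ν', c⟩
    by_cases e : ν' = ν
    · subst e
      by_cases e' : c.val = a.val
      · left
        constructor
        · refine Sigma.ext rfl (heq_of_eq (Fin.ext ?_))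
          simp only [Seq.elemsMap, cofaceAt, OrderHom.coe_mk, if_true, skip]
          split_ifs <;> omega
        · refine Sigma.ext rfl (heq_of_eq (Fin.ext ?_))
          simp only [Seq.elemsMap, cofaceAt, OrderHom.coe_mk, if_true, skip]
          split_ifs <;> omega
      · right
        have hv : ∀ (d : Fin (raise k ν' ν' + 1)), skip a.val c.val ≠ d.val →
            Seq.elemsMap (cofaceAt k ν' a.val) ⟨ν', c⟩ ≠ ⟨ν', d⟩ := by
          intro d hd h
          have h' : (cofaceAt k ν' a.val ν' c) = d := by
            simpa [Seq.elemsMap] using h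
          have h'' := congrArg Fin.val h'
          simp only [cofaceAt, OrderHom.coe_mk, if_true] at h''
          exact hd h''
        refine ⟨Sigma.ext rfl (heq_of_eq (Fin.ext ?_)), hv a ?_, hv b ?_⟩
        · simp only [Seq.elemsMap, cofaceAt, OrderHom.coe_mk, if_true, skip]
          split_ifs <;> omega
        · unfold skip
          split_ifs <;> omega
        · unfold skip
          split_ifs <;> omega
    · right
      refine ⟨Sigma.ext rfl (heq_of_eq (Fin.ext ?_)), fun h => e (congrArg Sigma.fst h),
        fun h => e (congrArg Sigma.fst h)⟩
      simp [Seq.elemsMap, cofaceAt, e]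
  refine Seq.ext ?_ (funext fun x => Subsingleton.elim (α := Fin 1) _ _)
  funext p q
  refine propext ?_
  rw [face_le, face_le]
  rcases key p with ⟨hp1, hp2⟩ | ⟨hp1, hp2, hp3⟩
  · rcases key q with ⟨hq1, hq2⟩ | ⟨hq1, hq2, hq3⟩
    · rw [hp1, hp2, hq1, hq2]
      exact ⟨fun _ => v.le_refl _, fun _ => v.le_refl _⟩
    · rw [hp1, hp2, ← hq1]
      refine ⟨fun h => v.le_trans _ _ _ h2 h, fun h => ?_⟩
      rcases v.le_total ⟨ν, b⟩ (Seq.elemsMap (cofaceAt k ν a.val) q) with h' | h'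
      · exact h'
      · rcases h3 _ h h' with h4 | h4
        · exact absurd h4 hq2
        · exact absurd h4 hq3
  · rcases key q with ⟨hq1, hq2⟩ | ⟨hq1, hq2, hq3⟩
    · rw [hq1, hq2, ← hp1]
      refine ⟨fun h => ?_, fun h => v.le_trans _ _ _ h h2⟩
      rcases v.le_total (Seq.elemsMap (cofaceAt k ν a.val) p) ⟨ν, a⟩ with h' | h'
      · exact h'
      · rcases h3 _ h' h with h4 | h4
        · exact absurd h4 hp2
        · exact absurd h4 hp3
    · rw [hp1, hq1]

/-- The faces of a degenerate total order are degenerate, or cancel in the differential. -/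
theorem faceSum_eq_zero_of_not_isDegenerate {f : Column 𝕜 U 0}
    (hf : ∀ k w, f k w ≠ 0 → w.IsDegenerate) {k : U.Ball → ℕ} {w : Seq U k 0}
    (hw : ¬ w.IsDegenerate) : faceSum f k w = 0 := by
  classical
  unfold faceSum
  refine Finset.sum_eq_zero fun ν _ => ?_
  rw [mul_eq_zero]
  right
  unfold pushForward
  simp_rw [Finset.mul_sum]
  rw [Finset.sum_comm]
  refine Finset.sum_eq_zero fun v _ => ?_
  by_cases hfv : f _ v = 0
  · refine Finset.sum_eq_zero fun j _ => ?_
    simp [hfv]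
  obtain ⟨⟨ν₀, a⟩, ⟨ν₁, b⟩, hxy, h1, h2, h3⟩ := hf _ v hfv
  dsimp only at h1
  subst h1
  have hzero : ∀ j, j < k ν + 2 → (ν₀ = ν → a.val ≠ j ∧ b.val ≠ j) → v.face ν j ≠ w := by
    intro j hj h e
    apply hw
    rw [← e]
    exact isDegenerate_face ν j hj v _ _ hxy rfl h2 h3 (fun h' => (h h').1) (fun h' => (h h').2)
  by_cases e : ν₀ = ν
  · subst e
    have hlt : a < b := by
      by_contra hc
      have := v.le_antisymm _ _ h2 (v.le_of_le ν₀ b a (not_lt.mp hc))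
      exact hxy this
    have hab : b.val = a.val + 1 := by
      by_contra hc
      have hlt' : a.val < b.val := hlt
      have hb := b.isLt
      rcases h3 ⟨ν₀, ⟨a.val + 1, by omega⟩⟩
        (v.le_of_le ν₀ _ _ (by rw [Fin.le_def]; dsimp only; omega))
        (v.le_of_le ν₀ _ _ (by rw [Fin.le_def]; dsimp only; omega)) with h | h
      · have h' := congrArg Fin.val (eq_of_heq (Sigma.ext_iff.1 h).2)
        dsimp only at h'
        omega
      · have h' := congrArg Fin.val (eq_of_heq (Sigma.ext_iff.1 h).2)
        dsimp only at h'
        omega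
    have hr := raise_self k ν₀
    have hb := b.isLt
    have hface := face_eq_face_succ ν₀ v a b hab h3
    rw [← Finset.sum_subset (s₁ := {a.val, b.val})]
    · rw [Finset.sum_pair (by omega), hface, hab, pow_succ]
      ring
    · intro j hj
      simp only [mem_insert, mem_singleton] at hj
      rw [mem_range]
      omega
    · intro j hj hj'
      simp only [mem_insert, mem_singleton, not_or] at hj'
      rw [if_neg (hzero j (mem_range.1 hj) fun _ => ⟨fun h => hj'.1 h.symm, fun h => hj'.2 h.symm⟩),
        mul_zero]
  · refine Finset.sum_eq_zero fun j hj => ?_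
    rw [if_neg (hzero j (mem_range.1 hj) fun h => absurd h e), mul_zero]

variable (𝕜) (U)

theorem breqDegenerate_le (n m : ℤ) (h : n + 1 = m) :
    breqDegenerate 𝕜 U n ≤ (breqDegenerate 𝕜 U m).comap (breqD 𝕜 U n m h) := by
  intro f hf k w hne
  by_contra hw
  exact hne (faceSum_eq_zero_of_not_isDegenerate hf hw)

/-- The complex `Nor(Breq)(U) = Breq(U) / Breq(U)_0`: the normalised realisation of the
polysimplicial set `seq(U)({I_ν}; [0])`. -/
def norBreq : CochainComplex (ModuleCat.{u} 𝕜) ℤ where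
  X := fun n => ModuleCat.of 𝕜 (breqX 𝕜 U n ⧸ breqDegenerate 𝕜 U n)
  d := fun n m => if h : n + 1 = m then ModuleCat.ofHom
    (Submodule.mapQ _ _ (breqD 𝕜 U n m h) (breqDegenerate_le 𝕜 U n m h)) else 0
  shape := fun n m h => dif_neg h
  d_comp_d' := by
    intro n m p h h'
    have h : n + 1 = m := h
    have h' : m + 1 = p := h'
    rw [dif_pos h, dif_pos h', ← ModuleCat.ofHom_comp]
    refine ModuleCat.hom_ext (Submodule.linearMap_qext _ (LinearMap.ext fun f => ?_))
    have e := LinearMap.congr_fun (breqD_comp 𝕜 U n m p h h') f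
    have e : breqD 𝕜 U m p h' (breqD 𝕜 U n m h f) = 0 := e
    simp [e]

end Differentials

/-! ## dg 2-operads -/

/-- The Koszul sign exponent of a composition along a map `σ` of leaves: for homogeneous `β μ` of
degree `b μ` and `α t` of degree `a t`, it is the exponent of the sign that arises when
`(⊗_μ β μ) ⊗ (⊗_t α t)` (factors in the planar orders) is rearranged to
`⊗_μ (β μ ⊗ ⊗_{σ t = μ} α t)`. -/
def koszul {T S : TwoDisk} (σ : T.Ball → S.Ball) (b : S.Ball → ℤ) (a : T.Ball → ℤ) : ℤ :=
  (∑ μ, ∑ t, if S.Before (σ t) μ then b μ * a t else 0) +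
    ∑ t, ∑ t', if T.Before t t' ∧ S.Before (σ t') (σ t) then a t * a t' else 0

/-- Raise the degree at the index `i` by one. -/
def bump {I : Type} [DecidableEq I] (a : I → ℤ) (i : I) : I → ℤ := Function.update a i (a i + 1)

theorem sum_bump {I : Type} [Fintype I] [DecidableEq I] (a : I → ℤ) (i : I) :
    ∑ j, bump a i j = ∑ j, a j + 1 := by
  unfold bump
  rw [Finset.sum_update_of_mem (mem_univ i), ← Finset.add_sum_erase univ a (mem_univ i),
    Finset.sdiff_singleton_eq_erase]
  ring

/-- Apply the differential to the `i`-th member of a family of elements of complexes. -/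
def diffAt {𝕜 : Type u} [Field 𝕜] {I : Type} [DecidableEq I]
    (K : I → CochainComplex (ModuleCat.{u} 𝕜) ℤ) (a : I → ℤ) (i : I)
    (α : ∀ j, (K j).X (a j)) (j : I) : (K j).X (bump a i j) :=
  if h : j = i then ((K j).d (a j) (bump a i j)).hom (α j)
  else ((K j).XIsoOfEq (show a j = bump a i j by simp [bump, h])).hom.hom (α j)

/-- The data of a dg 2-operad (pruned, with compositions along the surjective maps of pruned
2-trees): a complex for every 2-disk, compositions
`X(S) ⊗ ⨂_μ X(F μ) ⟶ X(T)` for every map `σ : T ⟶ S` with fibres `F μ`, and an operadic unit in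
the component of the one-leaf 2-disk. -/
structure DGTwoOperadData (𝕜 : Type u) [Field 𝕜] where
  X : TwoDisk → CochainComplex (ModuleCat.{u} 𝕜) ℤ
  comp : ∀ {T S : TwoDisk} {σ : T.Hom S} {F : S.Ball → TwoDisk} (_ : Fibres σ F)
    (b : ℤ) (a : S.Ball → ℤ) (n : ℤ), b + ∑ μ, a μ = n →
    ((X S).X b →ₗ[𝕜] MultilinearMap 𝕜 (fun μ => (X (F μ)).X (a μ)) ((X T).X n))
  one : (X TwoDisk.point).X 0

/-- The laws of a dg 2-operad. -/
structure DGTwoOperadData.IsOperad {𝕜 : Type u} [Field 𝕜] (O : DGTwoOperadData 𝕜) : Prop where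
  /-- The compositions are maps of complexes. -/
  d_comp : ∀ {T S : TwoDisk} {σ : T.Hom S} {F : S.Ball → TwoDisk} (ι : Fibres σ F)
    (b : ℤ) (a : S.Ball → ℤ) (n : ℤ) (h : b + ∑ μ, a μ = n)
    (β : (O.X S).X b) (α : ∀ μ, (O.X (F μ)).X (a μ)),
    ((O.X T).d n (n + 1)).hom (O.comp ι b a n h β α) =
      O.comp ι (b + 1) a (n + 1) (by rw [← h]; ring) (((O.X S).d b (b + 1)).hom β) α +
      ∑ μ, sgn 𝕜 (b + ∑ μ', if S.Before μ' μ then a μ' else 0) •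
        O.comp ι b (bump a μ) (n + 1) (by rw [sum_bump, ← h]; ring) β
          (diffAt (fun μ => O.X (F μ)) a μ α)
  /-- Associativity, for maps `T ⟶ S ⟶ Q` with composite `τ`: the fibre `F s` of `σ` over a leaf
  `s` of `S` is also a fibre of the map `θ q : H q ⟶ G q` of fibres over the leaf `q` of `Q` under
  `s`. The degrees of `γ`, `β q`, `α s` are `c`, `b q`, `a s`. -/
  assoc : ∀ {T S Q : TwoDisk} {σ : T.Hom S} {ρ : S.Hom Q} {τ : T.Hom Q}
    {F : S.Ball → TwoDisk} {G H : Q.Ball → TwoDisk}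
    (ι : Fibres σ F) (κ : Fibres ρ G) (l : Fibres τ H)
    {θ : ∀ q, (H q).Hom (G q)} (m : ∀ q, Fibres (θ q) (fun y => F (κ.incl q y))),
    (∀ t, τ.toFun t = ρ.toFun (σ.toFun t)) →
    (∀ q x, κ.incl q ((θ q).toFun x) = σ.toFun (l.incl q x)) →
    (∀ q y z, l.incl q ((m q).incl y z) = ι.incl (κ.incl q y) z) →
    ∀ (c : ℤ) (b : Q.Ball → ℤ) (a : S.Ball → ℤ) (p n : ℤ) (e : Q.Ball → ℤ)
      (hp : c + ∑ q, b q = p) (hn : p + ∑ s, a s = n)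
      (he : ∀ q, b q + ∑ y, a (κ.incl q y) = e q) (hn' : c + ∑ q, e q = n)
      (γ : (O.X Q).X c) (β : ∀ q, (O.X (G q)).X (b q)) (α : ∀ s, (O.X (F s)).X (a s)),
      O.comp ι p a n hn (O.comp κ c b p hp γ β) α =
        sgn 𝕜 (koszul ρ.toFun b a) •
          O.comp l c e n hn' γ (fun q =>
            O.comp (m q) (b q) (fun y => a (κ.incl q y)) (e q) (he q) (β q)
              (fun y => α (κ.incl q y)))
  /-- The unit is a cocycle. -/
  d_one : ((O.X TwoDisk.point).d 0 1).hom O.one = 0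
  /-- The unit law for the identity map, whose fibres are one-leaf disks. -/
  comp_one : ∀ {T : TwoDisk} {σ : T.Hom T} (ι : Fibres σ (fun _ => TwoDisk.point)),
    (∀ t, σ.toFun t = t) → ∀ (b : ℤ) (β : (O.X T).X b),
    O.comp ι b (fun _ => 0) b (by simp) β (fun _ => O.one) = β
  /-- The unit law for the map to the one-leaf disk, whose only fibre is the whole disk. -/
  one_comp : ∀ {T : TwoDisk} {σ : T.Hom TwoDisk.point} (ι : Fibres σ (fun _ => T)),
    (∀ μ t, ι.incl μ t = t) → ∀ (a n : ℤ) (h : 0 + ∑ _μ : TwoDisk.point.Ball, a = n)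
    (h' : a = n) (α : (O.X T).X a),
    O.comp ι 0 (fun _ => a) n h O.one (fun _ => α) = ((O.X T).XIsoOfEq h').hom.hom α

/-- A dg 2-operad over `𝕜`. -/
structure DGTwoOperad (𝕜 : Type u) [Field 𝕜] extends DGTwoOperadData 𝕜 where
  isOperad : toDGTwoOperadData.IsOperad

/-- A map of dg 2-operads. -/
structure DGTwoOperad.Hom {𝕜 : Type u} [Field 𝕜] (O P : DGTwoOperad 𝕜) where
  app : ∀ T, O.X T ⟶ P.X T
  map_comp : ∀ {T S : TwoDisk} {σ : T.Hom S} {F : S.Ball → TwoDisk} (ι : Fibres σ F)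
    (b : ℤ) (a : S.Ball → ℤ) (n : ℤ) (h : b + ∑ μ, a μ = n)
    (β : (O.X S).X b) (α : ∀ μ, (O.X (F μ)).X (a μ)),
    ((app T).f n).hom (O.comp ι b a n h β α) =
      P.comp ι b a n h (((app S).f b).hom β) (fun μ => ((app (F μ)).f (a μ)).hom (α μ))
  map_one : ((app TwoDisk.point).f 0).hom O.one = P.one

/-- Two dg 2-operads are quasi-isomorphic if they are connected by a zigzag of maps of
dg 2-operads all components of which are quasi-isomorphisms of complexes. -/
def DGTwoOperad.QuasiIsomorphic {𝕜 : Type u} [Field 𝕜] (O P : DGTwoOperad 𝕜) : Prop :=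
  Relation.EqvGen (fun O P : DGTwoOperad 𝕜 => ∃ f : O.Hom P, ∀ T, QuasiIso (f.app T)) O P

theorem Fibres.incl_bijective {T S : TwoDisk} {σ : T.Hom S} {F : S.Ball → TwoDisk}
    (ι : Fibres σ F) : Function.Bijective (fun z : Σ μ, (F μ).Ball => ι.incl z.1 z.2) := by
  constructor
  · rintro ⟨μ, x⟩ ⟨μ', x'⟩ h
    dsimp only at h
    obtain rfl : μ = μ' := by rw [← ι.map_incl μ x, h, ι.map_incl]
    rw [ι.incl_injective μ h]
  · intro t
    obtain ⟨x, hx⟩ := ι.exists_incl t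
    exact ⟨⟨_, x⟩, hx⟩

theorem Fibres.prod_incl {T S : TwoDisk} {σ : T.Hom S} {F : S.Ball → TwoDisk}
    (ι : Fibres σ F) {M : Type*} [CommMonoid M] (g : T.Ball → M) :
    ∏ μ, ∏ x, g (ι.incl μ x) = ∏ t, g t :=
  (Fintype.prod_sigma _).symm.trans (ι.incl_bijective.prod_comp g)

theorem Fibres.sum_incl {T S : TwoDisk} {σ : T.Hom S} {F : S.Ball → TwoDisk}
    (ι : Fibres σ F) {M : Type*} [AddCommMonoid M] (g : T.Ball → M) :
    ∑ μ, ∑ x, g (ι.incl μ x) = ∑ t, g t :=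
  (Fintype.sum_sigma _).symm.trans (ι.incl_bijective.sum_comp g)

section ProdUpdate

variable {𝕜 : Type u} [Field 𝕜] {I : Type} [Fintype I] [DecidableEq I] {M : I → Type u}
  [∀ i, AddCommGroup (M i)] [∀ i, Module 𝕜 (M i)]

theorem prod_update_add (l : ∀ i, M i →ₗ[𝕜] 𝕜) (α : ∀ i, M i) (i : I) (x y : M i) :
    ∏ j, l j (Function.update α i (x + y) j) =
      ∏ j, l j (Function.update α i x j) + ∏ j, l j (Function.update α i y j) :=
  ((MultilinearMap.mkPiAlgebra 𝕜 I 𝕜).compLinearMap l).map_update_add α i x y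

theorem prod_update_smul (l : ∀ i, M i →ₗ[𝕜] 𝕜) (α : ∀ i, M i) (i : I) (c : 𝕜) (x : M i) :
    ∏ j, l j (Function.update α i (c • x) j) = c * ∏ j, l j (Function.update α i x j) :=
  ((MultilinearMap.mkPiAlgebra 𝕜 I 𝕜).compLinearMap l).map_update_smul α i c x

end ProdUpdate

/-! ### The constant 2-operad -/

section Constant

variable (𝕜 : Type u) [Field 𝕜]

/-- The degree `n` part of the complex `𝕜` placed in degree `0`. -/
def constantX (n : ℤ) : Submodule 𝕜 𝕜 where
  carrier := {c | c ≠ 0 → n = 0}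
  zero_mem' := fun h => absurd rfl h
  add_mem' := by
    intro a b ha hb h
    by_cases e : a = 0
    · exact hb fun e' => h (by rw [e, e', add_zero])
    · exact ha e
  smul_mem' := fun c f hf h => hf (right_ne_zero_of_mul h)

/-- The complex `𝕜` placed in degree `0`. -/
def constantComplex : CochainComplex (ModuleCat.{u} 𝕜) ℤ where
  X := fun n => ModuleCat.of 𝕜 (constantX 𝕜 n)
  d := fun _ _ => 0

/-- The constant 2-operad `𝕜`: every component is `𝕜` in degree `0`, and the compositions are
given by multiplication. -/
def constantData : DGTwoOperadData 𝕜 where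
  X := fun _ => constantComplex 𝕜
  comp := fun {T S σ F} _ b a n h =>
    { toFun := fun β =>
        { toFun := fun α => (⟨(β : constantX 𝕜 b).1 * ∏ μ, (α μ : constantX 𝕜 (a μ)).1, by
            intro hne
            have hb := (β : constantX 𝕜 b).2 (left_ne_zero_of_mul hne)
            have ha : ∀ μ, a μ = 0 := fun μ => (α μ : constantX 𝕜 (a μ)).2
              (Finset.prod_ne_zero_iff.1 (right_ne_zero_of_mul hne) μ (mem_univ μ))
            rw [← h, hb, Finset.sum_eq_zero fun μ _ => ha μ, add_zero]⟩ : constantX 𝕜 n)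
          map_update_add' := by
            intro _ α μ x y
            refine Subtype.ext ?_
            have := prod_update_add (fun μ => (constantX 𝕜 (a μ)).subtype) α μ x y
            exact (congrArg ((β : constantX 𝕜 b).1 * ·) this).trans (mul_add _ _ _)
          map_update_smul' := by
            intro _ α μ c x
            refine Subtype.ext ?_
            have := prod_update_smul (fun μ => (constantX 𝕜 (a μ)).subtype) α μ c x
            exact (congrArg ((β : constantX 𝕜 b).1 * ·) this).trans (mul_left_comm _ _ _) }
      map_add' := fun β β' => MultilinearMap.ext fun α => Subtype.ext (add_mul _ _ _)
      map_smul' := fun c β => MultilinearMap.ext fun α => Subtype.ext (mul_assoc _ _ _) }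
  one := (⟨1, fun _ => rfl⟩ : constantX 𝕜 0)

instance : Unique TwoDisk.point.Ball where
  default := ⟨(0 : Fin 1), (0 : Fin 1)⟩
  uniq := by
    rintro ⟨i, j⟩
    obtain rfl : i = (0 : Fin 1) := Subsingleton.elim (α := Fin 1) _ _
    obtain rfl : j = (0 : Fin 1) := Subsingleton.elim (α := Fin 1) _ _
    rfl

theorem constantData_isOperad : (constantData 𝕜).IsOperad where
  d_comp := by
    intro T S σ F ι b a n h β α
    have h1 : ∀ μ, (constantData 𝕜).comp ι b (bump a μ) (n + 1)
        (by rw [sum_bump, ← h]; ring) β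
        (diffAt (fun μ => (constantData 𝕜).X (F μ)) a μ α) = 0 := by
      intro μ
      refine MultilinearMap.map_coord_zero _ μ ?_
      simp only [diffAt, dif_pos]
      rfl
    simp only [h1, smul_zero, Finset.sum_const_zero, add_zero]
    have h2 : (((constantData 𝕜).X S).d b (b + 1)).hom β = 0 := rfl
    rw [h2, map_zero]
    rfl
  assoc := by
    intro T S Q σ ρ τ F G H ι κ l θ m _ _ _ c b a p n e hp hn he hn' γ β α
    refine Subtype.ext ?_
    change (γ : constantX 𝕜 c).1 * (∏ q, (β q : constantX 𝕜 (b q)).1) *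
        (∏ s, (α s : constantX 𝕜 (a s)).1) =
      sgn 𝕜 (koszul ρ.toFun b a) * ((γ : constantX 𝕜 c).1 *
        ∏ q, ((β q : constantX 𝕜 (b q)).1 *
          ∏ y, (α (κ.incl q y) : constantX 𝕜 (a (κ.incl q y))).1))
    rw [Finset.prod_mul_distrib, κ.prod_incl (fun s => (α s : constantX 𝕜 (a s)).1)]
    by_cases h0 : ∀ s, a s = 0
    · have : koszul ρ.toFun b a = 0 := by simp [koszul, h0]
      rw [this]
      simp [sgn, mul_assoc]
    · push Not at h0
      obtain ⟨s, hs⟩ := h0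
      have : ∏ s, (α s : constantX 𝕜 (a s)).1 = 0 :=
        Finset.prod_eq_zero (mem_univ s)
          (by_contra fun hne => hs ((α s : constantX 𝕜 (a s)).2 hne))
      rw [this]
      simp
  d_one := rfl
  comp_one := by
    intro T σ ι _ b β
    refine Subtype.ext ?_
    change (β : constantX 𝕜 b).1 * ∏ _μ : T.Ball, (1 : 𝕜) = _
    simp
  one_comp := by
    intro T σ ι _ a n h h' α
    subst h'
    refine Subtype.ext ?_
    change (1 : 𝕜) * ∏ _μ : TwoDisk.point.Ball, (α : constantX 𝕜 a).1 = _
    rw [one_mul, Fintype.prod_unique]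
    rfl

/-- The constant dg 2-operad. -/
def constantOperad : DGTwoOperad 𝕜 where
  toDGTwoOperadData := constantData 𝕜
  isOperad := constantData_isOperad 𝕜

end Constant

/-! ### The dg condensation of `seq` -/

section Condensation

variable (𝕜 : Type u) [Field 𝕜] {T S : TwoDisk} {σ : T.Hom S} {F : S.Ball → TwoDisk}

/-- The dimension `J μ` of the intermediate ordinal: an element of degree `a μ` has nonzero
coefficients on cells in `seq(F μ)({[k ν]}; [s])` only for `s = a μ + ∑ k ν`. -/
def middleDim (ι : Fibres σ F) (a : S.Ball → ℤ) (k : T.Ball → ℕ) (μ : S.Ball) : ℕ :=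
  (a μ + ∑ x, (k (ι.incl μ x) : ℤ)).toNat

open Classical in
/-- The composition of cochains, induced from the composition of `seq`: the coefficient at `u`
is the sum over all decompositions `u = v ∘ (w μ)_μ`. The sign is that of the rearrangement of
`(⊗_μ α μ) ⊗ (⊗_t x_t)` to `⊗_μ (α μ ⊗ ⊗_{σ t = μ} x_t)`, where `x_t` has degree `k t`. -/
def compCochain (ι : Fibres σ F) (a : S.Ball → ℤ) (β : Cochains 𝕜 S)
    (α : ∀ μ, Cochains 𝕜 (F μ)) : Cochains 𝕜 T := fun s k u =>
  ∑ v : Seq S (middleDim ι a k) s,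
    ∑ w : (∀ μ, Seq (F μ) (fun x => k (ι.incl μ x)) (middleDim ι a k μ)),
      if Seq.comp ι v w = u then
        sgn 𝕜 (koszul σ.toFun a (fun t => (k t : ℤ))) * β s (middleDim ι a k) v *
          ∏ μ, α μ (middleDim ι a k μ) (fun x => k (ι.incl μ x)) (w μ)
      else 0

theorem compCochain_add_left (ι : Fibres σ F) (a : S.Ball → ℤ) (β β' : Cochains 𝕜 S)
    (α : ∀ μ, Cochains 𝕜 (F μ)) :
    compCochain 𝕜 ι a (β + β') α = compCochain 𝕜 ι a β α + compCochain 𝕜 ι a β' α := by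
  funext s k u
  simp only [compCochain, Pi.add_apply, ← Finset.sum_add_distrib]
  refine Finset.sum_congr rfl fun v _ => Finset.sum_congr rfl fun w _ => ?_
  split_ifs
  · ring
  · simp

theorem compCochain_smul_left (ι : Fibres σ F) (a : S.Ball → ℤ) (c : 𝕜) (β : Cochains 𝕜 S)
    (α : ∀ μ, Cochains 𝕜 (F μ)) :
    compCochain 𝕜 ι a (c • β) α = c • compCochain 𝕜 ι a β α := by
  funext s k u
  simp only [compCochain, Pi.smul_apply, smul_eq_mul, Finset.mul_sum]
  refine Finset.sum_congr rfl fun v _ => Finset.sum_congr rfl fun w _ => ?_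
  split_ifs
  · ring
  · simp

theorem compCochain_mem (ι : Fibres σ F) (b : ℤ) (a : S.Ball → ℤ) (n : ℤ)
    (h : b + ∑ μ, a μ = n) (β : condensationX 𝕜 S b) (α : ∀ μ, condensationX 𝕜 (F μ) (a μ)) :
    compCochain 𝕜 ι a β.1 (fun μ => (α μ).1) ∈ condensationX 𝕜 T n := by
  intro s k u hne
  obtain ⟨v, -, h1⟩ := Finset.exists_ne_zero_of_sum_ne_zero hne
  obtain ⟨w, -, h2⟩ := Finset.exists_ne_zero_of_sum_ne_zero h1
  have h3 : Seq.comp ι v w = u := by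
    by_contra hc
    rw [if_neg hc] at h2
    exact h2 rfl
  rw [if_pos h3] at h2
  have hβ := β.2 _ _ _ (right_ne_zero_of_mul (left_ne_zero_of_mul h2))
  have hα := fun μ => (α μ).2 _ _ _
    (Finset.prod_ne_zero_iff.1 (right_ne_zero_of_mul h2) μ (mem_univ μ))
  have hk := ι.sum_incl (fun t => (k t : ℤ))
  rw [← h, ← hβ, ← Finset.sum_congr rfl fun μ _ => hα μ]
  unfold cellDeg
  rw [Finset.sum_sub_distrib, hk]
  ring

/-- The value at a given cell, as a linear functional. -/
def cellValue (U : TwoDisk) (n : ℤ) (s : ℕ) (k : U.Ball → ℕ) (w : Seq U k s) :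
    condensationX 𝕜 U n →ₗ[𝕜] 𝕜 where
  toFun := fun f => f.1 s k w
  map_add' := fun _ _ => rfl
  map_smul' := fun _ _ => rfl

/-- The composition of the condensation. -/
def condensationComp (ι : Fibres σ F) (b : ℤ) (a : S.Ball → ℤ) (n : ℤ)
    (h : b + ∑ μ, a μ = n) : condensationX 𝕜 S b →ₗ[𝕜]
      MultilinearMap 𝕜 (fun μ => condensationX 𝕜 (F μ) (a μ)) (condensationX 𝕜 T n) where
  toFun := fun β =>
    { toFun := fun α => ⟨compCochain 𝕜 ι a β.1 (fun μ => (α μ).1),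
        compCochain_mem 𝕜 ι b a n h β α⟩
      map_update_add' := by
        intro _ α μ x y
        refine Subtype.ext ?_
        funext s k u
        change compCochain 𝕜 ι a β.1 _ s k u =
          compCochain 𝕜 ι a β.1 _ s k u + compCochain 𝕜 ι a β.1 _ s k u
        simp only [compCochain, ← Finset.sum_add_distrib]
        refine Finset.sum_congr rfl fun v _ => Finset.sum_congr rfl fun w _ => ?_
        split_ifs
        · rw [← mul_add]
          congr 1
          exact prod_update_add (fun μ => cellValue 𝕜 (F μ) (a μ) _ _ (w μ)) α μ x y
        · simp
      map_update_smul' := by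
        intro _ α μ c x
        refine Subtype.ext ?_
        funext s k u
        change compCochain 𝕜 ι a β.1 _ s k u = c * compCochain 𝕜 ι a β.1 _ s k u
        simp only [compCochain, Finset.mul_sum]
        refine Finset.sum_congr rfl fun v _ => Finset.sum_congr rfl fun w _ => ?_
        split_ifs
        · rw [mul_left_comm c]
          congr 1
          exact prod_update_smul (fun μ => cellValue 𝕜 (F μ) (a μ) _ _ (w μ)) α μ c x
        · simp }
  map_add' := fun β β' => MultilinearMap.ext fun α =>
    Subtype.ext (compCochain_add_left 𝕜 ι a β.1 β'.1 _)
  map_smul' := fun c β => MultilinearMap.ext fun α =>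
    Subtype.ext (compCochain_smul_left 𝕜 ι a c β.1 _)

open Classical in
/-- The operadic unit of the condensation: the product over `s` of the cells
`id : [s] ⟶ [s]`. -/
def condensationOne : condensationX 𝕜 TwoDisk.point 0 :=
  ⟨fun s k w => if (∀ ν, k ν = s) ∧ ∀ x, (w.W x).val = x.2.val then 1 else 0, by
    intro s k w h
    beta_reduce at h
    split_ifs at h with h'
    · simp [cellDeg, h'.1]
    · exact absurd rfl h⟩

/-- The dg condensation `|seq|` of Tamarkin's simplicial 2-operad, with its compositions and
unit. -/
def condensationData : DGTwoOperadData 𝕜 where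
  X := condensationComplex 𝕜
  comp := fun ι b a n h => condensationComp 𝕜 ι b a n h
  one := condensationOne 𝕜

end Condensation

end TwoOperads

end

/-!
The proof rests on one contraction. Fix the ordinal `J = [s]`; the polysimplicial vector space
`k ↦ 𝕜 seq(U)({[k ν]}; [s])` with the sum of all its faces is called a column. Enumerate the balls
of `U` with the last column first, and with the lowest ball first inside a column
(`TwoDisk.rank`). In this order balls can be pulled to the front of any total order of `seq(U)`
without violating the conditions: a ball moved to the front has to precede only the balls above
it, and relative to a ball of an earlier column a front segment of its ordinal may stand first
(`Seq.rearrange`). Inserting a new zeroth element of `I_l` in front, behind the balls prior to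
`l`, is therefore an extra degeneracy in the variable `I_l`. It gives a homotopy from the
projection that moves the balls prior to `l` to the front, to the projection that restricts to
`I_l = [0]` and moves `l` to the front as well (`faceSum_contract_add`). Going through all the
balls, every cycle becomes homologous to a multiple of one cell, in which each ball occurs once;
the multiple is the augmentation `columnAug`, the sum of the coefficients of the cells with all
`I_ν = [0]` (`exists_sub_faceSum_mem`). The homotopy preserves degenerate total orders, which
gives part (i).

For `|seq|(U)` the columns are acyclic up to the augmentation, so primitives of cocycles can be
constructed column by column (`exists_condensationD_eq_of_columnAug`). What remains is the constant
cosimplicial vector space of the augmentations, with alternating differentials `0` and `1`, which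
has cohomology `𝕜` in degree `0` (`exists_condensationD_eq`, `exists_cocycle_columnAug_eq_one`).

The operad laws are reduced to the composition of `seq`, which is associative (`Seq.comp_assoc`),
dinatural in the intermediate ordinals (`Seq.comp_pull_left`) and natural in the outer ones
(`Seq.comp_pull`). In the differential of a composition, the cofaces of the inner cochains cancel
against the faces of the outer one by dinaturality. Everything else is a comparison of Koszul
signs (`sgn_face_comp`, `sgn_coface_comp`, `even_koszul_assoc`).

The augmentation of the column `s = 0` is not multiplicative on `|seq|`, as elements of positive
degree can be composed with elements of negative degree. It is multiplicative on the truncation,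
which consists of the elements of negative degree and the cocycles of degree `0`. The truncation is
a suboperad, and both the inclusion and the augmentation are quasi-isomorphisms, as the cohomology
is concentrated in degree `0`; they form the zigzag.
-/

noncomputable section

namespace TwoOperads

universe u

/-! ### Rearranging total orders -/

section Rearrange

variable {U : TwoDisk}

/-- The contraction of a column moves the balls to the front in this order: the last column
first, and inside a column the lowest ball first. In this order the balls may stand in front of
any total order of `seq(U)` without violating its conditions. -/
def TwoDisk.Prior (U : TwoDisk) (x y : U.Ball) : Prop :=
  y.1 < x.1 ∨ (x.1 = y.1 ∧ x.2.val < y.2.val)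

theorem TwoDisk.Prior.trans {x y z : U.Ball} (h : U.Prior x y) (h' : U.Prior y z) :
    U.Prior x z := by
  rcases h with h | ⟨h, h1⟩ <;> rcases h' with h' | ⟨h', h2⟩
  · exact Or.inl (h'.trans h)
  · exact Or.inl (h' ▸ h)
  · exact Or.inl (h ▸ h')
  · exact Or.inr ⟨h.trans h', h1.trans h2⟩

theorem TwoDisk.not_prior_self (x : U.Ball) : ¬ U.Prior x x := by
  rintro (h | ⟨-, h⟩)
  · exact lt_irrefl _ h
  · exact lt_irrefl _ h

theorem TwoDisk.prior_or_prior {x y : U.Ball} (h : x ≠ y) : U.Prior x y ∨ U.Prior y x := by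
  obtain ⟨i, a⟩ := x
  obtain ⟨j, b⟩ := y
  rcases lt_trichotomy i j with h1 | h1 | h1
  · exact Or.inr (Or.inl h1)
  · subst h1
    rcases lt_trichotomy a.val b.val with h2 | h2 | h2
    · exact Or.inl (Or.inr ⟨rfl, h2⟩)
    · exact absurd (by rw [Fin.ext h2]) h
    · exact Or.inr (Or.inr ⟨rfl, h2⟩)
  · exact Or.inl (Or.inl h1)

open Classical in
/-- The position of a ball in the enumeration by `TwoDisk.Prior`. -/
def TwoDisk.rank (U : TwoDisk) (x : U.Ball) : ℕ := #{y | U.Prior y x}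

theorem TwoDisk.rank_lt {x y : U.Ball} (h : U.Prior x y) : U.rank x < U.rank y := by
  classical
  refine Finset.card_lt_card (Finset.ssubset_iff_of_subset ?_ |>.2 ⟨x, ?_, ?_⟩)
  · intro z hz
    simp only [mem_filter, mem_univ, true_and] at hz ⊢
    exact hz.trans h
  · simpa using h
  · simpa using U.not_prior_self x

theorem TwoDisk.rank_injective (U : TwoDisk) : Function.Injective U.rank := by
  intro x y h
  by_contra hne
  rcases U.prior_or_prior hne with h' | h'
  · exact absurd h (U.rank_lt h').ne
  · exact absurd h (U.rank_lt h').ne'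

/-- The number of balls. -/
def TwoDisk.size (U : TwoDisk) : ℕ := Fintype.card U.Ball

theorem TwoDisk.rank_lt_size (x : U.Ball) : U.rank x < U.size := by
  classical
  refine Finset.card_lt_card (Finset.ssubset_iff_of_subset (subset_univ _) |>.2 ⟨x, mem_univ _, ?_⟩)
  simpa using U.not_prior_self x

theorem TwoDisk.exists_rank_eq {t : ℕ} (ht : t < U.size) : ∃ x, U.rank x = t := by
  have h : Function.Bijective (fun x : U.Ball => (⟨U.rank x, U.rank_lt_size x⟩ : Fin U.size)) := by
    rw [Fintype.bijective_iff_injective_and_card]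
    exact ⟨fun x y e => U.rank_injective (congrArg Fin.val e), by simp [TwoDisk.size]⟩
  obtain ⟨x, hx⟩ := h.2 ⟨t, ht⟩
  exact ⟨x, congrArg Fin.val hx⟩

variable {k k' : U.Ball → ℕ} {s : ℕ}

/-- Conditions on a set `p` of elements that allow to move it to the front: `p` is an initial
segment for the order by rank and index, and the map `φ` is injective on the complement of `p`. -/
structure IsFront (φ : ∀ ν, Fin (k' ν + 1) →o Fin (k ν + 1)) (p : Elems U k' → Prop) : Prop where
  inj : ∀ x y, ¬ p x → ¬ p y → Seq.elemsMap φ x = Seq.elemsMap φ y → x = y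
  of_rank_lt : ∀ x y, U.rank x.1 < U.rank y.1 → p y → p x
  of_le : ∀ ν (i j : Fin (k' ν + 1)), i ≤ j → p ⟨ν, j⟩ → p ⟨ν, i⟩

open Classical in
/-- The sorting key: elements to be moved to the front are sorted by rank, all the others
come after them. -/
def frontKey (p : Elems U k' → Prop) (x : Elems U k') : ℕ := if p x then U.rank x.1 else U.size

/-- If every element of `I_ν₂` lies before or after the whole of `I_ν₁`, then `I_ν₁` lies
before, after, or in a gap of `I_ν₂`. -/
theorem brace_of_forall {n : ℕ} {A : Type} (le : Fin (n + 1) → A → Prop)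
    (ge : A → Fin (n + 1) → Prop) (h1 : ∀ i j a, i ≤ j → le j a → le i a)
    (h : ∀ j, (∀ a, le j a) ∨ (∀ a, ge a j)) :
    (∀ a j, ge a j) ∨ (∀ a j, le j a) ∨ ∃ b : ℕ, b < n ∧
      (∀ a (j : Fin (n + 1)), j.val ≤ b → le j a) ∧
      (∀ a (j : Fin (n + 1)), b < j.val → ge a j) := by
  classical
  by_cases hall : ∀ j a, le j a
  · exact Or.inr (Or.inl fun a j => hall j a)
  by_cases hnone : ∀ j, ¬ ∀ a, le j a
  · exact Or.inl fun a j => (h j).resolve_left (hnone j) a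
  push Not at hall hnone
  obtain ⟨j₁, a₁, hj₁⟩ := hall
  obtain ⟨j₀, hj₀⟩ := hnone
  obtain ⟨b, hb, hmax⟩ := Finset.exists_max_image
    (univ.filter fun j : Fin (n + 1) => ∀ a, le j a) (fun j => j.val) ⟨j₀, by simpa using hj₀⟩
  simp only [mem_filter, mem_univ, true_and] at hb hmax
  refine Or.inr (Or.inr ⟨b.val, ?_, fun a j hj => h1 j b a hj (hb a), fun a j hj => ?_⟩)
  · have hbj : b < j₁ := by
      by_contra hc
      exact hj₁ (h1 j₁ b a₁ (not_lt.mp hc) (hb a₁))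
    have := j₁.isLt
    have : b.val < j₁.val := hbj
    omega
  · refine (h j).resolve_left (fun hc => ?_) a
    have := hmax j hc
    omega

/-- An element of `I_ν₂` lies before or after the whole of `I_ν₁`, for `ν₁` in an earlier
column. -/
theorem Seq.le_or_le_of_col_lt (w : Seq U k s) {ν₁ ν₂ : U.Ball} (h : ν₁.1 < ν₂.1)
    (j : Fin (k ν₂ + 1)) : (∀ i, w.le ⟨ν₂, j⟩ ⟨ν₁, i⟩) ∨ (∀ i, w.le ⟨ν₁, i⟩ ⟨ν₂, j⟩) := by
  rcases w.diff_col ν₁ ν₂ h with h1 | h1 | ⟨a, -, h1, h2⟩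
  · exact Or.inr fun i => h1 i j
  · exact Or.inl fun i => h1 i j
  · rcases Nat.lt_or_ge a j.val with h3 | h3
    · exact Or.inr fun i => h2 i j h3
    · exact Or.inl fun i => h1 i j h3

theorem frontKey_le_size (p : Elems U k' → Prop) (x : Elems U k') : frontKey p x ≤ U.size := by
  unfold frontKey
  split_ifs
  · exact (U.rank_lt_size _).le
  · exact le_rfl

theorem frontKey_lt_size_iff (p : Elems U k' → Prop) (x : Elems U k') :
    frontKey p x < U.size ↔ p x := by
  unfold frontKey
  split_ifs with h
  · exact ⟨fun _ => h, fun _ => U.rank_lt_size _⟩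
  · exact ⟨fun h' => absurd h' (lt_irrefl _), fun h' => absurd h' h⟩

theorem frontKey_of_pos {p : Elems U k' → Prop} {x : Elems U k'} (h : p x) :
    frontKey p x = U.rank x.1 := if_pos h

theorem frontKey_of_neg {p : Elems U k' → Prop} {x : Elems U k'} (h : ¬ p x) :
    frontKey p x = U.size := if_neg h

theorem frontKey_lt_of_neg {p : Elems U k' → Prop} {x y : Elems U k'} (hx : p x) (hy : ¬ p y) :
    frontKey p x < frontKey p y := by
  rw [frontKey_of_neg hy, frontKey_lt_size_iff]
  exact hx

theorem not_frontKey_lt_of_neg {p : Elems U k' → Prop} {x y : Elems U k'} (hx : ¬ p x) :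
    ¬ frontKey p x < frontKey p y := by
  rw [frontKey_of_neg hx]
  exact not_lt.2 (frontKey_le_size _ _)

/-- Pull back a total order along `φ`, and move the elements of `p` to the front, sorted by
ball and index. The map `W` is zero on `p`. -/
def Seq.rearrange (φ : ∀ ν, Fin (k' ν + 1) →o Fin (k ν + 1)) (p : Elems U k' → Prop)
    (hp : IsFront φ p) (w : Seq U k s) : Seq U k' s where
  le := fun x y => frontKey p x < frontKey p y ∨
    (p x ∧ p y ∧ x.1 = y.1 ∧ x.2.val ≤ y.2.val) ∨
    (¬ p x ∧ ¬ p y ∧ w.le (Seq.elemsMap φ x) (Seq.elemsMap φ y))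
  le_refl := fun x => by
    by_cases h : p x
    · exact Or.inr (Or.inl ⟨h, h, rfl, le_rfl⟩)
    · exact Or.inr (Or.inr ⟨h, h, w.le_refl _⟩)
  le_trans := by
    rintro x y z (h | ⟨h1, h2, h3, h4⟩ | ⟨h1, h2, h3⟩) (h' | ⟨h1', h2', h3', h4'⟩ | ⟨h1', h2', h3'⟩)
    · exact Or.inl (h.trans h')
    · rw [frontKey_of_pos h1', h3', ← frontKey_of_pos h2'] at h
      exact Or.inl h
    · rw [frontKey_of_neg h1', ← frontKey_of_neg h2'] at h
      exact Or.inl h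
    · rw [frontKey_of_pos h2, ← h3, ← frontKey_of_pos h1] at h'
      exact Or.inl h'
    · exact Or.inr (Or.inl ⟨h1, h2', h3.trans h3', h4.trans h4'⟩)
    · exact absurd h2 h1'
    · exact absurd h' (not_frontKey_lt_of_neg h2)
    · exact absurd h1' h2
    · exact Or.inr (Or.inr ⟨h1, h2', w.le_trans _ _ _ h3 h3'⟩)
  le_antisymm := by
    have aux : ∀ x y : Elems U k', p x → x.1 = y.1 → p y → ¬ frontKey p x < frontKey p y := by
      intro x y h1 h2 h3
      rw [frontKey_of_pos h1, frontKey_of_pos h3, h2]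
      exact lt_irrefl _
    rintro x y (h | ⟨h1, h2, h3, h4⟩ | ⟨h1, h2, h3⟩) (h' | ⟨h1', h2', h3', h4'⟩ | ⟨h1', h2', h3'⟩)
    · omega
    · exact absurd h (aux _ _ h2' h3'.symm h1')
    · exact absurd h (not_frontKey_lt_of_neg h2')
    · exact absurd h' (aux _ _ h2 h3.symm h1)
    · obtain ⟨ν, i⟩ := x
      obtain ⟨ν', j⟩ := y
      obtain rfl : ν = ν' := h3
      rw [show i = j from Fin.ext (_root_.le_antisymm h4 h4')]
    · exact absurd h1 h2'
    · exact absurd h' (not_frontKey_lt_of_neg h2)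
    · exact absurd h1' h2
    · exact hp.inj x y h1 h2 (w.le_antisymm _ _ h3 h3')
  le_total := by
    intro x y
    rcases lt_trichotomy (frontKey p x) (frontKey p y) with h | h | h
    · exact Or.inl (Or.inl h)
    · by_cases hx : p x
      · have hy : p y := by
          by_contra hy
          exact absurd h (frontKey_lt_of_neg hx hy).ne
        rw [frontKey_of_pos hx, frontKey_of_pos hy] at h
        have h := U.rank_injective h
        rcases Nat.le_total x.2.val y.2.val with h' | h'
        · exact Or.inl (Or.inr (Or.inl ⟨hx, hy, h, h'⟩))
        · exact Or.inr (Or.inr (Or.inl ⟨hy, hx, h.symm, h'⟩))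
      · have hy : ¬ p y := fun hy => absurd h (frontKey_lt_of_neg hy hx).ne'
        rcases w.le_total (Seq.elemsMap φ x) (Seq.elemsMap φ y) with h' | h'
        · exact Or.inl (Or.inr (Or.inr ⟨hx, hy, h'⟩))
        · exact Or.inr (Or.inr (Or.inr ⟨hy, hx, h'⟩))
    · exact Or.inr (Or.inl h)
  le_of_le := by
    intro ν i j h
    by_cases hi : p ⟨ν, i⟩
    · by_cases hj : p ⟨ν, j⟩
      · exact Or.inr (Or.inl ⟨hi, hj, rfl, h⟩)
      · exact Or.inl (frontKey_lt_of_neg hi hj)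
    · exact Or.inr (Or.inr ⟨hi, fun hj => hi (hp.of_le ν i j h hj),
        w.le_of_le ν _ _ ((φ ν).monotone h)⟩)
  same_col := by
    intro ν₁ ν₂ h1 h2 i j
    have hr : U.rank ν₁ < U.rank ν₂ := U.rank_lt (Or.inr ⟨h1, h2⟩)
    by_cases hi : p ⟨ν₁, i⟩
    · left
      by_cases hj : p ⟨ν₂, j⟩
      · rwa [frontKey_of_pos hi, frontKey_of_pos hj]
      · exact frontKey_lt_of_neg hi hj
    · exact Or.inr (Or.inr ⟨hi, fun hj => hi (hp.of_rank_lt _ _ hr hj),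
        w.same_col ν₁ ν₂ h1 h2 _ _⟩)
  diff_col := by
    intro ν₁ ν₂ h
    have hr : U.rank ν₂ < U.rank ν₁ := U.rank_lt (Or.inl h)
    have front : ∀ i j, p ⟨ν₂, j⟩ → frontKey p ⟨ν₂, j⟩ < frontKey p ⟨ν₁, i⟩ := by
      intro i j hj
      by_cases hi : p ⟨ν₁, i⟩
      · rwa [frontKey_of_pos hi, frontKey_of_pos hj]
      · exact frontKey_lt_of_neg hj hi
    have rest : ∀ i j, ¬ p ⟨ν₂, j⟩ → ¬ p ⟨ν₁, i⟩ := fun i j hj hi =>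
      hj (hp.of_rank_lt _ _ hr hi)
    refine brace_of_forall (fun j i => _) (fun i j => _) ?_ ?_
    · intro i j a hij hj
      by_cases hpi : p ⟨ν₂, i⟩
      · exact Or.inl (front _ _ hpi)
      · have hpj : ¬ p ⟨ν₂, j⟩ := fun hpj => hpi (hp.of_le ν₂ i j hij hpj)
        rcases hj with hj | ⟨hj, -⟩ | ⟨-, hj, hj'⟩
        · exact absurd hj (not_frontKey_lt_of_neg hpj)
        · exact absurd hj hpj
        · exact Or.inr (Or.inr ⟨hpi, hj,
            w.le_trans _ _ _ (w.le_of_le ν₂ _ _ ((φ ν₂).monotone hij)) hj'⟩)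
    · intro j
      by_cases hpj : p ⟨ν₂, j⟩
      · exact Or.inl fun i => Or.inl (front i j hpj)
      · rcases w.le_or_le_of_col_lt h (φ ν₂ j) with h3 | h3
        · exact Or.inl fun i => Or.inr (Or.inr ⟨hpj, rest i j hpj, h3 _⟩)
        · exact Or.inr fun i => Or.inr (Or.inr ⟨rest i j hpj, hpj, h3 _⟩)
  W := fun x => if frontKey p x < U.size then 0 else w.W (Seq.elemsMap φ x)
  W_mono := by
    intro x y h
    by_cases hx : p x
    · rw [if_pos ((frontKey_lt_size_iff p x).2 hx)]
      exact Fin.zero_le _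
    · rcases h with h | ⟨h, -⟩ | ⟨-, hy, h⟩
      · exact absurd h (not_frontKey_lt_of_neg hx)
      · exact absurd h hx
      · rw [if_neg (mt (frontKey_lt_size_iff p x).1 hx), if_neg (mt (frontKey_lt_size_iff p y).1 hy)]
        exact w.W_mono _ _ h

/-- The total order in which the balls appear one after the other, sorted by rank, with `W = 0`. -/
def Seq.base (U : TwoDisk) (k : U.Ball → ℕ) (s : ℕ) : Seq U k s where
  le := fun x y => U.rank x.1 < U.rank y.1 ∨ (U.rank x.1 = U.rank y.1 ∧ x.2.val ≤ y.2.val)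
  le_refl := fun x => Or.inr ⟨rfl, le_rfl⟩
  le_trans := by
    rintro x y z (h1 | ⟨h1, h2⟩) (h3 | ⟨h3, h4⟩)
    · exact Or.inl (h1.trans h3)
    · exact Or.inl (h3 ▸ h1)
    · exact Or.inl (h1 ▸ h3)
    · exact Or.inr ⟨h1.trans h3, h2.trans h4⟩
  le_antisymm := by
    rintro ⟨ν, i⟩ ⟨ν', j⟩ h1 h2
    dsimp only at h1 h2
    have h3 : U.rank ν = U.rank ν' := by omega
    obtain rfl := U.rank_injective h3
    rw [Fin.ext (show i.val = j.val by omega)]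
  le_total := fun x y => by omega
  le_of_le := fun ν i j h => Or.inr ⟨rfl, h⟩
  same_col := fun ν₁ ν₂ h1 h2 i j => Or.inl (U.rank_lt (Or.inr ⟨h1, h2⟩))
  diff_col := fun ν₁ ν₂ h => Or.inr (Or.inl fun i j => Or.inl (U.rank_lt (Or.inl h)))
  W := fun _ => 0
  W_mono := fun _ _ _ => le_rfl

end Rearrange

/-! ### Faces of rearranged total orders -/

section Rearrangement

variable {𝕜 : Type u} [Field 𝕜] {U : TwoDisk} {k k₁ k₂ : U.Ball → ℕ} {s : ℕ}

/-- The map `g` of total orders pulls back along `Φ` and moves the elements of `p` to the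
front. -/
structure IsRearrangement (g : Seq U k₁ s → Seq U k s) (Φ : Elems U k → Elems U k₁)
    (p : Elems U k → Prop) : Prop where
  le_iff : ∀ v x y, (g v).le x y ↔ frontKey p x < frontKey p y ∨
    (p x ∧ p y ∧ x.1 = y.1 ∧ x.2.val ≤ y.2.val) ∨ (¬ p x ∧ ¬ p y ∧ v.le (Φ x) (Φ y))
  W_of_pos : ∀ v x, p x → (g v).W x = 0
  W_of_neg : ∀ v x, ¬ p x → (g v).W x = v.W (Φ x)

theorem isRearrangement_rearrange (φ : ∀ ν, Fin (k ν + 1) →o Fin (k₁ ν + 1))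
    (p : Elems U k → Prop) (hp : IsFront φ p) :
    IsRearrangement (s := s) (Seq.rearrange φ p hp) (Seq.elemsMap φ) p where
  le_iff := fun _ _ _ => Iff.rfl
  W_of_pos := fun _ x h => if_pos ((frontKey_lt_size_iff p x).2 h)
  W_of_neg := fun _ x h => if_neg (mt (frontKey_lt_size_iff p x).1 h)

theorem frontKey_elemsMap (φ : ∀ ν, Fin (k ν + 1) →o Fin (k₁ ν + 1)) (p : Elems U k₁ → Prop)
    (x : Elems U k) :
    frontKey p (Seq.elemsMap φ x) = frontKey (fun y => p (Seq.elemsMap φ y)) x := rfl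

theorem skip_le_skip_iff (j : ℕ) {a b : ℕ} : skip j a ≤ skip j b ↔ a ≤ b := by
  unfold skip
  split_ifs <;> omega

theorem skip_succ_eq_zero_iff (j a : ℕ) : skip (j + 1) a = 0 ↔ a = 0 := by
  unfold skip
  constructor <;> intro h <;> split_ifs at * <;> omega

theorem elemsMap_cofaceAt_snd (k : U.Ball → ℕ) (ν : U.Ball) (j : ℕ) (x : Elems U k) :
    (Seq.elemsMap (cofaceAt k ν j) x).2.val = if x.1 = ν then skip j x.2.val else x.2.val := rfl

theorem IsRearrangement.comp_face {ν : U.Ball} {g : Seq U k₁ s → Seq U k s}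
    {Φ : Elems U k → Elems U k₁} {p : Elems U k → Prop} (h : IsRearrangement g Φ p) (j : ℕ) :
    IsRearrangement (fun v : Seq U (raise k₁ ν) s => g (v.face ν j))
      (fun x => Seq.elemsMap (cofaceAt k₁ ν j) (Φ x)) p where
  le_iff := fun v x y => by rw [h.le_iff, face_le]
  W_of_pos := fun v x hx => h.W_of_pos _ x hx
  W_of_neg := fun v x hx => h.W_of_neg _ x hx

theorem IsRearrangement.face {ν : U.Ball} {g : Seq U k₁ s → Seq U (raise k ν) s}
    {Φ : Elems U (raise k ν) → Elems U k₁} {p : Elems U (raise k ν) → Prop}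
    (h : IsRearrangement g Φ p) (j : ℕ) :
    IsRearrangement (fun v => (g v).face ν j) (fun x => Φ (Seq.elemsMap (cofaceAt k ν j) x))
      (fun x => p (Seq.elemsMap (cofaceAt k ν j) x)) where
  le_iff := fun v x y => by
    rw [face_le, h.le_iff, frontKey_elemsMap, frontKey_elemsMap]
    have aux : x.1 = y.1 → ((Seq.elemsMap (cofaceAt k ν j) x).2.val ≤
        (Seq.elemsMap (cofaceAt k ν j) y).2.val ↔ x.2.val ≤ y.2.val) := by
      intro e
      rw [elemsMap_cofaceAt_snd, elemsMap_cofaceAt_snd]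
      by_cases hx : x.1 = ν
      · rw [if_pos hx, if_pos (e.symm.trans hx), skip_le_skip_iff]
      · rw [if_neg hx, if_neg fun hy => hx (e.trans hy)]
    refine or_congr Iff.rfl (or_congr (and_congr Iff.rfl (and_congr Iff.rfl ?_)) Iff.rfl)
    exact and_congr_right aux
  W_of_pos := fun v x hx => h.W_of_pos v _ hx
  W_of_neg := fun v x hx => h.W_of_neg v _ hx

/-- Two rearrangements agree as linear maps if they move the same elements to the front and have the
same effect on the other elements. As the sources are related by an equation of dimensions only,
the effects are compared through balls and values. -/
theorem IsRearrangement.pushForward_eq {g₁ : Seq U k₁ s → Seq U k s}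
    {g₂ : Seq U k₂ s → Seq U k s} {Φ₁ : Elems U k → Elems U k₁} {Φ₂ : Elems U k → Elems U k₂}
    {p₁ p₂ : Elems U k → Prop} (h₁ : IsRearrangement g₁ Φ₁ p₁) (h₂ : IsRearrangement g₂ Φ₂ p₂)
    (hk : k₁ = k₂) (f : Column 𝕜 U s) (hp : ∀ x, p₁ x ↔ p₂ x)
    (hΦ : ∀ x, ¬ p₁ x → (Φ₁ x).1 = (Φ₂ x).1 ∧ (Φ₁ x).2.val = (Φ₂ x).2.val) :
    pushForward g₁ (f k₁) = pushForward g₂ (f k₂) := by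
  subst hk
  obtain rfl : p₁ = p₂ := funext fun x => propext (hp x)
  have hΦ' : ∀ x, ¬ p₁ x → Φ₁ x = Φ₂ x := by
    intro x hx
    obtain ⟨h, h'⟩ := hΦ x hx
    rcases e : Φ₁ x with ⟨a, b⟩
    rcases e' : Φ₂ x with ⟨c, d⟩
    rw [e, e'] at h h'
    dsimp only at h h'
    subst h
    rw [Fin.ext h']
  congr 1
  funext v
  refine Seq.ext ?_ ?_
  · funext x y
    refine propext ?_
    rw [h₁.le_iff, h₂.le_iff]
    refine or_congr Iff.rfl (or_congr Iff.rfl ?_)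
    refine and_congr_right fun hx => and_congr_right fun hy => ?_
    rw [hΦ' x hx, hΦ' y hy]
  · funext x
    by_cases hx : p₁ x
    · rw [h₁.W_of_pos v x hx, h₂.W_of_pos v x hx]
    · rw [h₁.W_of_neg v x hx, h₂.W_of_neg v x hx, hΦ' x hx]

/-- The total order with the balls of rank less than `t` moved to the front. -/
def Seq.sort (t : ℕ) : Seq U k s → Seq U k s :=
  Seq.rearrange (fun _ => OrderHom.id) (fun x => U.rank x.1 < t)
    { inj := fun _ _ _ _ h => h
      of_rank_lt := fun _ _ h h' => h.trans h'
      of_le := fun _ _ _ _ h => h }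

theorem isRearrangement_sort (t : ℕ) :
    IsRearrangement (Seq.sort (U := U) (k := k) (s := s) t) id (fun x => U.rank x.1 < t) :=
  isRearrangement_rearrange _ _ _

/-- Lower the dimension of the ordinal `I_ν` by one (if it is not zero). -/
def lower (k : U.Ball → ℕ) (ν : U.Ball) : U.Ball → ℕ := Function.update k ν (k ν - 1)

theorem lower_self (k : U.Ball → ℕ) (ν : U.Ball) : lower k ν ν = k ν - 1 := by
  simp [lower]

theorem lower_of_ne (k : U.Ball → ℕ) {ν ν' : U.Ball} (h : ν' ≠ ν) : lower k ν ν' = k ν' := by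
  simp [lower, h]

theorem lower_raise (k : U.Ball → ℕ) (ν : U.Ball) : lower (raise k ν) ν = k := by
  unfold lower raise
  simp

theorem raise_lower (k : U.Ball → ℕ) (ν : U.Ball) (h : k ν ≠ 0) : raise (lower k ν) ν = k := by
  unfold lower raise
  simp [Nat.sub_add_cancel (Nat.pos_of_ne_zero h)]

theorem raise_lower_comm (k : U.Ball → ℕ) {ν ν' : U.Ball} (h : ν ≠ ν') :
    raise (lower k ν) ν' = lower (raise k ν') ν := by
  unfold lower raise
  rw [Function.update_of_ne h.symm, Function.update_of_ne h, Function.update_comm h]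

/-- The family of maps of ordinals that is the zeroth codegeneracy for `l` and the identity for
the other balls. -/
def codegeneracyAt (k : U.Ball → ℕ) (l ν : U.Ball) : Fin (k ν + 1) →o Fin (lower k l ν + 1) where
  toFun := fun i => ⟨if ν = l then i - 1 else i, by
    by_cases h : ν = l
    · subst h
      have := lower_self k ν
      simp only [if_true]
      omega
    · have := lower_of_ne k h
      simp only [h, if_false]
      omega⟩
  monotone' := fun a b h => by
    have h : a.val ≤ b.val := h
    by_cases e : ν = l
    · simp only [e, if_true, Fin.mk_le_mk]
      omega
    · simp only [e, if_false, Fin.mk_le_mk]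
      omega

theorem elemsMap_codegeneracyAt_snd (k : U.Ball → ℕ) (l : U.Ball) (x : Elems U k) :
    (Seq.elemsMap (codegeneracyAt k l) x).2.val = if x.1 = l then x.2.val - 1 else x.2.val := rfl

/-- The balls prior to `l`, and the zeroth element of `I_l`. -/
def InsertFront (k : U.Ball → ℕ) (l : U.Ball) (x : Elems U k) : Prop :=
  U.rank x.1 < U.rank l ∨ (x.1 = l ∧ x.2.val = 0)

theorem isFront_insertFront (k : U.Ball → ℕ) (l : U.Ball) :
    IsFront (codegeneracyAt k l) (InsertFront k l) where
  inj := by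
    rintro ⟨ν, i⟩ ⟨ν', j⟩ h1 h2 e
    obtain rfl : ν = ν' := congrArg Sigma.fst e
    have e2 : codegeneracyAt k l ν i = codegeneracyAt k l ν j := by
      simpa [Seq.elemsMap] using e
    have e3 : (if ν = l then i.val - 1 else i.val) = if ν = l then j.val - 1 else j.val :=
      congrArg Fin.val e2
    unfold InsertFront at h1 h2
    have : i = j := by
      refine Fin.ext ?_
      by_cases e' : ν = l
      · simp only [e', if_true] at e3
        simp only [e', true_and, not_or] at h1 h2
        omega
      · simpa only [e', if_false] using e3
    rw [this]
  of_rank_lt := by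
    rintro x y h (h' | ⟨h', -⟩)
    · exact Or.inl (h.trans h')
    · exact Or.inl (h' ▸ h)
  of_le := by
    rintro ν i j h (h' | ⟨h', h2⟩)
    · exact Or.inl h'
    · have h : i.val ≤ j.val := h
      exact Or.inr ⟨h', by dsimp only at h2 ⊢; omega⟩

/-- Insert a new zeroth element of `I_l` in front of the total order, after the balls prior to
`l`, which are moved to the front. This is an extra degeneracy of the simplicial variable `I_l`. -/
def Seq.insertAt (k : U.Ball → ℕ) (l : U.Ball) : Seq U (lower k l) s → Seq U k s :=
  Seq.rearrange (codegeneracyAt k l) (InsertFront k l) (isFront_insertFront k l)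

theorem isRearrangement_insertAt (k : U.Ball → ℕ) (l : U.Ball) :
    IsRearrangement (s := s) (Seq.insertAt k l) (Seq.elemsMap (codegeneracyAt k l))
      (InsertFront k l) :=
  isRearrangement_rearrange _ _ _

/-- Removing the inserted element again leaves the balls prior to `l` at the front. -/
theorem face_zero_insertAt (k : U.Ball → ℕ) (l : U.Ball) (f : Column 𝕜 U s) :
    pushForward (fun v => (Seq.insertAt (raise k l) l v).face l 0) (f (lower (raise k l) l)) =
      pushForward (Seq.sort (U.rank l)) (f k) := by
  refine ((isRearrangement_insertAt (s := s) (raise k l) l).face 0).pushForward_eq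
    (isRearrangement_sort _) (lower_raise k l) f ?_ ?_
  · intro x
    unfold InsertFront
    rw [elemsMap_cofaceAt_snd]
    refine ⟨fun h => h.resolve_right ?_, Or.inl⟩
    rintro ⟨h1, h2⟩
    have h1 : x.1 = l := h1
    simp [h1, skip] at h2
  · intro x _
    refine ⟨rfl, ?_⟩
    rw [elemsMap_codegeneracyAt_snd, elemsMap_cofaceAt_snd]
    change (if x.1 = l then _ else _) = x.2.val
    split_ifs <;> simp [skip]

/-- If `I_l = [0]`, then removing the old element of `I_l` leaves the new one, and the result is the
total order with `l` moved to the front too. -/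
theorem face_one_insertAt (k : U.Ball → ℕ) (l : U.Ball) (hl : k l = 0) (f : Column 𝕜 U s) :
    pushForward (fun v => (Seq.insertAt (raise k l) l v).face l 1) (f (lower (raise k l) l)) =
      pushForward (Seq.sort (U.rank l + 1)) (f k) := by
  refine ((isRearrangement_insertAt (s := s) (raise k l) l).face 1).pushForward_eq
    (isRearrangement_sort _) (lower_raise k l) f ?_ ?_
  · intro x
    unfold InsertFront
    rw [elemsMap_cofaceAt_snd]
    change (U.rank x.1 < U.rank l ∨ (x.1 = l ∧ _)) ↔ _
    rw [Nat.lt_succ_iff_lt_or_eq]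
    refine or_congr Iff.rfl ⟨fun h => by rw [h.1], fun h => ?_⟩
    have h := U.rank_injective h
    refine ⟨h, ?_⟩
    have h2 := x.2.isLt
    have h3 : k x.1 = 0 := (congrArg k h).trans hl
    have h2 : x.2.val < 1 := by omega
    rw [if_pos h, skip, if_pos h2]
    omega
  · intro x _
    refine ⟨rfl, ?_⟩
    rw [elemsMap_codegeneracyAt_snd, elemsMap_cofaceAt_snd]
    change (if x.1 = l then _ else _) = x.2.val
    split_ifs with h
    · have h2 := x.2.isLt
      have h3 : k x.1 = 0 := (congrArg k h).trans hl
      have h2 : x.2.val < 1 := by omega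
      rw [skip, if_pos h2]
      omega
    · rfl

/-- The other faces in the variable `I_l` commute with the extra degeneracy, up to the shift of the
index. -/
theorem face_succ_insertAt (k : U.Ball → ℕ) (l : U.Ball) (hl : k l ≠ 0) (j : ℕ)
    (f : Column 𝕜 U s) :
    pushForward (fun v => (Seq.insertAt (raise k l) l v).face l (j + 1))
        (f (lower (raise k l) l)) =
      pushForward (fun v => Seq.insertAt k l (v.face l j)) (f (raise (lower k l) l)) := by
  refine ((isRearrangement_insertAt (s := s) (raise k l) l).face (j + 1)).pushForward_eq
    ((isRearrangement_insertAt (s := s) k l).comp_face j)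
    ((lower_raise k l).trans (raise_lower k l hl).symm) f ?_ ?_
  · intro x
    unfold InsertFront
    rw [elemsMap_cofaceAt_snd]
    change (U.rank x.1 < U.rank l ∨ (x.1 = l ∧ _)) ↔ _
    refine or_congr Iff.rfl (and_congr_right fun h => ?_)
    rw [if_pos h]
    exact skip_succ_eq_zero_iff j _
  · intro x hx
    refine ⟨rfl, ?_⟩
    rw [elemsMap_codegeneracyAt_snd, elemsMap_cofaceAt_snd, elemsMap_cofaceAt_snd,
      elemsMap_codegeneracyAt_snd]
    change (if x.1 = l then _ else _) = if x.1 = l then _ else _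
    split_ifs with h
    · have : ¬ skip (j + 1) x.2.val = 0 := by
        intro h'
        refine hx (Or.inr ⟨h, ?_⟩)
        rw [elemsMap_cofaceAt_snd, if_pos h, h']
      unfold skip at this ⊢
      split_ifs at this ⊢ <;> omega
    · rfl

/-- The faces in the other variables commute with the extra degeneracy. -/
theorem face_insertAt_of_ne (k : U.Ball → ℕ) (l ν : U.Ball) (h : l ≠ ν) (j : ℕ)
    (f : Column 𝕜 U s) :
    pushForward (fun v => (Seq.insertAt (raise k ν) l v).face ν j) (f (lower (raise k ν) l)) =
      pushForward (fun v => Seq.insertAt k l (v.face ν j)) (f (raise (lower k l) ν)) := by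
  refine ((isRearrangement_insertAt (s := s) (raise k ν) l).face j).pushForward_eq
    ((isRearrangement_insertAt (s := s) k l).comp_face j) (raise_lower_comm k h).symm f ?_ ?_
  · intro x
    unfold InsertFront
    rw [elemsMap_cofaceAt_snd]
    change (U.rank x.1 < U.rank l ∨ (x.1 = l ∧ _)) ↔ _
    refine or_congr Iff.rfl (and_congr_right fun h' => ?_)
    rw [if_neg (fun h2 => h (h'.symm.trans h2))]
  · intro x hx
    refine ⟨rfl, ?_⟩
    rw [elemsMap_codegeneracyAt_snd, elemsMap_cofaceAt_snd, elemsMap_cofaceAt_snd,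
      elemsMap_codegeneracyAt_snd]
    change (if x.1 = l then (if x.1 = ν then _ else _) - 1 else if x.1 = ν then _ else _) =
      if x.1 = ν then skip j (if x.1 = l then _ else _) else if x.1 = l then _ else _
    by_cases h1 : x.1 = l
    · have : x.1 ≠ ν := fun h2 => h (h1.symm.trans h2)
      simp [h1, h]
    · simp [h1]

end Rearrangement

/-! ### The contraction of a column -/

section Contraction

variable {𝕜 : Type u} [Field 𝕜] {U : TwoDisk} {s : ℕ}

theorem koszulBefore_mul_self (k : U.Ball → ℕ) (ν : U.Ball) :
    koszulBefore (𝕜 := 𝕜) k ν * koszulBefore k ν = 1 := by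
  unfold koszulBefore
  rw [← mul_pow]
  simp

theorem not_before_self (ν : U.Ball) : ¬ U.Before ν ν := by
  rintro (h | ⟨-, h⟩)
  · exact lt_irrefl _ h
  · exact lt_irrefl _ h

theorem koszulBefore_raise_self (k : U.Ball → ℕ) (ν : U.Ball) :
    koszulBefore (𝕜 := 𝕜) (raise k ν) ν = koszulBefore k ν := by
  rw [koszulBefore_raise, if_neg (not_before_self ν), one_mul]

/-- The part of the contracting homotopy that inserts a new zeroth element of `I_l`. -/
def contract (l : U.Ball) (f : Column 𝕜 U s) : Column 𝕜 U s := fun k w =>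
  if k l = 0 then 0 else koszulBefore k l * pushForward (Seq.insertAt k l) (f (lower k l)) w

/-- Restrict to the cells with `I_l = [0]`, and move the balls up to `l` to the front. -/
def retract (l : U.Ball) (f : Column 𝕜 U s) : Column 𝕜 U s := fun k w =>
  if k l = 0 then pushForward (Seq.sort (U.rank l + 1)) (f k) w else 0

theorem contract_raise_self (l : U.Ball) (f : Column 𝕜 U s) (k : U.Ball → ℕ) :
    contract l f (raise k l) = fun w =>
      koszulBefore k l * pushForward (Seq.insertAt (raise k l) l) (f (lower (raise k l) l)) w := by
  funext w
  rw [contract, if_neg (by rw [raise_self]; omega), koszulBefore_raise_self]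

theorem contract_of_eq_zero (l : U.Ball) (f : Column 𝕜 U s) {k : U.Ball → ℕ} (h : k l = 0) :
    contract l f k = fun _ => 0 :=
  funext fun _ => if_pos h

theorem contract_of_ne_zero (l : U.Ball) (f : Column 𝕜 U s) {k : U.Ball → ℕ} (h : k l ≠ 0) :
    contract l f k = fun w =>
      koszulBefore k l * pushForward (Seq.insertAt k l) (f (lower k l)) w :=
  funext fun _ => if_neg h

theorem pushForward_zero {A B : Type} [Fintype A] (g : A → B) :
    pushForward g (fun _ => (0 : 𝕜)) = fun _ => 0 := by
  funext b
  simp [pushForward]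

/-- The summand of `faceSum (contract l f)` in the direction of `l`. -/
theorem faceSum_contract_self (l : U.Ball) (f : Column 𝕜 U s) (k : U.Ball → ℕ) (w : Seq U k s) :
    koszulBefore k l * ∑ j ∈ range (k l + 2),
        (-1) ^ j * pushForward (Seq.face l j) (contract l f (raise k l)) w =
      pushForward (Seq.sort (U.rank l)) (f k) w - ∑ j ∈ range (k l + 1), (-1) ^ j *
        pushForward (fun v => (Seq.insertAt (raise k l) l v).face l (j + 1))
          (f (lower (raise k l) l)) w := by
  simp_rw [contract_raise_self, pushForward_mul, pushForward_comp]
  rw [Finset.sum_range_succ', face_zero_insertAt, mul_add, Finset.mul_sum]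
  have h := koszulBefore_mul_self (𝕜 := 𝕜) k l
  have h2 : koszulBefore k l * ((-1) ^ 0 * (koszulBefore k l *
      pushForward (Seq.sort (U.rank l)) (f k) w)) = pushForward (Seq.sort (U.rank l)) (f k) w := by
    rw [pow_zero, one_mul, ← mul_assoc, h, one_mul]
  rw [h2, add_comm, sub_eq_add_neg, ← Finset.sum_neg_distrib]
  congr 1
  refine Finset.sum_congr rfl fun j _ => ?_
  linear_combination ((-1) ^ (j + 1) * pushForward (fun v =>
    (Seq.insertAt (raise k l) l v).face l (j + 1)) (f (lower (raise k l) l)) w) * h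

/-- `contract l` is a homotopy between moving the balls prior to `l` to the front, and
`retract l`. -/
theorem faceSum_contract_add (l : U.Ball) (f : Column 𝕜 U s) (k : U.Ball → ℕ) (w : Seq U k s) :
    faceSum (contract l f) k w + contract l (faceSum f) k w =
      pushForward (Seq.sort (U.rank l)) (f k) w - retract l f k w := by
  by_cases hl : k l = 0
  · rw [contract_of_eq_zero l _ hl, add_zero, faceSum, Finset.sum_eq_single l]
    · rw [faceSum_contract_self, hl, Finset.sum_range_one, face_one_insertAt k l hl, retract,
        if_pos hl, pow_zero, one_mul]
    · intro ν _ h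
      have h' : raise k ν l = 0 := by rw [raise_of_ne k h.symm, hl]
      rw [contract_of_eq_zero l _ h']
      simp [pushForward_zero]
    · exact fun h => absurd (mem_univ l) h
  · have h1 : contract l (faceSum f) k w = ∑ ν, koszulBefore k l * koszulBefore (lower k l) ν *
        ∑ j ∈ range (lower k l ν + 2), (-1) ^ j *
          pushForward (fun v => Seq.insertAt k l (v.face ν j)) (f (raise (lower k l) ν)) w := by
      rw [contract_of_ne_zero l _ hl]
      have : faceSum f (lower k l) = fun w => ∑ ν, koszulBefore (lower k l) ν *
        ∑ j ∈ range (lower k l ν + 2), (-1) ^ j *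
          pushForward (Seq.face ν j) (f (raise (lower k l) ν)) w := rfl
      rw [this]
      simp_rw [pushForward_sum, pushForward_mul, pushForward_sum, pushForward_mul,
        pushForward_comp, Finset.mul_sum, mul_assoc]
    rw [h1, faceSum, ← Finset.sum_add_distrib, Finset.sum_eq_single l, retract, if_neg hl,
      sub_zero]
    · rw [faceSum_contract_self, lower_self]
      have h2 : koszulBefore (𝕜 := 𝕜) k l * koszulBefore (lower k l) l = 1 := by
        have h3 := koszulBefore_raise_self (𝕜 := 𝕜) (lower k l) l
        rw [raise_lower k l hl] at h3
        rw [← h3, koszulBefore_mul_self]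
      rw [h2, one_mul, show k l - 1 + 2 = k l + 1 by omega]
      simp_rw [face_succ_insertAt k l hl]
      rw [sub_add_cancel]
    · intro ν _ h
      have h2 : raise k ν l ≠ 0 := by rwa [raise_of_ne k h.symm]
      rw [lower_of_ne k h, contract_of_ne_zero l _ h2]
      simp_rw [pushForward_mul, pushForward_comp, face_insertAt_of_ne k l ν h.symm]
      have h3 : koszulBefore (𝕜 := 𝕜) k ν * koszulBefore (raise k ν) l +
          koszulBefore k l * koszulBefore (lower k l) ν = 0 := by
        have h4 := koszulBefore_raise (𝕜 := 𝕜) (lower k l) l ν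
        rw [raise_lower k l hl] at h4
        rw [h4, koszulBefore_raise]
        rcases before_trichotomy h with ⟨h5, h6⟩ | ⟨h5, h6⟩
        · rw [if_neg h6, if_pos h5]
          ring
        · rw [if_pos h6, if_neg h5]
          ring
      rw [Finset.mul_sum, Finset.mul_sum, ← Finset.sum_add_distrib]
      refine Finset.sum_eq_zero fun j _ => ?_
      linear_combination ((-1) ^ j * pushForward (fun v => Seq.insertAt k l (v.face ν j))
        (f (raise (lower k l) ν)) w) * h3
    · exact fun h => absurd (mem_univ l) h

theorem Seq.sort_sort (t : ℕ) {k : U.Ball → ℕ} (w : Seq U k s) :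
    Seq.sort t (Seq.sort t w) = Seq.sort t w := by
  have h := isRearrangement_sort (U := U) (k := k) (s := s) t
  refine Seq.ext ?_ ?_
  · funext x y
    refine propext ?_
    rw [h.le_iff, h.le_iff]
    refine or_congr Iff.rfl (or_congr Iff.rfl ?_)
    refine and_congr_right fun hx => and_congr_right fun hy => ?_
    refine ⟨fun h1 => ?_, fun h1 => Or.inr (Or.inr ⟨hx, hy, h1⟩)⟩
    rcases h1 with h1 | h1 | h1
    · exact absurd h1 (not_frontKey_lt_of_neg hx)
    · exact absurd h1.1 hx
    · exact h1.2.2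
  · funext x
    by_cases hx : U.rank x.1 < t
    · rw [h.W_of_pos _ _ hx, h.W_of_pos _ _ hx]
    · rw [h.W_of_neg _ _ hx, id]

theorem Seq.sort_zero {k : U.Ball → ℕ} (w : Seq U k s) : Seq.sort 0 w = w := by
  have h := isRearrangement_sort (U := U) (k := k) (s := s) 0
  have hn : ∀ x : Elems U k, ¬ U.rank x.1 < 0 := fun x => Nat.not_lt_zero _
  refine Seq.ext ?_ (funext fun x => h.W_of_neg _ _ (hn x))
  funext x y
  refine propext ?_
  rw [h.le_iff]
  refine ⟨fun h1 => ?_, fun h1 => Or.inr (Or.inr ⟨hn x, hn y, h1⟩)⟩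
  rcases h1 with h1 | h1 | h1
  · exact absurd h1 (not_frontKey_lt_of_neg (hn x))
  · exact absurd h1.1 (hn x)
  · exact h1.2.2

theorem Seq.sort_size {k : U.Ball → ℕ} (w : Seq U k s) : Seq.sort U.size w = Seq.base U k s := by
  have h := isRearrangement_sort (U := U) (k := k) (s := s) U.size
  have hp : ∀ x : Elems U k, U.rank x.1 < U.size := fun x => U.rank_lt_size _
  refine Seq.ext ?_ (funext fun x => h.W_of_pos _ _ (hp x))
  funext x y
  refine propext ?_
  rw [h.le_iff, frontKey_of_pos (hp x), frontKey_of_pos (hp y)]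
  refine or_congr Iff.rfl ⟨fun h1 => ?_, fun h1 => Or.inl ⟨hp x, hp y, ?_, h1.2⟩⟩
  · rcases h1 with h1 | h1
    · exact ⟨congrArg U.rank h1.2.2.1, h1.2.2.2⟩
    · exact absurd (hp x) h1.1
  · exact U.rank_injective h1.1

/-- The function on the cells is supported in total degree `n`. -/
def Column.IsHomogeneous (f : Column 𝕜 U s) (n : ℤ) : Prop :=
  ∀ k w, f k w ≠ 0 → cellDeg s k = n

/-- The function is supported on the total orders that start with the balls of rank less than
`t`, each of them occurring once. -/
def Column.IsSorted (t : ℕ) (f : Column 𝕜 U s) : Prop :=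
  ∀ k w, f k w ≠ 0 → Seq.sort t w = w ∧ ∀ ν, U.rank ν < t → k ν = 0

variable (𝕜) in
/-- The linear map `faceSum`. -/
def faceSumHom (U : TwoDisk) (s : ℕ) : Column 𝕜 U s →ₗ[𝕜] Column 𝕜 U s where
  toFun := faceSum
  map_add' := faceSum_add
  map_smul' := faceSum_smul

/-- The augmentation: the sum of the coefficients of the cells with all `I_ν = [0]`. -/
def columnAug (f : Column 𝕜 U s) : 𝕜 := ∑ w : Seq U 0 s, f 0 w

theorem sum_pushForward {A B : Type} [Fintype A] [Fintype B] (g : A → B) (f : A → 𝕜) :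
    ∑ b, pushForward g f b = ∑ a, f a := by
  classical
  unfold pushForward
  rw [Finset.sum_comm]
  refine Finset.sum_congr rfl fun a _ => ?_
  rw [Finset.sum_eq_single (g a)]
  · simp
  · intro b _ h
    rw [if_neg h.symm]
  · exact fun h => absurd (mem_univ _) h

theorem columnAug_faceSum (f : Column 𝕜 U s) : columnAug (faceSum f) = 0 := by
  unfold columnAug faceSum
  rw [Finset.sum_comm]
  refine Finset.sum_eq_zero fun ν _ => ?_
  rw [← Finset.mul_sum, Finset.sum_comm]
  simp_rw [← Finset.mul_sum, sum_pushForward]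
  simp [Finset.sum_range_succ]

theorem columnAug_retract (l : U.Ball) (f : Column 𝕜 U s) :
    columnAug (retract l f) = columnAug f := by
  unfold columnAug retract
  simp only [Pi.zero_apply, if_true]
  exact sum_pushForward _ _

theorem pushForward_eq_self {A : Type} [Fintype A] (g : A → A) (f : A → 𝕜)
    (h : ∀ a, f a ≠ 0 → g a = a) : pushForward g f = f := by
  funext b
  unfold pushForward
  rw [Finset.sum_eq_single b]
  · split_ifs with hb
    · rfl
    · by_contra hc
      exact hb (h b fun e => hc e.symm)
  · intro a _ hab
    split_ifs with ha
    · by_contra hc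
      exact hab ((h a hc).symm.trans ha)
    · rfl
  · exact fun h => absurd (mem_univ _) h

theorem Column.IsHomogeneous.contract {f : Column 𝕜 U s} {n : ℤ} (hf : f.IsHomogeneous n)
    (l : U.Ball) : Column.IsHomogeneous (contract l f) (n - 1) := by
  intro k w h
  by_cases hl : k l = 0
  · rw [contract_of_eq_zero l f hl] at h
    exact absurd rfl h
  · rw [contract_of_ne_zero l f hl] at h
    obtain ⟨v, -, hv⟩ := exists_of_pushForward_ne_zero (right_ne_zero_of_mul h)
    have h1 := hf _ _ hv
    have h2 := cellDeg_raise s (lower k l) l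
    rw [raise_lower k l hl] at h2
    omega

theorem Column.IsHomogeneous.retract {f : Column 𝕜 U s} {n : ℤ} (hf : f.IsHomogeneous n)
    (l : U.Ball) : Column.IsHomogeneous (retract l f) n := by
  intro k w h
  unfold TwoOperads.retract at h
  split_ifs at h with hl
  · obtain ⟨v, -, hv⟩ := exists_of_pushForward_ne_zero h
    exact hf _ _ hv
  · exact absurd rfl h

theorem Column.IsSorted.retract {f : Column 𝕜 U s} {l : U.Ball} (hf : f.IsSorted (U.rank l)) :
    Column.IsSorted (U.rank l + 1) (retract l f) := by
  intro k w h
  unfold TwoOperads.retract at h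
  split_ifs at h with hl
  · obtain ⟨v, rfl, hv⟩ := exists_of_pushForward_ne_zero h
    refine ⟨Seq.sort_sort _ _, fun ν hν => ?_⟩
    rcases Nat.lt_succ_iff_lt_or_eq.1 hν with h1 | h1
    · exact (hf _ _ hv).2 ν h1
    · rw [U.rank_injective h1, hl]
  · exact absurd rfl h

open Classical in
variable (𝕜) (U) (s) in
/-- The cell in which every ball occurs once, the balls being sorted by rank. -/
def baseColumn : Column 𝕜 U s := fun k w => if k = 0 ∧ w = Seq.base U k s then 1 else 0

theorem columnAug_baseColumn : columnAug (baseColumn 𝕜 U s) = 1 := by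
  classical
  unfold columnAug baseColumn
  simp

theorem Column.IsSorted.eq_smul_baseColumn {f : Column 𝕜 U s} (hf : f.IsSorted U.size) :
    f = columnAug f • baseColumn 𝕜 U s := by
  classical
  have h0 : ∀ k w, f k w ≠ 0 → k = 0 ∧ w = Seq.base U k s := by
    intro k w h
    obtain ⟨h1, h2⟩ := hf k w h
    exact ⟨funext fun ν => h2 ν (U.rank_lt_size ν), by rw [← h1, Seq.sort_size]⟩
  have h1 : columnAug f = f 0 (Seq.base U 0 s) := by
    unfold columnAug
    refine Finset.sum_eq_single _ (fun w _ hw => ?_) fun h => absurd (mem_univ _) h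
    by_contra hc
    exact hw (h0 0 w hc).2
  funext k w
  rw [h1, Pi.smul_apply, Pi.smul_apply, smul_eq_mul, baseColumn]
  split_ifs with h
  · obtain ⟨rfl, rfl⟩ := h
    rw [mul_one]
  · rw [mul_zero]
    by_contra hc
    exact h (h0 k w hc)

/-- The contraction of a column, relative to a subcomplex `D` that is stable under the
contracting homotopies: a cycle modulo `D` is, modulo `D` and boundaries, a multiple of
`baseColumn`. -/
theorem exists_sub_faceSum_mem (D : Submodule 𝕜 (Column 𝕜 U s))
    (hD : ∀ f ∈ D, faceSum f ∈ D) (hD' : ∀ l, ∀ f ∈ D, contract l f ∈ D) (f : Column 𝕜 U s)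
    (n : ℤ) (hf : f.IsHomogeneous n) (hf' : faceSum f ∈ D) :
    ∃ g : Column 𝕜 U s, g.IsHomogeneous (n - 1) ∧ columnAug g = 0 ∧
      f - faceSum g - columnAug f • baseColumn 𝕜 U s ∈ D := by
  -- the balls are moved to the front one by one, in the order of their ranks
  have key : ∀ t, t ≤ U.size → ∃ g h : Column 𝕜 U s, g.IsHomogeneous (n - 1) ∧ columnAug g = 0 ∧
      h.IsHomogeneous n ∧ h.IsSorted t ∧ columnAug h = columnAug f ∧ f - faceSum g - h ∈ D := by
    intro t
    induction t with
    | zero =>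
      intro _
      refine ⟨0, f, fun _ _ h => absurd rfl h, by simp [columnAug], hf,
        fun _ _ _ => ⟨Seq.sort_zero _, fun _ h => absurd h (Nat.not_lt_zero _)⟩, rfl, ?_⟩
      have : faceSum (0 : Column 𝕜 U s) = 0 := (faceSumHom 𝕜 U s).map_zero
      rw [this]
      simp
    | succ t ih =>
      intro ht
      obtain ⟨g, h, hg, hg0, hh, hs, ha, hm⟩ := ih (by omega)
      obtain ⟨l, rfl⟩ := U.exists_rank_eq (show t < U.size by omega)
      refine ⟨g + contract l h, retract l h, ?_, ?_, hh.retract l, hs.retract,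
        (columnAug_retract l h).trans ha, ?_⟩
      · intro k w hne
        by_cases e : g k w = 0
        · refine hh.contract l k w fun e' => hne ?_
          rw [Pi.add_apply, Pi.add_apply, e, e', add_zero]
        · exact hg k w e
      · have : columnAug (g + contract l h) = columnAug g + columnAug (contract l h) := by
          simp [columnAug, Finset.sum_add_distrib]
        rw [this, hg0, zero_add]
        refine Finset.sum_eq_zero fun w _ => ?_
        rw [contract_of_eq_zero l h (Pi.zero_apply l)]
      · have h1 : faceSum h ∈ D := by
          have h2 := hD _ hm
          have h3 : faceSum (f - faceSum g - h) = faceSum f - faceSum h := by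
            change faceSumHom 𝕜 U s _ = faceSumHom 𝕜 U s f - faceSumHom 𝕜 U s h
            rw [map_sub, map_sub]
            change _ - faceSum (faceSum g) - _ = _
            rw [faceSum_faceSum, sub_zero]
          rw [h3] at h2
          have := D.sub_mem hf' h2
          rwa [sub_sub_cancel] at this
        have h2 : h - faceSum (contract l h) - retract l h = contract l (faceSum h) := by
          funext k w
          have h3 := faceSum_contract_add l h k w
          -- moving the prior balls to the front has no effect on `h`
          rw [pushForward_eq_self _ _ fun a ha' => (hs k a ha').1] at h3
          simp only [Pi.sub_apply]
          linear_combination -h3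
        have h3 : f - faceSum (g + contract l h) - retract l h =
            (f - faceSum g - h) + (h - faceSum (contract l h) - retract l h) := by
          rw [faceSum_add]
          abel
        rw [h3, h2]
        exact D.add_mem hm (hD' l _ h1)
  obtain ⟨g, h, hg, hg0, -, hs, ha, hm⟩ := key U.size le_rfl
  refine ⟨g, hg, hg0, ?_⟩
  rw [← ha, ← hs.eq_smul_baseColumn]
  exact hm

/-- The columns are acyclic: a cycle with augmentation zero is a boundary. -/
theorem exists_faceSum_eq (f : Column 𝕜 U s) (n : ℤ) (hf : f.IsHomogeneous n)
    (h0 : faceSum f = 0) (h1 : columnAug f = 0) :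
    ∃ g : Column 𝕜 U s, g.IsHomogeneous (n - 1) ∧ columnAug g = 0 ∧ faceSum g = f := by
  obtain ⟨g, hg, hg0, hm⟩ := exists_sub_faceSum_mem (⊥ : Submodule 𝕜 (Column 𝕜 U s))
    (fun f hf => by
      obtain rfl := (Submodule.mem_bot 𝕜).1 hf
      exact (Submodule.mem_bot 𝕜).2 (faceSumHom 𝕜 U s).map_zero)
    (fun l f hf => by
      obtain rfl := (Submodule.mem_bot 𝕜).1 hf
      refine (Submodule.mem_bot 𝕜).2 ?_
      funext k w
      unfold contract
      split_ifs
      · rfl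
      · change _ * pushForward _ (fun _ => 0) w = 0
        rw [pushForward_zero, mul_zero])
    f n hf ((Submodule.mem_bot 𝕜).2 h0)
  refine ⟨g, hg, hg0, ?_⟩
  have := (Submodule.mem_bot 𝕜).1 hm
  rw [h1, zero_smul, sub_zero, sub_eq_zero] at this
  exact this.symm

end Contraction

/-! ### Degenerate total orders -/

section Degenerate

variable {𝕜 : Type u} [Field 𝕜] {U : TwoDisk}

variable (𝕜 U) in
/-- The functions supported on the degenerate total orders. -/
def degenerateColumn : Submodule 𝕜 (Column 𝕜 U 0) where
  carrier := {f | ∀ k w, f k w ≠ 0 → w.IsDegenerate}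
  zero_mem' := fun _ _ h => absurd rfl h
  add_mem' := by
    intro f g hf hg k w h
    by_cases e : f k w = 0
    · exact hg k w fun e' => h (by rw [Pi.add_apply, Pi.add_apply, e, e', add_zero])
    · exact hf k w e
  smul_mem' := fun c f hf k w h => hf k w (right_ne_zero_of_mul h)

theorem exists_elemsMap_codegeneracyAt {k : U.Ball → ℕ} {l : U.Ball} (hl : k l ≠ 0)
    (x : Elems U (lower k l)) : ∃ y : Elems U k, Seq.elemsMap (codegeneracyAt k l) y = x ∧
      (InsertFront k l y ↔ U.rank x.1 < U.rank l) := by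
  obtain ⟨ν, i⟩ := x
  have hi := i.isLt
  by_cases e : ν = l
  · subst e
    have h1 := lower_self k ν
    refine ⟨⟨ν, ⟨i.val + 1, by omega⟩⟩, Sigma.ext rfl (heq_of_eq (Fin.ext ?_)), ?_⟩
    · simp [Seq.elemsMap, codegeneracyAt]
    · simp [InsertFront]
  · have h1 := lower_of_ne k e
    refine ⟨⟨ν, ⟨i.val, by omega⟩⟩, Sigma.ext rfl (heq_of_eq (Fin.ext ?_)), ?_⟩
    · simp [Seq.elemsMap, codegeneracyAt, e]
    · simp [InsertFront, e]

/-- Two consecutive elements of the same colour stay consecutive under the extra degeneracy: both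
of them are moved to the front, or neither of them is. -/
theorem Seq.IsDegenerate.insertAt {k : U.Ball → ℕ} {l : U.Ball} (hl : k l ≠ 0)
    {w : Seq U (lower k l) 0} (hw : w.IsDegenerate) : (Seq.insertAt k l w).IsDegenerate := by
  obtain ⟨x, y, hxy, h1, h2, h3⟩ := hw
  obtain ⟨x, rfl, hx⟩ := exists_elemsMap_codegeneracyAt hl x
  obtain ⟨y, rfl, hy⟩ := exists_elemsMap_codegeneracyAt hl y
  have hxy1 : x.1 = y.1 := h1
  have hpxy : InsertFront k l x ↔ InsertFront k l y := by rw [hx, hy, h1]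
  have hr := isRearrangement_insertAt (s := 0) k l
  have hle : ∀ a b : Elems U k, a.1 = b.1 →
      w.le (Seq.elemsMap (codegeneracyAt k l) a) (Seq.elemsMap (codegeneracyAt k l) b) →
      Seq.elemsMap (codegeneracyAt k l) a ≠ Seq.elemsMap (codegeneracyAt k l) b →
      a.2.val ≤ b.2.val := by
    rintro ⟨ν, i⟩ ⟨ν', j⟩ e h hne
    obtain rfl : ν = ν' := e
    by_contra hc
    refine hne (w.le_antisymm _ _ h (w.le_of_le ν _ _ ((codegeneracyAt k l ν).monotone ?_)))
    exact (not_le.1 hc).le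
  refine ⟨x, y, fun e => hxy (by rw [e]), h1, ?_, fun z hxz hzy => ?_⟩
  · rw [hr.le_iff]
    by_cases h : InsertFront k l x
    · exact Or.inr (Or.inl ⟨h, hpxy.1 h, h1, hle x y h1 h2 hxy⟩)
    · exact Or.inr (Or.inr ⟨h, fun h' => h (hpxy.2 h'), h2⟩)
  · rw [hr.le_iff] at hxz hzy
    by_cases h : InsertFront k l x
    · have h' := hpxy.1 h
      have hkey : frontKey (InsertFront k l) x = frontKey (InsertFront k l) y := by
        rw [frontKey_of_pos h, frontKey_of_pos h', hxy1]
      have hz : InsertFront k l z ∧ x.1 = z.1 ∧ x.2.val ≤ z.2.val ∧ z.2.val ≤ y.2.val := by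
        rcases hxz with h4 | ⟨-, h4, h5, h6⟩ | ⟨h4, -⟩
        · rcases hzy with h7 | ⟨h7, h7', h8, -⟩ | ⟨-, h7, -⟩
          · omega
          · rw [hkey, frontKey_of_pos h7, frontKey_of_pos h7', h8] at h4
            exact absurd h4 (lt_irrefl _)
          · exact absurd h' h7
        · rcases hzy with h7 | ⟨h7, h7', h8, h9⟩ | ⟨-, h7, -⟩
          · rw [← hkey, frontKey_of_pos h, frontKey_of_pos h4, h5] at h7
            exact absurd h7 (lt_irrefl _)
          · exact ⟨h4, h5, h6, h9⟩
          · exact absurd h' h7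
        · exact absurd h h4
      obtain ⟨hz, hz1, hz2, hz3⟩ := hz
      have hxl : x.1 ≠ l := by
        intro e
        have h4 := hx.1 h
        have h5 : U.rank x.1 < U.rank l := h4
        rw [e] at h5
        exact lt_irrefl _ h5
      obtain ⟨ν, i⟩ := x
      obtain ⟨ν', j⟩ := y
      obtain ⟨ν'', m⟩ := z
      obtain rfl : ν = ν' := hxy1
      obtain rfl : ν = ν'' := hz1
      have hcod : ∀ a b : Fin (k ν + 1), Seq.elemsMap (codegeneracyAt k l) ⟨ν, a⟩ =
          Seq.elemsMap (codegeneracyAt k l) ⟨ν, b⟩ → (⟨ν, a⟩ : Elems U k) = ⟨ν, b⟩ := by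
        intro a b e
        have e2 : codegeneracyAt k l ν a = codegeneracyAt k l ν b := by
          simpa [Seq.elemsMap] using e
        have e3 : (if ν = l then a.val - 1 else a.val) = if ν = l then b.val - 1 else b.val :=
          congrArg Fin.val e2
        rw [if_neg hxl, if_neg hxl] at e3
        rw [Fin.ext e3]
      rcases h3 (Seq.elemsMap (codegeneracyAt k l) ⟨ν, m⟩)
        (w.le_of_le ν _ _ ((codegeneracyAt k l ν).monotone hz2))
        (w.le_of_le ν _ _ ((codegeneracyAt k l ν).monotone hz3)) with h4 | h4
      · exact Or.inl (hcod _ _ h4)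
      · exact Or.inr (hcod _ _ h4)
    · have h' : ¬ InsertFront k l y := fun h' => h (hpxy.2 h')
      have hf := isFront_insertFront k l
      rcases hxz with h4 | ⟨h4, -⟩ | ⟨-, hz, h4⟩
      · exact absurd h4 (not_frontKey_lt_of_neg h)
      · exact absurd h4 h
      · rcases hzy with h7 | ⟨h7, -⟩ | ⟨-, -, h7⟩
        · exact absurd h7 (not_frontKey_lt_of_neg hz)
        · exact absurd h7 hz
        · rcases h3 _ h4 h7 with h8 | h8
          · exact Or.inl (hf.inj _ _ hz h h8)
          · exact Or.inr (hf.inj _ _ hz h' h8)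

theorem faceSum_mem_degenerateColumn (f : Column 𝕜 U 0) (hf : f ∈ degenerateColumn 𝕜 U) :
    faceSum f ∈ degenerateColumn 𝕜 U := by
  intro k w hne
  by_contra hw
  exact hne (faceSum_eq_zero_of_not_isDegenerate hf hw)

theorem contract_mem_degenerateColumn (l : U.Ball) (f : Column 𝕜 U 0)
    (hf : f ∈ degenerateColumn 𝕜 U) : contract l f ∈ degenerateColumn 𝕜 U := by
  intro k w hne
  by_cases hl : k l = 0
  · rw [contract_of_eq_zero l f hl] at hne
    exact absurd rfl hne
  · rw [contract_of_ne_zero l f hl] at hne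
    obtain ⟨v, rfl, hv⟩ := exists_of_pushForward_ne_zero (right_ne_zero_of_mul hne)
    exact (hf _ _ hv).insertAt hl

theorem columnAug_eq_zero_of_mem_degenerateColumn {f : Column 𝕜 U 0}
    (hf : f ∈ degenerateColumn 𝕜 U) : columnAug f = 0 := by
  refine Finset.sum_eq_zero fun w _ => ?_
  by_contra hne
  obtain ⟨⟨ν, i⟩, ⟨ν', j⟩, hxy, h1, -⟩ := hf _ _ hne
  obtain rfl : ν = ν' := h1
  exact hxy (by rw [Subsingleton.elim (α := Fin 1) i j])

end Degenerate

/-! ### The cohomology of the condensation -/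

section Cohomology

variable {𝕜 : Type u} [Field 𝕜] {U : TwoDisk}

variable (𝕜 U) in
/-- The alternating sum of the cofaces, for a single column. -/
def cofaceStep (s : ℕ) : Column 𝕜 U s →ₗ[𝕜] Column 𝕜 U (s + 1) where
  toFun := fun f k w =>
    ∑ j ∈ range (s + 2), (-1) ^ j * pushForward (Seq.push (coface s j)) (f k) w
  map_add' := by
    intro f g
    funext k w
    simp only [Pi.add_apply, pushForward_add', mul_add, Finset.sum_add_distrib]
  map_smul' := by
    intro c f
    funext k w
    simp only [Pi.smul_apply, pushForward_smul, smul_eq_mul, Finset.mul_sum, RingHom.id_apply]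
    refine Finset.sum_congr rfl fun j _ => ?_
    ring

theorem cofaceSum_succ (f : Cochains 𝕜 U) (s : ℕ) :
    cofaceSum f (s + 1) = cofaceStep 𝕜 U s (f s) := rfl

theorem columnAug_cofaceStep {s : ℕ} (f : Column 𝕜 U s) :
    columnAug (cofaceStep 𝕜 U s f) = (∑ j ∈ range (s + 2), (-1) ^ j) * columnAug f := by
  change ∑ w : Seq U 0 (s + 1), ∑ j ∈ range (s + 2),
    (-1) ^ j * pushForward (Seq.push (coface s j)) (f 0) w = _
  rw [Finset.sum_comm]
  simp_rw [← Finset.mul_sum, sum_pushForward]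
  rw [← Finset.sum_mul]
  rfl

variable (𝕜 U) in
/-- The augmentation of a column, as a linear map. -/
def columnAugHom (s : ℕ) : Column 𝕜 U s →ₗ[𝕜] 𝕜 where
  toFun := columnAug
  map_add' := fun f g => by simp [columnAug, Finset.sum_add_distrib]
  map_smul' := fun c f => by simp [columnAug, Finset.mul_sum]

theorem sgn_mul_self (n : ℤ) : sgn 𝕜 n * sgn 𝕜 n = 1 := by
  unfold sgn
  rw [← Int.cast_mul, ← Units.val_mul, Int.units_mul_self]
  simp

theorem sgn_smul_sgn_smul {M : Type*} [AddCommGroup M] [Module 𝕜 M] (n : ℤ) (x : M) :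
    sgn 𝕜 n • sgn 𝕜 n • x = x := by
  rw [smul_smul, sgn_mul_self, one_smul]

theorem condensationD_apply {n m : ℤ} (h : n + 1 = m) (f : condensationX 𝕜 U n) (s : ℕ) :
    (condensationD 𝕜 U n m h f).1 s = cofaceSum f.1 s - sgn 𝕜 n • faceSum (f.1 s) := rfl

theorem columnAug_eq_zero_of_ne {n : ℤ} (f : condensationX 𝕜 U n) {s : ℕ} (h : (s : ℤ) ≠ n) :
    columnAug (f.1 s) = 0 := by
  refine Finset.sum_eq_zero fun w _ => ?_
  by_contra hne
  have := f.2 _ _ _ hne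
  simp [cellDeg] at this
  exact h this

/-- A cocycle all of whose columns have augmentation zero is a coboundary: the columns of a
primitive are constructed one after the other, the columns being acyclic. -/
theorem exists_condensationD_eq_of_columnAug {m n : ℤ} (h : m + 1 = n) (f : condensationX 𝕜 U n)
    (hf : condensationD 𝕜 U n (n + 1) rfl f = 0) (h0 : ∀ s, columnAug (f.1 s) = 0) :
    ∃ g : condensationX 𝕜 U m, (∀ s, columnAug (g.1 s) = 0) ∧ condensationD 𝕜 U m n h g = f := by
  classical
  have hex : ∀ (s : ℕ) (x : Column 𝕜 U s), ∃ y : Column 𝕜 U s, x.IsHomogeneous n →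
      faceSum x = 0 → columnAug x = 0 → y.IsHomogeneous m ∧ columnAug y = 0 ∧ faceSum y = x := by
    intro s x
    by_cases hx : x.IsHomogeneous n ∧ faceSum x = 0 ∧ columnAug x = 0
    · obtain ⟨y, h1, h2⟩ := exists_faceSum_eq x n hx.1 hx.2.1 hx.2.2
      rw [show n - 1 = m by omega] at h1
      exact ⟨y, fun _ _ _ => ⟨h1, h2⟩⟩
    · exact ⟨0, fun h1 h2 h3 => absurd ⟨h1, h2, h3⟩ hx⟩
  choose H hH using hex
  -- the column `s` of the primitive is determined by the equation `d_J g - (-1) ^ m d_I g = f`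
  let g : Cochains 𝕜 U := fun s => Nat.rec (motive := fun s => Column 𝕜 U s)
    (H 0 (sgn 𝕜 m • (0 - f.1 0)))
    (fun s y => H (s + 1) (sgn 𝕜 m • (cofaceStep 𝕜 U s y - f.1 (s + 1)))) s
  have hg : ∀ s, g s = H s (sgn 𝕜 m • (cofaceSum g s - f.1 s)) := by
    intro s
    cases s with
    | zero => rfl
    | succ s => rfl
  clear_value g
  have hn : sgn 𝕜 n = - sgn 𝕜 m := by rw [← h, sgn_succ]
  have hdf : ∀ s, cofaceSum f.1 s + sgn 𝕜 m • faceSum (f.1 s) = 0 := by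
    intro s
    have := congrFun (congrArg Subtype.val hf) s
    rw [condensationD_apply, hn, neg_smul, sub_neg_eq_add] at this
    exact this
  have hfs : ∀ s, (f.1 s).IsHomogeneous n := fun s k w => f.2 s k w
  have hhom : ∀ s, Column.IsHomogeneous (cofaceSum g s) n →
      Column.IsHomogeneous (sgn 𝕜 m • (cofaceSum g s - f.1 s)) n := by
    intro s hc k w hne
    have hne : cofaceSum g s k w - f.1 s k w ≠ 0 := right_ne_zero_of_mul hne
    by_cases e : f.1 s k w = 0
    · rw [e, sub_zero] at hne
      exact hc _ _ hne
    · exact hfs s _ _ e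
  have key : ∀ s, (g s).IsHomogeneous m ∧ columnAug (g s) = 0 ∧
      faceSum (g s) = sgn 𝕜 m • (cofaceSum g s - f.1 s) := by
    intro s
    induction s with
    | zero =>
      rw [hg]
      have h1 : cofaceSum g 0 = 0 := rfl
      have h2 := hdf 0
      rw [show cofaceSum f.1 0 = 0 from rfl, zero_add] at h2
      refine hH 0 _ (hhom 0 ?_) ?_ ?_
      · rw [h1]
        exact fun _ _ h => absurd rfl h
      · rw [h1, zero_sub, smul_neg]
        change faceSumHom 𝕜 U 0 _ = 0
        rw [map_neg, map_smul]
        change -(sgn 𝕜 m • faceSum (f.1 0)) = 0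
        rw [h2, neg_zero]
      · rw [h1, zero_sub, smul_neg]
        change columnAugHom 𝕜 U 0 _ = 0
        rw [map_neg, map_smul]
        change -(sgn 𝕜 m • columnAug (f.1 0)) = 0
        rw [h0, smul_zero, neg_zero]
    | succ s ih =>
      rw [hg]
      have h2 := hdf (s + 1)
      refine hH (s + 1) _ (hhom (s + 1) ?_) ?_ ?_
      · intro k w hne
        obtain ⟨s', v, hs, hv⟩ := exists_of_cofaceSum_ne_zero hne
        obtain rfl : s = s' := by omega
        have h3 := ih.1 _ _ hv
        rw [← h, ← h3]
        unfold cellDeg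
        push_cast
        ring
      · have h4 : faceSum (cofaceSum g (s + 1)) = - sgn 𝕜 m • cofaceSum f.1 (s + 1) := by
          rw [faceSum_cofaceSum, cofaceSum_succ, ih.2.2, map_smul, map_sub, ← cofaceSum_succ,
            cofaceSum_cofaceSum, ← cofaceSum_succ, Pi.zero_apply, zero_sub, smul_neg, neg_smul]
        change faceSumHom 𝕜 U (s + 1) _ = 0
        rw [map_smul, map_sub]
        change sgn 𝕜 m • (faceSum (cofaceSum g (s + 1)) - faceSum (f.1 (s + 1))) = 0
        rw [h4, eq_neg_of_add_eq_zero_left h2, neg_smul, smul_neg, neg_neg, sgn_smul_sgn_smul,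
          sub_self, smul_zero]
      · change columnAugHom 𝕜 U (s + 1) _ = 0
        rw [map_smul, map_sub]
        change sgn 𝕜 m • (columnAug (cofaceSum g (s + 1)) - columnAug (f.1 (s + 1))) = 0
        rw [cofaceSum_succ, columnAug_cofaceStep, ih.2.1, h0, mul_zero, sub_zero, smul_zero]
  refine ⟨⟨g, fun s k w => (key s).1 k w⟩, fun s => (key s).2.1, Subtype.ext (funext fun s => ?_)⟩
  rw [condensationD_apply]
  change cofaceSum g s - sgn 𝕜 m • faceSum (g s) = f.1 s
  rw [(key s).2.2, sgn_smul_sgn_smul, sub_sub_cancel]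

variable (𝕜 U) in
/-- The cochain `baseColumn` in the column `s`. -/
def baseCochain (s : ℕ) : condensationX 𝕜 U s :=
  ⟨fun s' => if s' = s then baseColumn 𝕜 U s' else 0, by
    intro s' k w hne
    beta_reduce at hne
    split_ifs at hne with h
    · subst h
      unfold baseColumn at hne
      split_ifs at hne with h'
      · simp [cellDeg, h'.1]
      · exact absurd rfl hne
    · exact absurd rfl hne⟩

theorem columnAug_baseCochain (s s' : ℕ) :
    columnAug ((baseCochain 𝕜 U s).1 s') = if s' = s then 1 else 0 := by
  unfold baseCochain
  dsimp only
  split_ifs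
  · exact columnAug_baseColumn
  · simp [columnAug]

theorem columnAug_condensationD {n m : ℤ} (h : n + 1 = m) (f : condensationX 𝕜 U n) (s : ℕ) :
    columnAug ((condensationD 𝕜 U n m h f).1 s) = columnAug (cofaceSum f.1 s) := by
  rw [condensationD_apply]
  change columnAugHom 𝕜 U s _ = _
  rw [map_sub, map_smul]
  change _ - _ • columnAug (faceSum (f.1 s)) = _
  rw [columnAug_faceSum, smul_zero, sub_zero]
  rfl

theorem columnAug_cofaceSum_zero (f : Cochains 𝕜 U) : columnAug (cofaceSum f 0) = 0 := by
  simp [columnAug, cofaceSum]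

/-- A cocycle of degree different from `0`, or of degree `0` with augmentation zero, is a
coboundary. The constant cosimplicial vector space formed by the augmentations of the columns
contributes to degree `0` only. -/
theorem exists_condensationD_eq {m n : ℤ} (h : m + 1 = n) (f : condensationX 𝕜 U n)
    (hf : condensationD 𝕜 U n (n + 1) rfl f = 0) (h0 : n = 0 → columnAug (f.1 0) = 0) :
    ∃ g : condensationX 𝕜 U m, condensationD 𝕜 U m n h g = f := by
  by_cases hn : 0 < n
  · obtain ⟨p, rfl⟩ : ∃ p : ℕ, m = p := ⟨m.toNat, by omega⟩
    subst h
    have hsum := neg_one_geom_sum (R := 𝕜) (n := p + 2)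
    have hsum' := neg_one_geom_sum (R := 𝕜) (n := p + 3)
    rcases Nat.even_or_odd p with hp | hp
    · -- from the odd degree `p + 1`, the alternating sum of the cofaces is the identity on
      -- augmentations, so that the augmentation of a cocycle vanishes
      obtain ⟨g, -, hg⟩ := exists_condensationD_eq_of_columnAug rfl f hf (fun s => by
        by_cases hs : (s : ℤ) = p + 1
        · obtain rfl : s = p + 1 := by omega
          have h1 := columnAug_condensationD rfl f (p + 2)
          rw [hf, cofaceSum_succ, columnAug_cofaceStep, hsum', if_neg (by
            rw [Nat.even_add_one, Nat.even_add]
            simpa using hp), one_mul] at h1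
          rw [← h1]
          simp [columnAug]
        · exact columnAug_eq_zero_of_ne f hs)
      exact ⟨g, hg⟩
    · -- into the even degree `p + 1` it is the identity too, and a multiple of the base cell in
      -- degree `p` serves to make the augmentation vanish
      let c := columnAug (f.1 (p + 1))
      let f' := f - condensationD 𝕜 U p (p + 1) rfl (c • baseCochain 𝕜 U p)
      have hf' : condensationD 𝕜 U (p + 1) (p + 1 + 1) rfl f' = 0 := by
        rw [map_sub, hf, zero_sub, neg_eq_zero]
        exact LinearMap.congr_fun (condensationD_comp 𝕜 U p (p + 1) (p + 1 + 1) rfl rfl) _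
      obtain ⟨g, -, hg⟩ := exists_condensationD_eq_of_columnAug rfl f' hf' (fun s => by
        by_cases hs : (s : ℤ) = p + 1
        · obtain rfl : s = p + 1 := by omega
          have h1 : columnAug (f'.1 (p + 1)) = c - columnAug
            ((condensationD 𝕜 U p (p + 1) rfl (c • baseCochain 𝕜 U p)).1 (p + 1)) :=
            (columnAugHom 𝕜 U (p + 1)).map_sub _ _
          have h2 : columnAug ((c • baseCochain 𝕜 U p).1 p) = c := by
            have : columnAug ((c • baseCochain 𝕜 U p).1 p) =
              c • columnAug ((baseCochain 𝕜 U p).1 p) := (columnAugHom 𝕜 U p).map_smul c _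
            rw [this, columnAug_baseCochain, if_pos rfl, smul_eq_mul, mul_one]
          rw [h1, columnAug_condensationD, cofaceSum_succ, columnAug_cofaceStep, hsum,
            if_neg (by
              rw [Nat.even_add]
              simpa using hp), one_mul, h2, sub_self]
        · exact columnAug_eq_zero_of_ne f' hs)
      refine ⟨g + c • baseCochain 𝕜 U p, ?_⟩
      rw [map_add, hg, sub_add_cancel]
  · obtain ⟨g, -, hg⟩ := exists_condensationD_eq_of_columnAug h f hf (fun s => by
      by_cases hs : (s : ℤ) = n
      · obtain rfl : s = 0 := by omega
        exact h0 (by simpa using hs.symm)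
      · exact columnAug_eq_zero_of_ne f hs)
    exact ⟨g, hg⟩

variable (𝕜 U) in
/-- There is a cocycle of degree `0` with augmentation `1`. -/
theorem exists_cocycle_columnAug_eq_one : ∃ e : condensationX 𝕜 U 0,
    condensationD 𝕜 U 0 1 rfl e = 0 ∧ columnAug (e.1 0) = 1 := by
  let b : condensationX 𝕜 U 0 := baseCochain 𝕜 U 0
  obtain ⟨g, hg, hg'⟩ := exists_condensationD_eq_of_columnAug (U := U) (zero_add 1)
    (condensationD 𝕜 U 0 1 rfl b)
    (LinearMap.congr_fun (condensationD_comp 𝕜 U 0 1 (1 + 1) rfl rfl) b) (fun s => by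
      rw [columnAug_condensationD]
      match s with
      | 0 => exact columnAug_cofaceSum_zero _
      | s + 1 =>
        rw [cofaceSum_succ, columnAug_cofaceStep]
        change _ * columnAug ((baseCochain 𝕜 U 0).1 s) = 0
        rw [columnAug_baseCochain]
        split_ifs with h
        · subst h
          simp [Finset.sum_range_succ]
        · rw [mul_zero])
  refine ⟨b - g, ?_, ?_⟩
  · rw [map_sub, hg', sub_self]
  · have : columnAug ((b - g).1 0) = columnAug (b.1 0) - columnAug (g.1 0) :=
      (columnAugHom 𝕜 U 0).map_sub _ _
    rw [this, hg, sub_zero]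
    change columnAug ((baseCochain 𝕜 U 0).1 0) = 1
    rw [columnAug_baseCochain, if_pos rfl]

end Cohomology

/-! ### Quasi-isomorphisms to the constant complex -/

section QuasiIso

variable {𝕜 : Type u} [Field 𝕜]

/-- Over a field, a linear map lifts through another one if its values do. -/
theorem exists_comp_eq_of_forall {A P M : Type*} [AddCommGroup A] [Module 𝕜 A] [AddCommGroup P]
    [Module 𝕜 P] [AddCommGroup M] [Module 𝕜 M] (f : P →ₗ[𝕜] M) (g : A →ₗ[𝕜] M)
    (h : ∀ a, ∃ p, f p = g a) : ∃ l : A →ₗ[𝕜] P, f.comp l = g := by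
  obtain ⟨l, hl⟩ := Module.projective_lifting_property f.rangeRestrict
    (g.codRestrict (LinearMap.range f) h) f.surjective_rangeRestrict
  refine ⟨l, LinearMap.ext fun a => ?_⟩
  exact congrArg Subtype.val (LinearMap.congr_fun hl a)

/-- The criterion for quasi-isomorphisms in terms of elements. -/
theorem quasiIso_of_elements {K L : CochainComplex (ModuleCat.{u} 𝕜) ℤ} (φ : K ⟶ L)
    (inj : ∀ m n : ℤ, m + 1 = n → ∀ x : K.X n, (K.d n (n + 1)).hom x = 0 →
      (∃ y : L.X m, (L.d m n).hom y = (φ.f n).hom x) → ∃ z : K.X m, (K.d m n).hom z = x)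
    (surj : ∀ m n : ℤ, m + 1 = n → ∀ y : L.X n, (L.d n (n + 1)).hom y = 0 →
      ∃ x : K.X n, (K.d n (n + 1)).hom x = 0 ∧
        ∃ z : L.X m, (φ.f n).hom x + (L.d m n).hom z = y) : QuasiIso φ := by
  rw [quasiIso_iff]
  intro n
  rw [quasiIsoAt_iff_isIso_homologyMap]
  have hprev : (ComplexShape.up ℤ).prev n = n - 1 := by simp
  have hnext : (ComplexShape.up ℤ).next n = n + 1 := by simp
  have h1 : Mono (HomologicalComplex.homologyMap φ n) := by
    rw [HomologicalComplex.mono_homologyMap_iff_up_to_refinements φ _ n _ hprev hnext]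
    intro A x hx y hxy
    obtain ⟨l, hl⟩ := exists_comp_eq_of_forall (K.d (n - 1) n).hom x.hom (fun a =>
      inj (n - 1) n (by ring) (x.hom a)
        (LinearMap.congr_fun (congrArg ModuleCat.Hom.hom hx) a)
        ⟨y.hom a, (LinearMap.congr_fun (congrArg ModuleCat.Hom.hom hxy) a).symm⟩)
    refine ⟨A, 𝟙 A, inferInstance, ModuleCat.ofHom l, ?_⟩
    rw [Category.id_comp]
    exact ModuleCat.hom_ext hl.symm
  have h2 : Epi (HomologicalComplex.homologyMap φ n) := by
    rw [HomologicalComplex.epi_homologyMap_iff_up_to_refinements φ _ n _ hprev hnext]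
    intro A y hy
    obtain ⟨l, hl⟩ := exists_comp_eq_of_forall
      (LinearMap.coprod ((φ.f n).hom.comp (LinearMap.ker (K.d n (n + 1)).hom).subtype)
        (L.d (n - 1) n).hom) y.hom (fun a => by
        obtain ⟨x, hx, z, hz⟩ := surj (n - 1) n (by ring) (y.hom a)
          (LinearMap.congr_fun (congrArg ModuleCat.Hom.hom hy) a)
        exact ⟨(⟨x, hx⟩, z), hz⟩)
    refine ⟨A, 𝟙 A, inferInstance, ModuleCat.ofHom ((LinearMap.ker (K.d n (n + 1)).hom).subtype.comp
      ((LinearMap.fst 𝕜 _ _).comp l)), ?_, ModuleCat.ofHom ((LinearMap.snd 𝕜 _ _).comp l), ?_⟩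
    · exact ModuleCat.hom_ext (LinearMap.ext fun a => (l a).1.2)
    · rw [Category.id_comp]
      exact ModuleCat.hom_ext hl.symm
  exact isIso_of_mono_of_epi _

theorem subsingleton_constantX {n : ℤ} (h : n ≠ 0) : Subsingleton (constantX 𝕜 n) := by
  have h0 : ∀ c : constantX 𝕜 n, c = 0 := fun c =>
    Subtype.ext (by_contra fun hne => h (c.2 hne))
  exact ⟨fun a b => (h0 a).trans (h0 b).symm⟩

variable (𝕜) in
/-- The homology of the constant complex, whose differential is zero. -/
def constantHomologyIso (n : ℤ) :
    (constantComplex 𝕜).homology n ≅ ModuleCat.of 𝕜 (constantX 𝕜 n) :=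
  (ShortComplex.HomologyData.ofZeros ((constantComplex 𝕜).sc n) rfl rfl).left.homologyIso

variable (𝕜) in
theorem constantX_zero : constantX 𝕜 0 = ⊤ :=
  eq_top_iff.2 fun _ _ _ => rfl

variable (𝕜) (U : TwoDisk)

theorem norBreq_d_mk {n m : ℤ} (h : n + 1 = m) (f : breqX 𝕜 U n) :
    ((norBreq 𝕜 U).d n m).hom ((breqDegenerate 𝕜 U n).mkQ f) =
      (breqDegenerate 𝕜 U m).mkQ (breqD 𝕜 U n m h f) := by
  have : (norBreq 𝕜 U).d n m = ModuleCat.ofHom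
    (Submodule.mapQ _ _ (breqD 𝕜 U n m h) (breqDegenerate_le 𝕜 U n m h)) := dif_pos h
  rw [this]
  rfl

/-- The augmentation of `Breq(U)`. -/
def breqAug (n : ℤ) : breqX 𝕜 U n →ₗ[𝕜] constantX 𝕜 n where
  toFun := fun f => ⟨columnAug f.1, fun h => by
    obtain ⟨w, -, hw⟩ := Finset.exists_ne_zero_of_sum_ne_zero h
    rw [← f.2 _ _ hw]
    simp [cellDeg]⟩
  map_add' := fun f g => Subtype.ext ((columnAugHom 𝕜 U 0).map_add f.1 g.1)
  map_smul' := fun c f => Subtype.ext ((columnAugHom 𝕜 U 0).map_smul c f.1)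

theorem breqDegenerate_le_ker (n : ℤ) :
    breqDegenerate 𝕜 U n ≤ LinearMap.ker (breqAug 𝕜 U n) := fun f hf =>
  Subtype.ext (columnAug_eq_zero_of_mem_degenerateColumn (f := f.1) hf)

/-- The augmentation of the normalised complex. -/
def norBreqAug : norBreq 𝕜 U ⟶ constantComplex 𝕜 where
  f := fun n => ModuleCat.ofHom ((breqDegenerate 𝕜 U n).liftQ (breqAug 𝕜 U n)
    (breqDegenerate_le_ker 𝕜 U n))
  comm' := by
    rintro n m rfl
    refine ModuleCat.hom_ext (Submodule.linearMap_qext _ (LinearMap.ext fun f => ?_))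
    change 0 = (breqDegenerate 𝕜 U (n + 1)).liftQ (breqAug 𝕜 U (n + 1))
      (breqDegenerate_le_ker 𝕜 U (n + 1))
      (((norBreq 𝕜 U).d n (n + 1)).hom ((breqDegenerate 𝕜 U n).mkQ f))
    rw [norBreq_d_mk 𝕜 U rfl]
    exact (Subtype.ext (columnAug_faceSum f.1)).symm

theorem faceSum_baseColumn (s : ℕ) : faceSum (baseColumn 𝕜 U s) = 0 := by
  funext k w
  by_contra h
  obtain ⟨ν, v, hv⟩ := exists_of_faceSum_ne_zero h
  unfold baseColumn at hv
  split_ifs at hv with h'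
  · have := congrFun h'.1 ν
    rw [raise_self] at this
    exact absurd this (Nat.succ_ne_zero _)
  · exact hv rfl

/-- The cell `baseColumn` as an element of `Breq(U)`. -/
def breqBase : breqX 𝕜 U 0 :=
  ⟨baseColumn 𝕜 U 0, by
    intro k w h
    unfold baseColumn at h
    split_ifs at h with h'
    · simp [cellDeg, h'.1]
    · exact absurd rfl h⟩

instance quasiIso_norBreqAug : QuasiIso (norBreqAug 𝕜 U) := by
  refine quasiIso_of_elements _ ?_ ?_
  · rintro m n h x hx ⟨y, hy⟩
    obtain ⟨f, rfl⟩ := (breqDegenerate 𝕜 U n).mkQ_surjective x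
    rw [norBreq_d_mk 𝕜 U rfl] at hx
    have hx' := (Submodule.Quotient.mk_eq_zero _).1 hx
    have hy : (0 : constantX 𝕜 n) = breqAug 𝕜 U n f := hy
    have h0 : columnAug f.1 = 0 := (congrArg Subtype.val hy).symm
    obtain ⟨g, hg, -, hfg⟩ := exists_sub_faceSum_mem (degenerateColumn 𝕜 U)
      faceSum_mem_degenerateColumn contract_mem_degenerateColumn f.1 n f.2 hx'
    rw [h0, zero_smul, sub_zero] at hfg
    obtain rfl : m = n - 1 := by omega
    refine ⟨(breqDegenerate 𝕜 U (n - 1)).mkQ ⟨g, hg⟩, ?_⟩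
    rw [norBreq_d_mk 𝕜 U h]
    refine ((Submodule.Quotient.eq _).2 ?_).symm
    exact hfg
  · rintro m n h y -
    by_cases hn : n = 0
    · subst hn
      refine ⟨(breqDegenerate 𝕜 U 0).mkQ ((y : constantX 𝕜 0).1 • breqBase 𝕜 U), ?_, 0, ?_⟩
      · rw [norBreq_d_mk 𝕜 U rfl, map_smul]
        have : breqD 𝕜 U 0 (0 + 1) rfl (breqBase 𝕜 U) = 0 :=
          Subtype.ext (faceSum_baseColumn 𝕜 U 0)
        rw [this, smul_zero, map_zero]
        rfl
      · rw [map_zero, add_zero]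
        refine Subtype.ext ?_
        change columnAug ((y : constantX 𝕜 0).1 • baseColumn 𝕜 U 0) = (y : constantX 𝕜 0).1
        rw [show columnAug ((y : constantX 𝕜 0).1 • baseColumn 𝕜 U 0) =
          (y : constantX 𝕜 0).1 • columnAug (baseColumn 𝕜 U 0) from
          (columnAugHom 𝕜 U 0).map_smul _ _, columnAug_baseColumn, smul_eq_mul, mul_one]
    · have := subsingleton_constantX (𝕜 := 𝕜) hn
      exact ⟨0, map_zero _, 0, Subsingleton.elim (α := constantX 𝕜 n) _ _⟩

theorem nonempty_norBreq_homology_zero_iso :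
    Nonempty ((norBreq 𝕜 U).homology 0 ≅ ModuleCat.of 𝕜 𝕜) :=
  ⟨asIso (HomologicalComplex.homologyMap (norBreqAug 𝕜 U) 0) ≪≫ constantHomologyIso 𝕜 0 ≪≫
    ((LinearEquiv.ofEq _ _ (constantX_zero 𝕜)).trans Submodule.topEquiv).toModuleIso⟩

theorem isZero_norBreq_homology {n : ℤ} (h : n ≠ 0) : Limits.IsZero ((norBreq 𝕜 U).homology n) := by
  have := subsingleton_constantX (𝕜 := 𝕜) h
  exact (ModuleCat.isZero_of_subsingleton (ModuleCat.of 𝕜 (constantX 𝕜 n))).of_iso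
    (asIso (HomologicalComplex.homologyMap (norBreqAug 𝕜 U) n) ≪≫ constantHomologyIso 𝕜 n)

end QuasiIso

/-! ### The linear extension of the composition of `seq` -/

section CompAt

variable {𝕜 : Type u} [Field 𝕜]

theorem pushForward_id {A : Type} [Fintype A] (f : A → 𝕜) : pushForward (fun a => a) f = f :=
  pushForward_eq_self _ _ fun _ _ => rfl

/-- The push-forward of a product of functions along a product of maps. -/
theorem pushForward_tensor {A B I : Type} [Fintype I] [Fintype A] {X Y : I → Type}
    [DecidableEq I] [∀ i, Fintype (X i)] (g : A → B) (h : ∀ i, X i → Y i) (f : A → 𝕜)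
    (f' : ∀ i, X i → 𝕜) (q : B × (∀ i, Y i)) :
    pushForward (fun p : A × (∀ i, X i) => (g p.1, fun i => h i (p.2 i)))
        (fun p => f p.1 * ∏ i, f' i (p.2 i)) q =
      pushForward g f q.1 * ∏ i, pushForward (h i) (f' i) (q.2 i) := by
  classical
  unfold pushForward
  rw [Finset.prod_univ_sum, Finset.sum_mul_sum, Fintype.sum_prod_type, Fintype.piFinset_univ]
  refine Finset.sum_congr rfl fun a _ => Finset.sum_congr rfl fun x _ => ?_
  rw [Prod.ext_iff, funext_iff]
  by_cases h1 : g a = q.1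
  · by_cases h2 : ∀ i, h i (x i) = q.2 i
    · simp [h1, h2]
    · rw [if_neg fun h3 => h2 h3.2]
      push Not at h2
      obtain ⟨i, hi⟩ := h2
      rw [Finset.prod_eq_zero (mem_univ i) (if_neg hi), mul_zero]
  · rw [if_neg fun h3 => h1 h3.1, if_neg h1, zero_mul]

variable {T S : TwoDisk} {σ : T.Hom S} {F : S.Ball → TwoDisk}

/-- The linear combination of the compositions of the cells, with the products of the given
coefficients. -/
def compFun (ι : Fibres σ F) (J : S.Ball → ℕ) (k : T.Ball → ℕ) (s : ℕ) (B : Seq S J s → 𝕜)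
    (A : ∀ μ, Seq (F μ) (fun x => k (ι.incl μ x)) (J μ) → 𝕜) : Seq T k s → 𝕜 :=
  pushForward (fun p : Seq S J s × (∀ μ, Seq (F μ) (fun x => k (ι.incl μ x)) (J μ)) =>
    Seq.comp ι p.1 p.2) (fun p => B p.1 * ∏ μ, A μ (p.2 μ))

variable (𝕜) in
/-- The linear extension of the composition of `seq`, for ordinals of given dimensions. -/
def compAt (ι : Fibres σ F) (J : S.Ball → ℕ) (k : T.Ball → ℕ) (s : ℕ) :
    (Seq S J s → 𝕜) →ₗ[𝕜] MultilinearMap 𝕜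
      (fun μ => Seq (F μ) (fun x => k (ι.incl μ x)) (J μ) → 𝕜) (Seq T k s → 𝕜) where
  toFun := fun B =>
    { toFun := compFun ι J k s B
      map_update_add' := by
        intro inst A μ x y
        obtain rfl : inst = fun a b => Sigma.instDecidableEqSigma a b := Subsingleton.elim _ _
        unfold compFun
        rw [← pushForward_add']
        congr 1
        funext p
        rw [Pi.add_apply, ← mul_add]
        congr 1
        exact prod_update_add (fun μ => LinearMap.proj (p.2 μ)) A μ x y
      map_update_smul' := by
        intro inst A μ c x
        obtain rfl : inst = fun a b => Sigma.instDecidableEqSigma a b := Subsingleton.elim _ _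
        unfold compFun
        rw [← pushForward_smul]
        congr 1
        funext p
        rw [Pi.smul_apply, smul_eq_mul, mul_left_comm]
        congr 1
        exact prod_update_smul (fun μ => LinearMap.proj (p.2 μ)) A μ c x }
  map_add' := fun B B' => MultilinearMap.ext fun A => by
    change compFun ι J k s (B + B') A = compFun ι J k s B A + compFun ι J k s B' A
    unfold compFun
    rw [← pushForward_add']
    congr 1
    funext p
    simp only [Pi.add_apply, add_mul]
  map_smul' := fun c B => MultilinearMap.ext fun A => by
    change compFun ι J k s (c • B) A = c • compFun ι J k s B A
    unfold compFun
    rw [← pushForward_smul]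
    congr 1
    funext p
    simp only [Pi.smul_apply, smul_eq_mul, mul_assoc]

theorem compAt_apply (ι : Fibres σ F) (J : S.Ball → ℕ) (k : T.Ball → ℕ) (s : ℕ)
    (B : Seq S J s → 𝕜) (A : ∀ μ, Seq (F μ) (fun x => k (ι.incl μ x)) (J μ) → 𝕜) :
    compAt 𝕜 ι J k s B A = pushForward
        (fun p : Seq S J s × (∀ μ, Seq (F μ) (fun x => k (ι.incl μ x)) (J μ)) =>
          Seq.comp ι p.1 p.2) (fun p => B p.1 * ∏ μ, A μ (p.2 μ)) := rfl

theorem compCochain_eq_compAt (ι : Fibres σ F) (a : S.Ball → ℤ) (β : Cochains 𝕜 S)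
    (α : ∀ μ, Cochains 𝕜 (F μ)) (s : ℕ) (k : T.Ball → ℕ) :
    compCochain 𝕜 ι a β α s k = sgn 𝕜 (koszul σ.toFun a (fun t => (k t : ℤ))) •
      compAt 𝕜 ι (middleDim ι a k) k s (β s (middleDim ι a k))
        (fun μ => α μ (middleDim ι a k μ) (fun x => k (ι.incl μ x))) := by
  classical
  funext u
  rw [compAt_apply, Pi.smul_apply, pushForward, Fintype.sum_prod_type, smul_eq_mul,
    Finset.mul_sum]
  unfold compCochain
  refine Finset.sum_congr rfl fun v _ => ?_
  rw [Finset.mul_sum]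
  refine Finset.sum_congr rfl fun w _ => ?_
  split_ifs
  · rw [mul_assoc]
  · rw [mul_zero]

/-- The composition of push-forwards is the push-forward of the composition of cells. -/
theorem compAt_pushForward (ι : Fibres σ F) {J : S.Ball → ℕ} {k : T.Ball → ℕ} {s : ℕ}
    {B : Type} [Fintype B] {X : S.Ball → Type} [∀ μ, Fintype (X μ)]
    (g : B → Seq S J s) (h : ∀ μ, X μ → Seq (F μ) (fun x => k (ι.incl μ x)) (J μ))
    (f : B → 𝕜) (f' : ∀ μ, X μ → 𝕜) :
    compAt 𝕜 ι J k s (pushForward g f) (fun μ => pushForward (h μ) (f' μ)) =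
      pushForward (fun p : B × (∀ μ, X μ) => Seq.comp ι (g p.1) (fun μ => h μ (p.2 μ)))
        (fun p => f p.1 * ∏ μ, f' μ (p.2 μ)) := by
  rw [compAt_apply, ← pushForward_comp
    (fun p : B × (∀ μ, X μ) => (g p.1, fun μ => h μ (p.2 μ)))
    (fun p : Seq S J s × (∀ μ, Seq (F μ) (fun x => k (ι.incl μ x)) (J μ)) =>
          Seq.comp ι p.1 p.2)]
  congr 1
  funext q
  rw [pushForward_tensor]

theorem pushForward_push_compAt (ι : Fibres σ F) {J : S.Ball → ℕ} {k : T.Ball → ℕ} {s s' : ℕ}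
    (ψ : Fin (s + 1) →o Fin (s' + 1)) (B : Seq S J s → 𝕜)
    (A : ∀ μ, Seq (F μ) (fun x => k (ι.incl μ x)) (J μ) → 𝕜) :
    pushForward (Seq.push ψ) (compAt 𝕜 ι J k s B A) =
      compAt 𝕜 ι J k s' (pushForward (Seq.push ψ) B) A := by
  conv_rhs => rw [← funext fun μ => pushForward_id (A μ)]
  rw [compAt_pushForward, compAt_apply, pushForward_comp]
  rfl

/-- The total orders of `comp` in terms of the decomposition along the fibres. -/
theorem Seq.comp_le (ι : Fibres σ F) {J : S.Ball → ℕ} {k : T.Ball → ℕ} {s : ℕ} (v : Seq S J s)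
    (w : ∀ μ, Seq (F μ) (fun x => k (ι.incl μ x)) (J μ)) (μ μ' : S.Ball) (x : (F μ).Ball)
    (x' : (F μ').Ball) (i : Fin (k (ι.incl μ x) + 1)) (i' : Fin (k (ι.incl μ' x') + 1)) :
    (Seq.comp ι v w).le ⟨ι.incl μ x, i⟩ ⟨ι.incl μ' x', i'⟩ ↔
      compLe v w ⟨μ, x, i⟩ ⟨μ', x', i'⟩ := by
  change compLe v w _ _ ↔ _
  rw [ι.symm_toElems, ι.symm_toElems]

theorem Seq.comp_W (ι : Fibres σ F) {J : S.Ball → ℕ} {k : T.Ball → ℕ} {s : ℕ} (v : Seq S J s)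
    (w : ∀ μ, Seq (F μ) (fun x => k (ι.incl μ x)) (J μ)) (μ : S.Ball) (x : (F μ).Ball)
    (i : Fin (k (ι.incl μ x) + 1)) :
    (Seq.comp ι v w).W ⟨ι.incl μ x, i⟩ = v.W ⟨μ, (w μ).W ⟨x, i⟩⟩ := by
  change v.W (compPos w _) = _
  rw [ι.symm_toElems]
  rfl

theorem Fibres.forall_elems (ι : Fibres σ F) {k : T.Ball → ℕ} {P : Elems T k → Prop} :
    (∀ a, P a) ↔ ∀ μ x (i : Fin (k (ι.incl μ x) + 1)), P ⟨ι.incl μ x, i⟩ := by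
  refine ⟨fun h μ x i => h _, fun h a => ?_⟩
  obtain ⟨⟨μ, x, i⟩, rfl⟩ := (ι.toElems_bijective k).2 a
  exact h μ x i

/-- Two elements of `seq(T)` agree if they agree on the elements of the fibres. -/
theorem Seq.ext_fibres (ι : Fibres σ F) {k : T.Ball → ℕ} {s : ℕ} {v w : Seq T k s}
    (hle : ∀ μ x i μ' x' i', v.le ⟨ι.incl μ x, i⟩ ⟨ι.incl μ' x', i'⟩ ↔
      w.le ⟨ι.incl μ x, i⟩ ⟨ι.incl μ' x', i'⟩)
    (hW : ∀ μ x i, v.W ⟨ι.incl μ x, i⟩ = w.W ⟨ι.incl μ x, i⟩) : v = w := by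
  refine Seq.ext ?_ ?_
  · funext a b
    refine propext ?_
    revert b
    revert a
    refine ι.forall_elems.2 fun μ x i => ι.forall_elems.2 fun μ' x' i' => hle μ x i μ' x' i'
  · funext a
    revert a
    exact ι.forall_elems.2 hW

theorem Seq.pull_le_of_ne {U : TwoDisk} {k k' : U.Ball → ℕ} {s : ℕ}
    (φ : ∀ ν, Fin (k' ν + 1) →o Fin (k ν + 1)) (w : Seq U k s) {x y : Elems U k'}
    (h : x.1 ≠ y.1) : (w.pull φ).le x y ↔ w.le (Seq.elemsMap φ x) (Seq.elemsMap φ y) := by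
  have ne : Seq.elemsMap φ x ≠ Seq.elemsMap φ y := fun e =>
    h (congrArg (fun p : Elems U k => p.1) e)
  constructor
  · rintro (⟨h1, -⟩ | ⟨h1, -⟩)
    · exact h1
    · exact absurd h1 ne
  · exact fun h1 => Or.inl ⟨h1, ne⟩

/-- The composition is dinatural in the ordinals `J_μ`. -/
theorem Seq.comp_pull_left (ι : Fibres σ F) {J J' : S.Ball → ℕ} {k : T.Ball → ℕ} {s : ℕ}
    (φ : ∀ μ, Fin (J μ + 1) →o Fin (J' μ + 1)) (v : Seq S J' s)
    (w : ∀ μ, Seq (F μ) (fun x => k (ι.incl μ x)) (J μ)) :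
    Seq.comp ι (v.pull φ) w = Seq.comp ι v (fun μ => (w μ).push (φ μ)) := by
  refine Seq.ext_fibres ι ?_ ?_
  · intro μ x i μ' x' i'
    rw [Seq.comp_le, Seq.comp_le]
    by_cases h : μ = μ'
    · subst h
      rw [compLe_same, compLe_same]
      rfl
    · rw [compLe_diff _ _ _ _ h, compLe_diff _ _ _ _ h]
      exact Seq.pull_le_of_ne φ v h
  · intro μ x i
    rw [Seq.comp_W, Seq.comp_W]
    rfl

/-- The composition is natural in the ordinals `I_ν`. -/
theorem Seq.comp_pull (ι : Fibres σ F) {J : S.Ball → ℕ} {k k' : T.Ball → ℕ} {s : ℕ}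
    (φ : ∀ t, Fin (k' t + 1) →o Fin (k t + 1)) (v : Seq S J s)
    (w : ∀ μ, Seq (F μ) (fun x => k (ι.incl μ x)) (J μ)) :
    (Seq.comp ι v w).pull φ =
      Seq.comp ι v (fun μ => (w μ).pull (fun x => φ (ι.incl μ x))) := by
  refine Seq.ext_fibres ι ?_ ?_
  · intro μ x i μ' x' i'
    rw [Seq.comp_le]
    by_cases h : μ = μ'
    · subst h
      rw [compLe_same]
      have h1 : (Seq.elemsMap φ ⟨ι.incl μ x, i⟩ = Seq.elemsMap φ ⟨ι.incl μ x', i'⟩) ↔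
          ((Seq.elemsMap (fun x => φ (ι.incl μ x)) ⟨x, i⟩ :
            Elems (F μ) (fun x => k (ι.incl μ x))) =
            Seq.elemsMap (fun x => φ (ι.incl μ x)) ⟨x', i'⟩) := by
        constructor
        · intro e
          have := (ι.toElems_bijective k).1 (a₁ := ⟨μ, x, φ _ i⟩) (a₂ := ⟨μ, x', φ _ i'⟩) e
          exact eq_of_heq (Sigma.mk.inj this).2
        · intro e
          exact congrArg (fun z => ι.toElems k ⟨μ, z⟩) e
      change ((Seq.comp ι v w).le (Seq.elemsMap φ ⟨ι.incl μ x, i⟩)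
        (Seq.elemsMap φ ⟨ι.incl μ x', i'⟩) ∧ _ ≠ _) ∨ (_ = _ ∧ _) ↔ _
      rw [Ne, h1]
      have h2 := Seq.comp_le ι v w μ μ x x' (φ _ i) (φ _ i')
      rw [compLe_same] at h2
      exact or_congr (and_congr h2 Iff.rfl) Iff.rfl
    · rw [compLe_diff _ _ _ _ h, Seq.pull_le_of_ne]
      · have h2 := Seq.comp_le ι v w μ μ' x x' (φ _ i) (φ _ i')
        rw [compLe_diff _ _ _ _ h] at h2
        exact h2
      · intro e
        apply h
        rw [← ι.map_incl μ x, ← ι.map_incl μ' x']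
        exact congrArg σ.toFun e
  · intro μ x i
    rw [Seq.comp_W]
    exact Seq.comp_W ι v w μ x (φ _ i)

theorem compAt_pushForward_pull (ι : Fibres σ F) {J J' : S.Ball → ℕ} {k : T.Ball → ℕ} {s : ℕ}
    (φ : ∀ μ, Fin (J μ + 1) →o Fin (J' μ + 1)) (B : Seq S J' s → 𝕜)
    (A : ∀ μ, Seq (F μ) (fun x => k (ι.incl μ x)) (J μ) → 𝕜) :
    compAt 𝕜 ι J k s (pushForward (Seq.pull φ) B) A =
      compAt 𝕜 ι J' k s B (fun μ => pushForward (Seq.push (φ μ)) (A μ)) := by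
  conv_lhs => rw [← funext fun μ => pushForward_id (A μ)]
  conv_rhs => rw [← pushForward_id B]
  rw [compAt_pushForward, compAt_pushForward]
  congr 1
  funext p
  exact Seq.comp_pull_left ι φ p.1 p.2

theorem pushForward_pull_compAt (ι : Fibres σ F) {J : S.Ball → ℕ} {k k' : T.Ball → ℕ} {s : ℕ}
    (φ : ∀ t, Fin (k' t + 1) →o Fin (k t + 1)) (B : Seq S J s → 𝕜)
    (A : ∀ μ, Seq (F μ) (fun x => k (ι.incl μ x)) (J μ) → 𝕜) :
    pushForward (Seq.pull φ) (compAt 𝕜 ι J k s B A) =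
      compAt 𝕜 ι J k' s B (fun μ => pushForward (Seq.pull fun x => φ (ι.incl μ x)) (A μ)) := by
  conv_rhs => rw [← pushForward_id B]
  rw [compAt_pushForward, compAt_apply, pushForward_comp]
  congr 1
  funext p
  exact Seq.comp_pull ι φ p.1 p.2

end CompAt

/-! ### Signs -/

section Signs

variable {𝕜 : Type u} [Field 𝕜]

theorem sgn_add (m n : ℤ) : sgn 𝕜 (m + n) = sgn 𝕜 m * sgn 𝕜 n := by
  simp [sgn, Int.negOnePow_add]

theorem sgn_zero : sgn 𝕜 0 = 1 := by
  simp [sgn]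

theorem sgn_congr {m n : ℤ} (h : Even (m - n)) : sgn 𝕜 m = sgn 𝕜 n := by
  unfold sgn
  rw [(Int.negOnePow_eq_iff m n).2 h]

theorem koszulBefore_eq_sgn {U : TwoDisk} (k : U.Ball → ℕ) (ν : U.Ball) :
    koszulBefore (𝕜 := 𝕜) k ν = sgn 𝕜 (∑ ν', if U.Before ν' ν then (k ν' : ℤ) else 0) := by
  unfold koszulBefore sgn
  have : (∑ ν', if U.Before ν' ν then (k ν' : ℤ) else 0) =
      ((∑ ν', if U.Before ν' ν then k ν' else 0 : ℕ) : ℤ) := by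
    push_cast
    rfl
  rw [this, Int.negOnePow_def, zpow_natCast]
  simp

variable {T S : TwoDisk} {σ : T.Hom S} {F : S.Ball → TwoDisk}

theorem natCast_raise {U : TwoDisk} (k : U.Ball → ℕ) (ν x : U.Ball) :
    ((raise k ν x : ℕ) : ℤ) = k x + if x = ν then 1 else 0 := by
  by_cases e : x = ν
  · subst e
    simp [raise_self]
  · simp [raise_of_ne k e, e]

/-- The change of the Koszul sign exponent when a degree on the target is raised. -/
theorem koszul_bump (f : T.Ball → S.Ball) (b : S.Ball → ℤ) (a : T.Ball → ℤ) (μ : S.Ball) :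
    koszul f (bump b μ) a = koszul f b a + ∑ t, if S.Before (f t) μ then a t else 0 := by
  have h : ∀ μ' t, (if S.Before (f t) μ' then bump b μ μ' * a t else 0) =
      (if S.Before (f t) μ' then b μ' * a t else 0) +
        if μ' = μ then (if S.Before (f t) μ then a t else 0) else 0 := by
    intro μ' t
    by_cases e : μ' = μ
    · subst e
      simp only [bump, Function.update_self, if_true]
      split_ifs
      · ring
      · ring
    · simp [bump, e]
  unfold koszul
  simp_rw [h, Finset.sum_add_distrib]
  rw [Finset.sum_comm (f := fun μ' t => if μ' = μ then (if S.Before (f t) μ then a t else 0) else 0)]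
  simp_rw [Finset.sum_ite_eq' univ μ, if_pos (mem_univ μ)]
  ring

/-- The change of the Koszul sign exponent when a dimension on the source is raised. -/
theorem koszul_raise (f : T.Ball → S.Ball) (b : S.Ball → ℤ) (k : T.Ball → ℕ) (t₀ : T.Ball) :
    koszul f b (fun t => (raise k t₀ t : ℤ)) = koszul f b (fun t => (k t : ℤ)) +
      (∑ μ, if S.Before (f t₀) μ then b μ else 0) +
      (∑ t, if T.Before t₀ t ∧ S.Before (f t) (f t₀) then (k t : ℤ) else 0) +
      ∑ t, if T.Before t t₀ ∧ S.Before (f t₀) (f t) then (k t : ℤ) else 0 := by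
  have h1 : ∀ μ t, (if S.Before (f t) μ then b μ * (raise k t₀ t : ℤ) else 0) =
      (if S.Before (f t) μ then b μ * (k t : ℤ) else 0) +
        if t = t₀ then (if S.Before (f t₀) μ then b μ else 0) else 0 := by
    intro μ t
    rw [natCast_raise]
    by_cases e : t = t₀
    · subst e
      simp only [if_true]
      split_ifs
      · ring
      · ring
    · simp [e]
  have h2 : ∀ t t', (if T.Before t t' ∧ S.Before (f t') (f t) then
        (raise k t₀ t : ℤ) * (raise k t₀ t' : ℤ) else 0) =
      (if T.Before t t' ∧ S.Before (f t') (f t) then (k t : ℤ) * (k t' : ℤ) else 0) +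
        (if t = t₀ then
          (if T.Before t₀ t' ∧ S.Before (f t') (f t₀) then (k t' : ℤ) else 0) else 0) +
        if t' = t₀ then
          (if T.Before t t₀ ∧ S.Before (f t₀) (f t) then (k t : ℤ) else 0) else 0 := by
    intro t t'
    rw [natCast_raise, natCast_raise]
    by_cases e : t = t₀
    · subst e
      by_cases e' : t' = t
      · subst e'
        simp [not_before_self]
      · simp only [e', if_true, if_false]
        split_ifs
        · ring
        · ring
    · by_cases e' : t' = t₀
      · subst e'
        simp only [e, if_true, if_false]
        split_ifs
        · ring
        · ring
      · simp [e, e']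
  unfold koszul
  simp_rw [h1, h2, Finset.sum_add_distrib, Finset.sum_ite_eq' univ t₀, if_pos (mem_univ t₀)]
  rw [Finset.sum_comm (f := fun t t' => if t = t₀ then
    (if T.Before t₀ t' ∧ S.Before (f t') (f t₀) then (k t' : ℤ) else 0) else 0)]
  simp_rw [Finset.sum_ite_eq' univ t₀, if_pos (mem_univ t₀)]
  ring

theorem Fibres.before_iff (ι : Fibres σ F) (μ : S.Ball) (x y : (F μ).Ball) :
    (F μ).Before x y ↔ T.Before (ι.incl μ x) (ι.incl μ y) :=
  or_congr (ι.col_lt_iff μ x y).symm (ι.lt_in_col_iff μ x y).symm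

/-- A sum over a fibre, as a sum over the source of the map. -/
theorem Fibres.sum_fibre (ι : Fibres σ F) {M : Type*} [AddCommMonoid M] (μ : S.Ball)
    (g : T.Ball → M) : ∑ x, g (ι.incl μ x) = ∑ t, if σ.toFun t = μ then g t else 0 := by
  rw [← ι.sum_incl]
  simp_rw [ι.map_incl]
  rw [Finset.sum_eq_single μ]
  · simp
  · intro μ' _ h
    simp [h]
  · exact fun h => absurd (mem_univ μ) h

theorem before_cases {U : TwoDisk} (x y : U.Ball) : (x = y ∧ ¬ U.Before x y ∧ ¬ U.Before y x) ∨
    (x ≠ y ∧ U.Before x y ∧ ¬ U.Before y x) ∨ (x ≠ y ∧ ¬ U.Before x y ∧ U.Before y x) := by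
  by_cases h : x = y
  · subst h
    exact Or.inl ⟨rfl, not_before_self x, not_before_self x⟩
  · exact Or.inr ((before_trichotomy h).imp (And.intro h) (And.intro h))

/-- The sign rule for the faces of a composition. -/
theorem sgn_face_comp (ι : Fibres σ F) (b : ℤ) (a : S.Ball → ℤ) (k : T.Ball → ℕ) (μ : S.Ball)
    (x : (F μ).Ball) :
    sgn 𝕜 (b + ∑ μ, a μ) * koszulBefore k (ι.incl μ x) *
        sgn 𝕜 (koszul σ.toFun a (fun t => (raise k (ι.incl μ x) t : ℤ))) =
      sgn 𝕜 (b + ∑ μ', if S.Before μ' μ then a μ' else 0) * sgn 𝕜 (a μ) *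
        sgn 𝕜 (koszul σ.toFun (bump a μ) (fun t => (k t : ℤ))) *
        koszulBefore (fun x => k (ι.incl μ x)) x := by
  rw [koszulBefore_eq_sgn, koszulBefore_eq_sgn, ← sgn_add, ← sgn_add, ← sgn_add, ← sgn_add,
    ← sgn_add]
  refine sgn_congr ?_
  rw [koszul_raise, koszul_bump, ι.map_incl]
  simp_rw [ι.before_iff]
  rw [ι.sum_fibre μ fun t => if T.Before t (ι.incl μ x) then (k t : ℤ) else 0]
  -- sort the leaves of `S` by their position relative to `μ`, and those of `T` also by their
  -- position relative to the leaf in question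
  have h1 : ∑ μ', a μ' = (∑ μ', if S.Before μ' μ then a μ' else 0) +
      (∑ μ', if S.Before μ μ' then a μ' else 0) + a μ := by
    rw [← Finset.sum_ite_eq' univ μ a |>.trans (if_pos (mem_univ μ)), ← Finset.sum_add_distrib,
      ← Finset.sum_add_distrib]
    refine Finset.sum_congr rfl fun μ' _ => ?_
    rcases before_cases μ' μ with ⟨e, h1, h2⟩ | ⟨e, h1, h2⟩ | ⟨e, h1, h2⟩ <;> simp [e, h1, h2]
    simp [not_before_self]
  have h2 : (∑ t, if T.Before t (ι.incl μ x) then (k t : ℤ) else 0) =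
      (∑ t, if σ.toFun t = μ then (if T.Before t (ι.incl μ x) then (k t : ℤ) else 0) else 0) +
      (∑ t, if T.Before t (ι.incl μ x) ∧ S.Before (σ.toFun t) μ then (k t : ℤ) else 0) +
      ∑ t, if T.Before t (ι.incl μ x) ∧ S.Before μ (σ.toFun t) then (k t : ℤ) else 0 := by
    rw [← Finset.sum_add_distrib, ← Finset.sum_add_distrib]
    refine Finset.sum_congr rfl fun t _ => ?_
    rcases before_cases (σ.toFun t) μ with ⟨e, h1, h2⟩ | ⟨e, h1, h2⟩ | ⟨e, h1, h2⟩ <;>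
      simp [e, h1, h2]
    simp [not_before_self]
  have h3 : (∑ t, if S.Before (σ.toFun t) μ then (k t : ℤ) else 0) =
      (∑ t, if T.Before t (ι.incl μ x) ∧ S.Before (σ.toFun t) μ then (k t : ℤ) else 0) +
      ∑ t, if T.Before (ι.incl μ x) t ∧ S.Before (σ.toFun t) μ then (k t : ℤ) else 0 := by
    rw [← Finset.sum_add_distrib]
    refine Finset.sum_congr rfl fun t _ => ?_
    by_cases hs : S.Before (σ.toFun t) μ
    · have ht : t ≠ ι.incl μ x := by
        rintro rfl
        rw [ι.map_incl] at hs
        exact not_before_self _ hs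
      rcases before_trichotomy ht with ⟨h1, h2⟩ | ⟨h1, h2⟩ <;> simp [hs, h1, h2]
    · simp [hs]
  refine ⟨(∑ μ', if S.Before μ μ' then a μ' else 0) +
    ∑ t, if T.Before t (ι.incl μ x) ∧ S.Before μ (σ.toFun t) then (k t : ℤ) else 0, ?_⟩
  linear_combination h1 + h2 - h3

/-- The sign rule for moving a face in the ordinal `J_μ` to the coface of the inner cochain. -/
theorem sgn_coface_comp (ι : Fibres σ F) (b : ℤ) (a : S.Ball → ℤ) (k : T.Ball → ℕ)
    (J : S.Ball → ℕ) (hJ : ∀ μ, (J μ : ℤ) = a μ + ∑ x, (k (ι.incl μ x) : ℤ)) (μ : S.Ball) :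
    sgn 𝕜 b * sgn 𝕜 (koszul σ.toFun a (fun t => (k t : ℤ))) * koszulBefore J μ =
      sgn 𝕜 (b + ∑ μ', if S.Before μ' μ then a μ' else 0) *
        sgn 𝕜 (koszul σ.toFun (bump a μ) (fun t => (k t : ℤ))) := by
  rw [koszulBefore_eq_sgn, ← sgn_add, ← sgn_add, ← sgn_add, koszul_bump]
  congr 1
  have h1 : (∑ t, if S.Before (σ.toFun t) μ then (k t : ℤ) else 0) =
      ∑ μ', if S.Before μ' μ then ∑ x, (k (ι.incl μ' x) : ℤ) else 0 := by
    rw [← ι.sum_incl]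
    simp_rw [ι.map_incl]
    refine Finset.sum_congr rfl fun μ' _ => ?_
    split_ifs <;> simp
  have h2 : (∑ μ', if S.Before μ' μ then (J μ' : ℤ) else 0) =
      (∑ μ', if S.Before μ' μ then a μ' else 0) +
      ∑ μ', if S.Before μ' μ then ∑ x, (k (ι.incl μ' x) : ℤ) else 0 := by
    rw [← Finset.sum_add_distrib]
    refine Finset.sum_congr rfl fun μ' _ => ?_
    rw [hJ]
    split_ifs <;> simp
  rw [h1, h2]
  ring

end Signs

/-! ### The compositions of the condensation are maps of complexes -/

section DComp

variable {𝕜 : Type u} [Field 𝕜]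

theorem Seq.pull_le_of_injective {U : TwoDisk} {k k' : U.Ball → ℕ} {s : ℕ}
    (φ : ∀ ν, Fin (k' ν + 1) →o Fin (k ν + 1)) (hφ : ∀ ν, Function.Injective (φ ν))
    (w : Seq U k s) (x y : Elems U k') :
    (w.pull φ).le x y ↔ w.le (Seq.elemsMap φ x) (Seq.elemsMap φ y) := by
  by_cases h : x.1 = y.1
  · obtain ⟨ν, i⟩ := x
    obtain ⟨ν', j⟩ := y
    obtain rfl : ν = ν' := h
    constructor
    · rintro (⟨h1, -⟩ | ⟨h1, -⟩)
      · exact h1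
      · rw [h1]
        exact w.le_refl _
    · intro h1
      by_cases e : Seq.elemsMap φ ⟨ν, i⟩ = Seq.elemsMap φ ⟨ν, j⟩
      · have e' : φ ν i = φ ν j := by simpa [Seq.elemsMap] using e
        rw [hφ ν e']
        exact Or.inr ⟨rfl, le_rfl⟩
      · exact Or.inl ⟨h1, e⟩
  · exact Seq.pull_le_of_ne φ w h

theorem cofaceAt_val {U : TwoDisk} (k : U.Ball → ℕ) (ν : U.Ball) (j : ℕ) (ν' : U.Ball)
    (i : Fin (k ν' + 1)) :
    (cofaceAt k ν j ν' i).val = if ν' = ν then skip j i else i := rfl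

theorem cofaceAt_apply_injective {U : TwoDisk} (k : U.Ball → ℕ) (ν : U.Ball) (j : ℕ)
    (ν' : U.Ball) : Function.Injective (cofaceAt k ν j ν') := by
  intro a b e
  have e := congrArg Fin.val e
  rw [cofaceAt_val, cofaceAt_val] at e
  split_ifs at e
  · exact Fin.ext (skip_inj j e)
  · exact Fin.ext e

/-- Pulling back along maps that preserve the values of the elements is a change of names. -/
theorem pushForward_pull_eq {U : TwoDisk} {k k' : U.Ball → ℕ} {s : ℕ} (hk : k' = k)
    (φ : ∀ ν, Fin (k ν + 1) →o Fin (k' ν + 1)) (hφ : ∀ ν i, (φ ν i).val = i.val)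
    (f : Column 𝕜 U s) : pushForward (Seq.pull φ) (f k') = f k := by
  have h : pushForward (fun w : Seq U k s => w) (f k) = f k := pushForward_id (f k)
  rw [← h]
  refine pushForward_eq_of_elems hk f _ _ (Seq.elemsMap φ) id (fun v x y => ?_)
    (fun _ _ => rfl) (fun _ _ _ => Iff.rfl) (fun _ _ => rfl) (fun x => ⟨rfl, hφ _ _⟩)
  refine Seq.pull_le_of_injective φ (fun ν a b e => Fin.ext ?_) v x y
  rw [← hφ, e, hφ]

/-- Pushing forward along a map that preserves the values is a change of names. -/
theorem pushForward_push_eq {U : TwoDisk} {k : U.Ball → ℕ} {s s' : ℕ} (hs : s' = s)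
    (ψ : Fin (s + 1) →o Fin (s' + 1)) (hψ : ∀ i, (ψ i).val = i.val) (f : Cochains 𝕜 U) :
    pushForward (Seq.push ψ) (f s k) = f s' k := by
  subst hs
  exact pushForward_eq_self _ _ fun w _ => Seq.ext rfl (funext fun x => Fin.ext (hψ _))

/-- The sum of the cofaces, with the target ordinal given up to an equation of dimensions. -/
theorem cofaceSum_eq_of_eq_succ {U : TwoDisk} {k : U.Ball → ℕ} {s s' : ℕ} (hs : s' = s + 1)
    (ψ : ℕ → Fin (s + 1) →o Fin (s' + 1)) (hψ : ∀ j i, (ψ j i).val = skip j i.val)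
    (f : Cochains 𝕜 U) :
    cofaceSum f s' k = ∑ j ∈ range (s + 2), (-1 : 𝕜) ^ j • pushForward (Seq.push (ψ j)) (f s k) := by
  subst hs
  funext w
  rw [Finset.sum_apply]
  refine Finset.sum_congr rfl fun j _ => ?_
  have : ψ j = coface s j := OrderHom.ext _ _ (funext fun i => Fin.ext (hψ j i))
  rw [this]
  rfl

variable {T S : TwoDisk} {σ : T.Hom S} {F : S.Ball → TwoDisk}

theorem raise_incl_of_ne (ι : Fibres σ F) (k : T.Ball → ℕ) {μ μ' : S.Ball} (h : μ' ≠ μ)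
    (x : (F μ).Ball) :
    (fun x' => raise k (ι.incl μ x) (ι.incl μ' x')) = fun x' => k (ι.incl μ' x') := by
  funext x'
  refine raise_of_ne k fun e => h ?_
  rw [← ι.map_incl μ' x', e, ι.map_incl]

theorem raise_incl_self (ι : Fibres σ F) (k : T.Ball → ℕ) (μ : S.Ball) (x : (F μ).Ball) :
    (fun x' => raise k (ι.incl μ x) (ι.incl μ x')) = raise (fun x' => k (ι.incl μ x')) x := by
  funext x'
  by_cases e : x' = x
  · subst e
    rw [raise_self, raise_self]
  · rw [raise_of_ne _ e, raise_of_ne]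
    exact fun e' => e (ι.incl_injective μ e')

/-- The intermediate dimensions depend on the degrees and the dimensions through their sums over
the fibres only. -/
theorem middleDim_raise (ι : Fibres σ F) (a : S.Ball → ℤ) (k : T.Ball → ℕ) (μ : S.Ball)
    (x : (F μ).Ball) :
    middleDim ι a (raise k (ι.incl μ x)) = middleDim ι (bump a μ) k := by
  funext μ'
  unfold middleDim
  congr 1
  by_cases h : μ' = μ
  · subst h
    have h1 := congrFun (raise_incl_self ι k μ' x)
    simp_rw [h1, natCast_raise, Finset.sum_add_distrib, Finset.sum_ite_eq' univ x,
      if_pos (mem_univ x)]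
    simp only [bump, Function.update_self]
    ring
  · have h1 := congrFun (raise_incl_of_ne ι k h x)
    simp_rw [h1]
    simp [bump, h]

/-- The face of a composition in a direction of the fibre over `μ`. -/
theorem pushForward_face_compAt (ι : Fibres σ F) (J : S.Ball → ℕ) (k : T.Ball → ℕ) (s : ℕ)
    (B : Seq S J s → 𝕜) (α : ∀ μ, Column 𝕜 (F μ) (J μ)) (μ : S.Ball) (x : (F μ).Ball) (j : ℕ) :
    pushForward (Seq.face (ι.incl μ x) j) (compAt 𝕜 ι J (raise k (ι.incl μ x)) s B
        (fun μ' => α μ' (fun x' => raise k (ι.incl μ x) (ι.incl μ' x')))) =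
      compAt 𝕜 ι J k s B (Function.update (fun μ' => α μ' (fun x' => k (ι.incl μ' x'))) μ
        (pushForward (Seq.face x j) (α μ (raise (fun x' => k (ι.incl μ x')) x)))) := by
  refine (pushForward_pull_compAt ι (cofaceAt k (ι.incl μ x) j) B _).trans ?_
  congr 1
  funext μ'
  by_cases h : μ' = μ
  · subst h
    rw [Function.update_self]
    refine pushForward_eq_of_elems (raise_incl_self ι k μ' x) (α μ') _ _ _
      (Seq.elemsMap (cofaceAt _ x j)) (Seq.pull_le_of_injective _ fun ν =>
        cofaceAt_apply_injective k (ι.incl μ' x) j (ι.incl μ' ν)) (fun _ _ => rfl)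
      (face_le x j) (fun _ _ => rfl) (fun y => ⟨rfl, ?_⟩)
    rw [elemsMap_cofaceAt_snd]
    change (if ι.incl μ' y.1 = ι.incl μ' x then _ else _) = _
    simp only [(ι.incl_injective μ').eq_iff]
  · rw [Function.update_of_ne h]
    refine pushForward_pull_eq (raise_incl_of_ne ι k h x) _ (fun ν i => ?_) (α μ')
    rw [cofaceAt_val, if_neg]
    intro e
    apply h
    rw [← ι.map_incl μ' ν, e, ι.map_incl]

theorem faceSum_eq_sum {U : TwoDisk} {s : ℕ} (f : Column 𝕜 U s) (k : U.Ball → ℕ) :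
    faceSum f k = ∑ ν, koszulBefore (𝕜 := 𝕜) k ν •
      ∑ j ∈ range (k ν + 2), (-1 : 𝕜) ^ j • pushForward (Seq.face ν j) (f (raise k ν)) := by
  funext w
  simp [faceSum, Finset.sum_apply]

/-- The cofaces of a composition are those of the outer cochain. -/
theorem compCochain_cofaceSum_left (ι : Fibres σ F) (a : S.Ball → ℤ) (β : Cochains 𝕜 S)
    (α : ∀ μ, Cochains 𝕜 (F μ)) (s : ℕ) (k : T.Ball → ℕ) :
    cofaceSum (compCochain 𝕜 ι a β α) s k = compCochain 𝕜 ι a (cofaceSum β) α s k := by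
  rw [compCochain_eq_compAt]
  match s with
  | 0 =>
    rw [show cofaceSum β 0 (middleDim ι a k) = 0 from rfl, map_zero]
    simp only [_root_.zero_apply, smul_zero]
    rfl
  | s + 1 =>
    rw [cofaceSum_eq_of_eq_succ rfl (coface s) (fun _ _ => rfl),
      cofaceSum_eq_of_eq_succ rfl (coface s) (fun _ _ => rfl), map_sum,
      _root_.sum_apply, Finset.smul_sum]
    refine Finset.sum_congr rfl fun j _ => ?_
    rw [compCochain_eq_compAt, pushForward_smul, pushForward_push_compAt, map_smul,
      _root_.smul_apply, smul_comm]

theorem compCochain_update (ι : Fibres σ F) (a : S.Ball → ℤ) (β : Cochains 𝕜 S)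
    (α : ∀ μ, Cochains 𝕜 (F μ)) (μ : S.Ball) (f : Cochains 𝕜 (F μ)) (s : ℕ) (k : T.Ball → ℕ) :
    compCochain 𝕜 ι a β (Function.update α μ f) s k =
      sgn 𝕜 (koszul σ.toFun a (fun t => (k t : ℤ))) •
      compAt 𝕜 ι (middleDim ι a k) k s (β s (middleDim ι a k))
        (Function.update (fun μ' => α μ' (middleDim ι a k μ') (fun x => k (ι.incl μ' x))) μ
          (f (middleDim ι a k μ) (fun x => k (ι.incl μ x)))) := by
  rw [compCochain_eq_compAt]
  congr 2
  funext μ'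
  exact Function.apply_update (fun μ' (g : Cochains 𝕜 (F μ')) =>
    g (middleDim ι a k μ') (fun x => k (ι.incl μ' x))) α μ f μ'

/-- The faces of a composition come from the faces of the inner cochains. -/
theorem faceSum_compCochain (ι : Fibres σ F) (b : ℤ) (a : S.Ball → ℤ) (β : Cochains 𝕜 S)
    (α : ∀ μ, Cochains 𝕜 (F μ)) (s : ℕ) (k : T.Ball → ℕ) :
    sgn 𝕜 (b + ∑ μ, a μ) • faceSum (compCochain 𝕜 ι a β α s) k =
      ∑ μ, (sgn 𝕜 (b + ∑ μ', if S.Before μ' μ then a μ' else 0) * sgn 𝕜 (a μ)) •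
        compCochain 𝕜 ι (bump a μ) β
          (Function.update α μ fun s => faceSum (α μ s)) s k := by
  rw [faceSum_eq_sum, ← ι.sum_incl, Finset.smul_sum]
  refine Finset.sum_congr rfl fun μ _ => ?_
  rw [compCochain_update, faceSum_eq_sum, MultilinearMap.map_update_sum, Finset.smul_sum,
    Finset.smul_sum, Finset.smul_sum]
  refine Finset.sum_congr rfl fun x _ => ?_
  rw [MultilinearMap.map_update_smul, MultilinearMap.map_update_sum, Finset.smul_sum,
    Finset.smul_sum, Finset.smul_sum, Finset.smul_sum, Finset.smul_sum]
  refine Finset.sum_congr rfl fun j _ => ?_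
  rw [MultilinearMap.map_update_smul, compCochain_eq_compAt, pushForward_smul,
    middleDim_raise ι a k μ x]
  rw [pushForward_face_compAt ι (middleDim ι (bump a μ) k) k s
    (β s (middleDim ι (bump a μ) k)) (fun μ' => α μ' (middleDim ι (bump a μ) k μ')) μ x j]
  simp only [smul_smul]
  congr 1
  linear_combination (-1) ^ j * sgn_face_comp (𝕜 := 𝕜) ι b a k μ x

/-- The coface of an inner cochain compensates the faces of the outer one. -/
theorem compCochain_faceSum_left (ι : Fibres σ F) (b : ℤ) (a : S.Ball → ℤ) (β : Cochains 𝕜 S)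
    (α : ∀ μ, condensationX 𝕜 (F μ) (a μ)) (s : ℕ) (k : T.Ball → ℕ) :
    sgn 𝕜 b • compCochain 𝕜 ι a (fun s => faceSum (β s)) (fun μ => (α μ).1) s k =
      ∑ μ, sgn 𝕜 (b + ∑ μ', if S.Before μ' μ then a μ' else 0) •
        compCochain 𝕜 ι (bump a μ) β
          (Function.update (fun μ => (α μ).1) μ (cofaceSum (α μ).1)) s k := by
  rw [compCochain_eq_compAt]
  simp_rw [compCochain_update]
  set J := middleDim ι a k with hJdef
  by_cases hneg : ∀ μ, 0 ≤ a μ + ∑ x, (k (ι.incl μ x) : ℤ)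
  · -- no truncation occurs in the intermediate dimensions
    have hJ : ∀ μ, (J μ : ℤ) = a μ + ∑ x, (k (ι.incl μ x) : ℤ) := fun μ =>
      Int.toNat_of_nonneg (hneg μ)
    have hJ' : ∀ μ, middleDim ι (bump a μ) k = raise J μ := by
      intro μ
      funext μ'
      zify
      rw [natCast_raise, hJ]
      unfold middleDim bump
      by_cases h : μ' = μ
      · subst h
        rw [Function.update_self, Int.toNat_of_nonneg, if_pos rfl]
        · ring
        · linarith [hneg μ']
      · rw [Function.update_of_ne h, if_neg h, add_zero, Int.toNat_of_nonneg (hneg μ')]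
    rw [faceSum_eq_sum, map_sum, _root_.sum_apply, Finset.smul_sum, Finset.smul_sum]
    refine Finset.sum_congr rfl fun μ _ => ?_
    rw [hJ' μ, cofaceSum_eq_of_eq_succ (raise_self J μ) (fun j => cofaceAt J μ j μ)
      (fun j i => by rw [cofaceAt_val, if_pos rfl]), MultilinearMap.map_update_sum, map_smul,
      _root_.smul_apply, map_sum, _root_.sum_apply, Finset.smul_sum,
      Finset.smul_sum, Finset.smul_sum, Finset.smul_sum, Finset.smul_sum]
    refine Finset.sum_congr rfl fun j _ => ?_
    rw [MultilinearMap.map_update_smul, map_smul, _root_.smul_apply]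
    have h1 : compAt 𝕜 ι J k s (pushForward (Seq.face μ j) (β s (raise J μ)))
        (fun μ' => (α μ').1 (J μ') (fun x => k (ι.incl μ' x))) =
      compAt 𝕜 ι (raise J μ) k s (β s (raise J μ))
        (Function.update (fun μ' => (α μ').1 (raise J μ μ') (fun x => k (ι.incl μ' x))) μ
          (pushForward (Seq.push (cofaceAt J μ j μ))
            ((α μ).1 (J μ) (fun x => k (ι.incl μ x))))) := by
      refine (compAt_pushForward_pull ι (cofaceAt J μ j) _ _).trans ?_
      congr 1
      funext μ'
      by_cases h : μ' = μ
      · subst h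
        rw [Function.update_self]
      · rw [Function.update_of_ne h]
        refine pushForward_push_eq (raise_of_ne J h) _ (fun i => ?_) (α μ').1
        rw [cofaceAt_val, if_neg h]
    rw [h1]
    simp only [smul_smul]
    congr 1
    linear_combination (-1) ^ j * sgn_coface_comp (𝕜 := 𝕜) ι b a k J hJ μ
  · push Not at hneg
    obtain ⟨μ₀, h₀⟩ := hneg
    -- there are no cells of the required degree in the component of `μ₀`
    have hzero : ∀ s, (α μ₀).1 s (fun x => k (ι.incl μ₀ x)) = 0 := by
      intro s
      funext w
      by_contra hne
      have : (s : ℤ) - ∑ x, (k (ι.incl μ₀ x) : ℤ) = a μ₀ := (α μ₀).2 _ _ _ hne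
      omega
    rw [MultilinearMap.map_coord_zero _ μ₀ (hzero _), smul_zero, smul_zero]
    refine (Finset.sum_eq_zero fun μ _ => ?_).symm
    rw [MultilinearMap.map_coord_zero _ μ₀, smul_zero, smul_zero]
    by_cases h : μ₀ = μ
    · subst h
      rw [Function.update_self]
      have h1 : middleDim ι (bump a μ₀) k μ₀ = 0 := by
        unfold middleDim bump
        rw [Function.update_self]
        omega
      rw [h1]
      rfl
    · rw [Function.update_of_ne h]
      exact hzero _

end DComp

section DCompCondensation

variable {𝕜 : Type u} [Field 𝕜]

theorem condensationComplex_d {U : TwoDisk} {n m : ℤ} (h : n + 1 = m) (f : condensationX 𝕜 U n) :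
    ((condensationComplex 𝕜 U).d n m).hom f = condensationD 𝕜 U n m h f := by
  have : (condensationComplex 𝕜 U).d n m = ModuleCat.ofHom (condensationD 𝕜 U n m h) := dif_pos h
  rw [this]
  rfl

theorem condensationComplex_XIsoOfEq {U : TwoDisk} {n m : ℤ} (h : n = m)
    (f : condensationX 𝕜 U n) :
    ((((condensationComplex 𝕜 U).XIsoOfEq h).hom.hom f : condensationX 𝕜 U m)).1 = f.1 := by
  subst h
  rfl

variable {T S : TwoDisk} {σ : T.Hom S} {F : S.Ball → TwoDisk}

/-- The underlying cochains of `diffAt`. -/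
theorem diffAt_condensation (a : S.Ball → ℤ) (μ : S.Ball)
    (α : ∀ μ, condensationX 𝕜 (F μ) (a μ)) :
    (fun μ' => ((diffAt (fun μ => condensationComplex 𝕜 (F μ)) a μ α μ' :
      condensationX 𝕜 (F μ') (bump a μ μ'))).1) =
      Function.update (fun μ' => (α μ').1) μ
        (cofaceSum (α μ).1 - sgn 𝕜 (a μ) • fun s => faceSum ((α μ).1 s)) := by
  funext μ'
  unfold diffAt
  by_cases h : μ' = μ
  · subst h
    rw [dif_pos rfl, Function.update_self,
      condensationComplex_d (show a μ' + 1 = bump a μ' μ' by simp [bump])]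
    rfl
  · rw [dif_neg h, Function.update_of_ne h]
    exact condensationComplex_XIsoOfEq _ _

theorem compCochain_update_sub_smul (ι : Fibres σ F) (a : S.Ball → ℤ) (β : Cochains 𝕜 S)
    (α : ∀ μ, Cochains 𝕜 (F μ)) (μ : S.Ball) (f g : Cochains 𝕜 (F μ)) (c : 𝕜) (s : ℕ)
    (k : T.Ball → ℕ) :
    compCochain 𝕜 ι a β (Function.update α μ (f - c • g)) s k =
      compCochain 𝕜 ι a β (Function.update α μ f) s k -
        c • compCochain 𝕜 ι a β (Function.update α μ g) s k := by
  rw [compCochain_update, compCochain_update, compCochain_update, smul_comm c, ← smul_sub]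
  congr 1
  exact (MultilinearMap.map_update_sub _ _ _ _ _).trans
    (congrArg _ (MultilinearMap.map_update_smul _ _ _ _ _))

/-- The compositions of the condensation are maps of complexes: the faces of the outer cochain,
which occur in its differential but not in that of the composition, cancel against the cofaces of
the inner cochains. -/
theorem condensationData_d_comp (ι : Fibres σ F) (b : ℤ) (a : S.Ball → ℤ) (n : ℤ)
    (h : b + ∑ μ, a μ = n) (β : condensationX 𝕜 S b) (α : ∀ μ, condensationX 𝕜 (F μ) (a μ)) :
    condensationD 𝕜 T n (n + 1) rfl (condensationComp 𝕜 ι b a n h β α) =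
      condensationComp 𝕜 ι (b + 1) a (n + 1) (by rw [← h]; ring)
        (condensationD 𝕜 S b (b + 1) rfl β) α +
      ∑ μ, sgn 𝕜 (b + ∑ μ', if S.Before μ' μ then a μ' else 0) •
        condensationComp 𝕜 ι b (bump a μ) (n + 1) (by rw [sum_bump, ← h]; ring) β
          (diffAt (fun μ => condensationComplex 𝕜 (F μ)) a μ α) := by
  refine Subtype.ext ?_
  rw [Submodule.coe_add, Submodule.coe_sum]
  funext s k
  rw [Pi.add_apply, Pi.add_apply, Finset.sum_apply, Finset.sum_apply]
  change cofaceSum (compCochain 𝕜 ι a β.1 (fun μ => (α μ).1)) s k -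
      sgn 𝕜 n • faceSum (compCochain 𝕜 ι a β.1 (fun μ => (α μ).1) s) k =
    compCochain 𝕜 ι a (cofaceSum β.1 - sgn 𝕜 b • fun s => faceSum (β.1 s)) (fun μ => (α μ).1) s k
      + ∑ μ, sgn 𝕜 (b + ∑ μ', if S.Before μ' μ then a μ' else 0) •
        compCochain 𝕜 ι (bump a μ) β.1 (fun μ' =>
          ((diffAt (fun μ => condensationComplex 𝕜 (F μ)) a μ α μ' :
            condensationX 𝕜 (F μ') (bump a μ μ'))).1) s k
  simp_rw [diffAt_condensation, compCochain_update_sub_smul, smul_sub, Finset.sum_sub_distrib,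
    smul_smul]
  rw [← compCochain_faceSum_left, ← faceSum_compCochain, compCochain_cofaceSum_left, h,
    sub_eq_add_neg (cofaceSum β.1), ← neg_smul, compCochain_add_left, compCochain_smul_left,
    Pi.add_apply, Pi.add_apply, Pi.smul_apply, Pi.smul_apply, neg_smul]
  abel

end DCompCondensation

/-! ### Associativity of the compositions of the condensation -/

section AssocSign

variable {𝕜 : Type u} [Field 𝕜]

theorem sgn_sum {I : Type} (t : Finset I) (g : I → ℤ) :
    sgn 𝕜 (∑ i ∈ t, g i) = ∏ i ∈ t, sgn 𝕜 (g i) := by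
  classical
  induction t using Finset.induction_on with
  | empty => simp [sgn_zero]
  | insert i t hi ih => rw [Finset.sum_insert hi, Finset.prod_insert hi, sgn_add, ih]

/-- A weighted sum of the sums over the fibres, as a sum over the source of the map. -/
theorem Fibres.sum_mul_sum {T S : TwoDisk} {σ : T.Hom S} {F : S.Ball → TwoDisk} (ι : Fibres σ F)
    (g : S.Ball → ℤ) (k : T.Ball → ℤ) :
    ∑ s, g s * ∑ x, k (ι.incl s x) = ∑ t, g (σ.toFun t) * k t := by
  rw [← ι.sum_incl]
  refine Finset.sum_congr rfl fun s _ => ?_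
  rw [Finset.mul_sum]
  simp_rw [ι.map_incl]

/-- A sum over ordered pairs, as a sum over the pairs in the planar order. -/
theorem sum_sum_eq_sum_before {U : TwoDisk} (f : U.Ball → U.Ball → ℤ) (hf : ∀ x, f x x = 0) :
    ∑ x, ∑ y, f x y = ∑ x, ∑ y, if U.Before x y then f x y + f y x else 0 := by
  have h1 : ∀ x y, f x y = (if U.Before x y then f x y else 0) +
      if U.Before y x then f x y else 0 := by
    intro x y
    rcases before_cases x y with ⟨e, h1, h2⟩ | ⟨e, h1, h2⟩ | ⟨e, h1, h2⟩
    · simp [e, hf, not_before_self]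
    · simp [h1, h2]
    · simp [h1, h2]
  have h2 : ∀ x y, (if U.Before x y then f x y + f y x else 0) =
      (if U.Before x y then f x y else 0) + if U.Before x y then f y x else 0 := by
    intro x y
    split_ifs <;> simp
  simp_rw [h2, Finset.sum_add_distrib]
  rw [Finset.sum_comm (f := fun x y => if U.Before x y then f y x else 0), ← Finset.sum_add_distrib]
  simp_rw [← Finset.sum_add_distrib]
  exact Finset.sum_congr rfl fun x _ => Finset.sum_congr rfl fun y _ => h1 x y

/-- The sign rule for an iterated composition: the two ways to rearrange the factors differ by
an even number of transpositions of odd elements. -/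
theorem even_koszul_assoc {T S Q : TwoDisk} {σ : T.Hom S} {ρ : S.Hom Q} {τ : T.Hom Q}
    {F : S.Ball → TwoDisk} {G H : Q.Ball → TwoDisk}
    (ι : Fibres σ F) (κ : Fibres ρ G) (l : Fibres τ H) {θ : ∀ q, (H q).Hom (G q)}
    (hτ : ∀ t, τ.toFun t = ρ.toFun (σ.toFun t))
    (hθ : ∀ q x, κ.incl q ((θ q).toFun x) = σ.toFun (l.incl q x))
    (b : Q.Ball → ℤ) (a : S.Ball → ℤ) (k : T.Ball → ℤ) :
    Even ((koszul σ.toFun a k + koszul ρ.toFun b (fun s => a s + ∑ x, k (ι.incl s x))) -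
      (koszul ρ.toFun b a + (koszul τ.toFun (fun q => b q + ∑ y, a (κ.incl q y)) k +
        ∑ q, koszul (θ q).toFun (fun y => a (κ.incl q y)) (fun x => k (l.incl q x))))) := by
  -- the pairs of factors whose order is reversed, for each of the maps
  have e1 : koszul ρ.toFun b (fun s => a s + ∑ x, k (ι.incl s x)) = koszul ρ.toFun b a +
      (∑ q, ∑ t, if Q.Before (τ.toFun t) q then b q * k t else 0) +
      (∑ s, ∑ t, if S.Before s (σ.toFun t) ∧ Q.Before (τ.toFun t) (ρ.toFun s)
        then a s * k t else 0) +
      (∑ s, ∑ t, if S.Before (σ.toFun t) s ∧ Q.Before (ρ.toFun s) (τ.toFun t)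
        then a s * k t else 0) +
      ∑ t, ∑ t', if S.Before (σ.toFun t) (σ.toFun t') ∧ Q.Before (τ.toFun t') (τ.toFun t)
        then k t * k t' else 0 := by
    have h1 : (∑ q, ∑ s, if Q.Before (ρ.toFun s) q then b q * ∑ x, k (ι.incl s x) else 0) =
        ∑ q, ∑ t, if Q.Before (τ.toFun t) q then b q * k t else 0 := by
      refine Finset.sum_congr rfl fun q _ => ?_
      simp_rw [hτ, ← ite_zero_mul]
      exact ι.sum_mul_sum (fun s => if Q.Before (ρ.toFun s) q then b q else 0) k
    have h2 : (∑ s, ∑ s', if S.Before s s' ∧ Q.Before (ρ.toFun s') (ρ.toFun s) then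
        a s * ∑ x, k (ι.incl s' x) else 0) =
        ∑ s, ∑ t, if S.Before s (σ.toFun t) ∧ Q.Before (τ.toFun t) (ρ.toFun s)
          then a s * k t else 0 := by
      refine Finset.sum_congr rfl fun s _ => ?_
      simp_rw [hτ, ← ite_zero_mul]
      exact ι.sum_mul_sum
        (fun s' => if S.Before s s' ∧ Q.Before (ρ.toFun s') (ρ.toFun s) then a s else 0) k
    have h3 : (∑ s', ∑ s, if S.Before s s' ∧ Q.Before (ρ.toFun s') (ρ.toFun s) then
        a s' * ∑ x, k (ι.incl s x) else 0) =
        ∑ s, ∑ t, if S.Before (σ.toFun t) s ∧ Q.Before (ρ.toFun s) (τ.toFun t)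
          then a s * k t else 0 := by
      refine Finset.sum_congr rfl fun s' _ => ?_
      simp_rw [hτ, ← ite_zero_mul]
      exact ι.sum_mul_sum
        (fun s => if S.Before s s' ∧ Q.Before (ρ.toFun s') (ρ.toFun s) then a s' else 0) k
    have h4 : (∑ s, ∑ s', if S.Before s s' ∧ Q.Before (ρ.toFun s') (ρ.toFun s) then
        (∑ x, k (ι.incl s x)) * ∑ x, k (ι.incl s' x) else 0) =
        ∑ t, ∑ t', if S.Before (σ.toFun t) (σ.toFun t') ∧ Q.Before (τ.toFun t') (τ.toFun t)
          then k t * k t' else 0 := by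
      have : ∀ s, (∑ s', if S.Before s s' ∧ Q.Before (ρ.toFun s') (ρ.toFun s) then
          (∑ x, k (ι.incl s x)) * ∑ x, k (ι.incl s' x) else 0) =
          (∑ t', if S.Before s (σ.toFun t') ∧ Q.Before (τ.toFun t') (ρ.toFun s) then k t' else 0) *
            ∑ x, k (ι.incl s x) := by
        intro s
        have h5 := ι.sum_mul_sum
          (fun s' => if S.Before s s' ∧ Q.Before (ρ.toFun s') (ρ.toFun s) then
            (1 : ℤ) else 0) k
        simp_rw [hτ]
        simp_rw [ite_mul, one_mul, zero_mul] at h5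
        rw [← h5, Finset.sum_mul]
        refine Finset.sum_congr rfl fun s' _ => ?_
        split_ifs
        · ring
        · ring
      simp_rw [this]
      rw [ι.sum_mul_sum]
      refine Finset.sum_congr rfl fun t _ => ?_
      rw [Finset.sum_mul]
      refine Finset.sum_congr rfl fun t' _ => ?_
      rw [hτ t]
      split_ifs
      · ring
      · ring
    rw [← h1, ← h2, ← h3, ← h4, Finset.sum_comm (f := fun s' s =>
      if S.Before s s' ∧ Q.Before (ρ.toFun s') (ρ.toFun s) then
        a s' * ∑ x, k (ι.incl s x) else 0)]
    have h6 : ∀ q s, (if Q.Before (ρ.toFun s) q then b q * (a s + ∑ x, k (ι.incl s x)) else 0) =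
        (if Q.Before (ρ.toFun s) q then b q * a s else 0) +
          if Q.Before (ρ.toFun s) q then b q * ∑ x, k (ι.incl s x) else 0 := by
      intro q s
      split_ifs
      · ring
      · ring
    have h7 : ∀ s s', (if S.Before s s' ∧ Q.Before (ρ.toFun s') (ρ.toFun s) then
        (a s + ∑ x, k (ι.incl s x)) * (a s' + ∑ x, k (ι.incl s' x)) else 0) =
        (if S.Before s s' ∧ Q.Before (ρ.toFun s') (ρ.toFun s) then a s * a s' else 0) +
        (if S.Before s s' ∧ Q.Before (ρ.toFun s') (ρ.toFun s) then
          a s * ∑ x, k (ι.incl s' x) else 0) +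
        (if S.Before s s' ∧ Q.Before (ρ.toFun s') (ρ.toFun s) then
          a s' * ∑ x, k (ι.incl s x) else 0) +
        if S.Before s s' ∧ Q.Before (ρ.toFun s') (ρ.toFun s) then
          (∑ x, k (ι.incl s x)) * ∑ x, k (ι.incl s' x) else 0 := by
      intro s s'
      split_ifs
      · ring
      · ring
    unfold koszul
    simp_rw [h6, h7, Finset.sum_add_distrib]
    ring
  have e2 : koszul τ.toFun (fun q => b q + ∑ y, a (κ.incl q y)) k =
      (∑ q, ∑ t, if Q.Before (τ.toFun t) q then b q * k t else 0) +
      (∑ s, ∑ t, if Q.Before (τ.toFun t) (ρ.toFun s) then a s * k t else 0) +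
      ∑ t, ∑ t', if T.Before t t' ∧ Q.Before (τ.toFun t') (τ.toFun t) then k t * k t' else 0 := by
    have h1 : (∑ q, ∑ t, if Q.Before (τ.toFun t) q then (∑ y, a (κ.incl q y)) * k t else 0) =
        ∑ s, ∑ t, if Q.Before (τ.toFun t) (ρ.toFun s) then a s * k t else 0 := by
      rw [Finset.sum_comm, Finset.sum_comm (γ := S.Ball)]
      refine Finset.sum_congr rfl fun t _ => ?_
      have := κ.sum_mul_sum (fun q => if Q.Before (τ.toFun t) q then k t else 0) a
      simp_rw [ite_zero_mul, mul_comm (k t)] at this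
      exact this
    rw [← h1]
    have h2 : ∀ q t, (if Q.Before (τ.toFun t) q then (b q + ∑ y, a (κ.incl q y)) * k t else 0) =
        (if Q.Before (τ.toFun t) q then b q * k t else 0) +
          if Q.Before (τ.toFun t) q then (∑ y, a (κ.incl q y)) * k t else 0 := by
      intro q t
      split_ifs
      · ring
      · ring
    unfold koszul
    simp_rw [h2, Finset.sum_add_distrib]
  have e3 : ∑ q, koszul (θ q).toFun (fun y => a (κ.incl q y)) (fun x => k (l.incl q x)) =
      (∑ s, ∑ t, if τ.toFun t = ρ.toFun s then
        (if S.Before (σ.toFun t) s then a s * k t else 0) else 0) +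
      ∑ t, ∑ t', if τ.toFun t' = τ.toFun t then
        (if T.Before t t' ∧ S.Before (σ.toFun t') (σ.toFun t) then k t * k t' else 0) else 0 := by
    rw [← κ.sum_incl, ← l.sum_incl (fun t => ∑ t', if τ.toFun t' = τ.toFun t then
        (if T.Before t t' ∧ S.Before (σ.toFun t') (σ.toFun t) then k t * k t' else 0) else 0),
      ← Finset.sum_add_distrib]
    refine Finset.sum_congr rfl fun q _ => ?_
    unfold koszul
    congr 1
    · refine Finset.sum_congr rfl fun y _ => ?_
      simp_rw [κ.before_iff, hθ, κ.map_incl]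
      exact l.sum_fibre q fun t =>
        if S.Before (σ.toFun t) (κ.incl q y) then a (κ.incl q y) * k t else 0
    · refine Finset.sum_congr rfl fun x _ => ?_
      simp_rw [κ.before_iff, hθ, l.before_iff, l.map_incl]
      exact l.sum_fibre q fun t => if T.Before (l.incl q x) t ∧
        S.Before (σ.toFun t) (σ.toFun (l.incl q x)) then k (l.incl q x) * k t else 0
  have e4 : koszul σ.toFun a k = (∑ s, ∑ t, if S.Before (σ.toFun t) s then a s * k t else 0) +
    ∑ t, ∑ t', if T.Before t t' ∧ S.Before (σ.toFun t') (σ.toFun t) then k t * k t' else 0 := rfl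
  -- compare the signs for a factor of degree `a s` and a factor of degree `k t`
  have e5 : (∑ s, ∑ t, if S.Before (σ.toFun t) s then a s * k t else 0) +
      (∑ s, ∑ t, if S.Before s (σ.toFun t) ∧ Q.Before (τ.toFun t) (ρ.toFun s)
        then a s * k t else 0) =
      (∑ s, ∑ t, if Q.Before (τ.toFun t) (ρ.toFun s) then a s * k t else 0) +
      (∑ s, ∑ t, if τ.toFun t = ρ.toFun s then
        (if S.Before (σ.toFun t) s then a s * k t else 0) else 0) +
      (∑ s, ∑ t, if S.Before (σ.toFun t) s ∧ Q.Before (ρ.toFun s) (τ.toFun t)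
        then a s * k t else 0) := by
    simp_rw [← Finset.sum_add_distrib]
    refine Finset.sum_congr rfl fun s _ => Finset.sum_congr rfl fun t _ => ?_
    rw [hτ]
    rcases before_cases (σ.toFun t) s with ⟨e, h1, h2⟩ | ⟨e, h1, h2⟩ | ⟨e, h1, h2⟩
    · simp [e, not_before_self]
    all_goals
      rcases before_cases (ρ.toFun (σ.toFun t)) (ρ.toFun s) with
        ⟨e', h3, h4⟩ | ⟨e', h3, h4⟩ | ⟨e', h3, h4⟩
      all_goals simp [h1, h2, h3, h4, e', not_before_self]
  -- compare the signs for two factors of degrees `k t` and `k t'`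
  have e6 : (∑ t, ∑ t', if T.Before t t' ∧ S.Before (σ.toFun t') (σ.toFun t)
        then k t * k t' else 0) +
      (∑ t, ∑ t', if S.Before (σ.toFun t) (σ.toFun t') ∧ Q.Before (τ.toFun t') (τ.toFun t)
        then k t * k t' else 0) =
      (∑ t, ∑ t', if T.Before t t' ∧ Q.Before (τ.toFun t') (τ.toFun t) then k t * k t' else 0) +
      (∑ t, ∑ t', if τ.toFun t' = τ.toFun t then
        (if T.Before t t' ∧ S.Before (σ.toFun t') (σ.toFun t) then k t * k t' else 0) else 0) +
      2 * ∑ t, ∑ t', if T.Before t t' ∧ S.Before (σ.toFun t') (σ.toFun t) ∧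
        Q.Before (τ.toFun t) (τ.toFun t') then k t * k t' else 0 := by
    rw [sum_sum_eq_sum_before (fun t t' => if S.Before (σ.toFun t) (σ.toFun t') ∧
      Q.Before (τ.toFun t') (τ.toFun t) then k t * k t' else 0)
      (fun t => by simp [not_before_self]), two_mul]
    simp_rw [← Finset.sum_add_distrib]
    refine Finset.sum_congr rfl fun t _ => Finset.sum_congr rfl fun t' _ => ?_
    rw [hτ, hτ]
    simp only [eq_comm (a := ρ.toFun (σ.toFun t'))]
    by_cases ht : T.Before t t'
    · rcases before_cases (σ.toFun t) (σ.toFun t') with ⟨e, h1, h2⟩ | ⟨e, h1, h2⟩ | ⟨e, h1, h2⟩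
      · simp [e, not_before_self]
      all_goals
        rcases before_cases (ρ.toFun (σ.toFun t)) (ρ.toFun (σ.toFun t')) with
          ⟨e', h3, h4⟩ | ⟨e', h3, h4⟩ | ⟨e', h3, h4⟩
        all_goals simp [ht, h1, h2, h3, h4, e', not_before_self, mul_comm (k t')]
    · simp [ht]
  rw [e1, e2, e3, e4]
  refine ⟨(∑ s, ∑ t, if S.Before (σ.toFun t) s ∧ Q.Before (ρ.toFun s) (τ.toFun t)
    then a s * k t else 0) + ∑ t, ∑ t', if T.Before t t' ∧ S.Before (σ.toFun t') (σ.toFun t) ∧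
        Q.Before (τ.toFun t) (τ.toFun t') then k t * k t' else 0, ?_⟩
  linear_combination e5 + e6

end AssocSign

section Assoc

variable {𝕜 : Type u} [Field 𝕜]

theorem pushForward_of_bijective {A A' B : Type} [Fintype A] [Fintype A'] {E : A → A'}
    (hE : Function.Bijective E) (g : A' → B) (f : A' → 𝕜) :
    pushForward (fun x => g (E x)) (fun x => f (E x)) = pushForward g f := by
  classical
  funext b
  exact hE.sum_comp fun x => if g x = b then f x else 0

theorem elems_ext {U : TwoDisk} {k : U.Ball → ℕ} {x y : Elems U k} (h : x.1 = y.1)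
    (h' : x.2.val = y.2.val) : x = y := by
  obtain ⟨ν, i⟩ := x
  obtain ⟨ν', j⟩ := y
  obtain rfl : ν = ν' := h
  obtain rfl : i = j := Fin.ext h'
  rfl

/-- The map of ordinals of equal dimension that preserves the values. -/
def finCast {m n : ℕ} (h : m = n) : Fin (m + 1) →o Fin (n + 1) where
  toFun := Fin.cast (congrArg (· + 1) h)
  monotone' := fun _ _ h => h

theorem finCast_injective {m n : ℕ} (h : m = n) : Function.Injective (finCast h) :=
  fun a b e => Fin.ext (show (finCast h a).val = (finCast h b).val from congrArg Fin.val e)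

/-- The intermediate dimensions may be replaced by equal ones. This form of the congruence avoids
rewriting under dependent types. -/
theorem compAt_congr_left {T S : TwoDisk} {σ : T.Hom S} {F : S.Ball → TwoDisk}
    (ι : Fibres σ F) {J J' : S.Ball → ℕ} (h : J = J') (k : T.Ball → ℕ) (s : ℕ)
    (β : Column 𝕜 S s) (α : ∀ μ, Cochains 𝕜 (F μ)) :
    compAt 𝕜 ι J k s (β J) (fun μ => α μ (J μ) (fun x => k (ι.incl μ x))) =
      compAt 𝕜 ι J' k s (β J') (fun μ => α μ (J' μ) (fun x => k (ι.incl μ x))) := by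
  rw [h]

variable {T S Q : TwoDisk} {σ : T.Hom S} {ρ : S.Hom Q} {τ : T.Hom Q}
    {F : S.Ball → TwoDisk} {G H : Q.Ball → TwoDisk}
    (ι : Fibres σ F) (κ : Fibres ρ G) (l : Fibres τ H)
    {θ : ∀ q, (H q).Hom (G q)} (m : ∀ q, Fibres (θ q) (fun y => F (κ.incl q y)))

variable {ι κ l m} in
/-- The identification of the ordinals of an iterated fibre. -/
def fibreCast (hm : ∀ q y z, l.incl q ((m q).incl y z) = ι.incl (κ.incl q y) z) (k : T.Ball → ℕ)
    (q : Q.Ball) (y : (G q).Ball) (z : (F (κ.incl q y)).Ball) :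
    Fin (k (l.incl q ((m q).incl y z)) + 1) →o Fin (k (ι.incl (κ.incl q y) z) + 1) :=
  finCast (congrArg k (hm q y z))

/-- The composition of `seq` is associative. -/
theorem Seq.comp_assoc (hm : ∀ q y z, l.incl q ((m q).incl y z) = ι.incl (κ.incl q y) z)
    {L : Q.Ball → ℕ} {J : S.Ball → ℕ} {k : T.Ball → ℕ} {s : ℕ}
    (v : Seq Q L s) (w : ∀ q, Seq (G q) (fun y => J (κ.incl q y)) (L q))
    (z : ∀ μ, Seq (F μ) (fun x => k (ι.incl μ x)) (J μ)) :
    Seq.comp ι (Seq.comp κ v w) z = Seq.comp l v (fun q => Seq.comp (m q) (w q)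
      (fun y => (z (κ.incl q y)).pull (fibreCast hm k q y))) := by
  have he : ∀ q y x (i : Fin (k (l.incl q ((m q).incl y x)) + 1)),
      (⟨l.incl q ((m q).incl y x), i⟩ : Elems T k) =
        ⟨ι.incl (κ.incl q y) x, fibreCast hm k q y x i⟩ := fun q y x i => elems_ext (hm q y x) rfl
  refine Seq.ext_fibres l ?_ ?_
  · intro q x i q' x' i'
    obtain ⟨y, x, rfl⟩ := (m q).exists_eq x
    obtain ⟨y', x', rfl⟩ := (m q').exists_eq x'
    rw [Seq.comp_le l]
    rw [he, he, Seq.comp_le ι]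
    by_cases hq : q = q'
    · subst hq
      rw [compLe_same, Seq.comp_le (m q)]
      by_cases hy : y = y'
      · subst hy
        rw [compLe_same, compLe_same]
        exact (Seq.pull_le_of_injective (fibreCast hm k q y)
          (fun _ => finCast_injective _) (z (κ.incl q y)) ⟨x, i⟩ ⟨x', i'⟩).symm
      · rw [compLe_diff _ _ _ _ fun e => hy (κ.incl_injective q e), compLe_diff _ _ _ _ hy]
        refine (Seq.comp_le κ v w _ _ _ _ _ _).trans ?_
        rw [compLe_same]
        rfl
    · have hne : κ.incl q y ≠ κ.incl q' y' := fun e => hq (by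
        rw [← κ.map_incl q y, e, κ.map_incl])
      rw [compLe_diff _ _ _ _ hne, compLe_diff _ _ _ _ hq]
      refine (Seq.comp_le κ v w _ _ _ _ _ _).trans ?_
      rw [compLe_diff _ _ _ _ hq]
      unfold compPos
      rw [Seq.comp_W (m q), Seq.comp_W (m q')]
      rfl
  · intro q x i
    obtain ⟨y, x, rfl⟩ := (m q).exists_eq x
    rw [Seq.comp_W l, Seq.comp_W (m q), he, Seq.comp_W ι, Seq.comp_W κ]
    rfl

/-- A choice of cells for the iterated fibres is a choice of cells for the fibres. -/
theorem Fibres.regroup_bijective (A : Type) (B : Q.Ball → Type) (X : S.Ball → Type) :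
    Function.Bijective (fun P : (A × ∀ q, B q) × (∀ s, X s) =>
      ((P.1.1, fun q => (P.1.2 q, fun y => P.2 (κ.incl q y))) :
        A × ∀ q, B q × ∀ y : (G q).Ball, X (κ.incl q y))) := by
  constructor
  · rintro ⟨⟨x, y⟩, z⟩ ⟨⟨x', y'⟩, z'⟩ h
    obtain ⟨h1, h2⟩ := Prod.mk.inj h
    have h3 := fun q => Prod.mk.inj (congrFun h2 q)
    refine Prod.ext (Prod.ext h1 (funext fun q => (h3 q).1)) (funext fun s => ?_)
    obtain ⟨q, y, rfl⟩ := κ.exists_eq s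
    exact congrFun (h3 q).2 y
  · rintro ⟨x, y⟩
    refine ⟨((x, fun q => (y q).1), Equiv.piCongrLeft X (Equiv.ofBijective _ κ.incl_bijective)
      (fun p => (y p.1).2 p.2)), Prod.ext rfl (funext fun q => Prod.ext rfl (funext fun r => ?_))⟩
    exact Equiv.piCongrLeft_apply_apply X (Equiv.ofBijective _ κ.incl_bijective)
      (fun p => (y p.1).2 p.2) ⟨q, r⟩

/-- The linear extension of the composition of `seq` is associative. The names of the elements of
an iterated fibre differ by `fibreCast`. -/
theorem compAt_assoc (hm : ∀ q y z, l.incl q ((m q).incl y z) = ι.incl (κ.incl q y) z)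
    (L : Q.Ball → ℕ) (J : S.Ball → ℕ) (k : T.Ball → ℕ) (s : ℕ)
    (C : Seq Q L s → 𝕜) (B : ∀ q, Seq (G q) (fun y => J (κ.incl q y)) (L q) → 𝕜)
    (A : ∀ μ, Seq (F μ) (fun x => k (ι.incl μ x)) (J μ) → 𝕜) :
    compAt 𝕜 ι J k s (compAt 𝕜 κ L J s C B) A = compAt 𝕜 l L k s C
      (fun q => compAt 𝕜 (m q) (fun y => J (κ.incl q y)) (fun x => k (l.incl q x)) (L q) (B q)
        (fun y => pushForward (Seq.pull (fibreCast hm k q y)) (A (κ.incl q y)))) := by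
  have h1 := compAt_pushForward (𝕜 := 𝕜) ι (J := J) (k := k)
    (fun p : Seq Q L s × (∀ q, Seq (G q) (fun y => J (κ.incl q y)) (L q)) => Seq.comp κ p.1 p.2)
    (fun μ (w : Seq (F μ) (fun x => k (ι.incl μ x)) (J μ)) => w)
    (fun p => C p.1 * ∏ q, B q (p.2 q)) A
  have h2 := fun q => compAt_pushForward (𝕜 := 𝕜) (m q) (J := fun y => J (κ.incl q y))
    (k := fun x => k (l.incl q x)) (fun w : Seq (G q) (fun y => J (κ.incl q y)) (L q) => w)
    (fun y => Seq.pull (fibreCast hm k q y)) (B q) (fun y => A (κ.incl q y))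
  simp_rw [pushForward_id] at h2
  have h3 := compAt_pushForward (𝕜 := 𝕜) l (J := L) (k := k) (fun w : Seq Q L s => w)
    (fun q (p : Seq (G q) (fun y => J (κ.incl q y)) (L q) ×
        ∀ y, Seq (F (κ.incl q y)) (fun x => k (ι.incl (κ.incl q y) x)) (J (κ.incl q y))) =>
      Seq.comp (m q) p.1 (fun y => (p.2 y).pull (fibreCast hm k q y))) C
    (fun q p => B q p.1 * ∏ y, A (κ.incl q y) (p.2 y))
  simp_rw [pushForward_id] at h1
  rw [pushForward_id] at h3
  simp_rw [h2]
  rw [compAt_apply κ]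
  refine h1.trans (Eq.trans ?_ h3.symm)
  rw [← pushForward_of_bijective (κ.regroup_bijective (Seq Q L s)
    (fun q => Seq (G q) (fun y => J (κ.incl q y)) (L q))
    (fun μ => Seq (F μ) (fun x => k (ι.incl μ x)) (J μ)))]
  congr 1
  · funext P
    exact Seq.comp_assoc ι κ l m hm _ _ _
  · funext P
    dsimp only
    rw [Finset.prod_mul_distrib, κ.prod_incl (fun s => A s (P.2 s)), mul_assoc]

end Assoc

section CochainAssoc

variable {𝕜 : Type u} [Field 𝕜] {T S Q : TwoDisk} {σ : T.Hom S} {ρ : S.Hom Q} {τ : T.Hom Q}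
    {F : S.Ball → TwoDisk} {G H : Q.Ball → TwoDisk}
    (ι : Fibres σ F) (κ : Fibres ρ G) (l : Fibres τ H)
    {θ : ∀ q, (H q).Hom (G q)} (m : ∀ q, Fibres (θ q) (fun y => F (κ.incl q y)))

theorem condensationX_apply_eq_zero {U : TwoDisk} {n : ℤ} (f : condensationX 𝕜 U n) (s : ℕ)
    {k : U.Ball → ℕ} (h : n + ∑ x, (k x : ℤ) < 0) : f.1 s k = 0 := by
  funext w
  by_contra hne
  have : (s : ℤ) - ∑ x, (k x : ℤ) = n := f.2 _ _ _ hne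
  omega

/-- The intermediate dimensions over an iterated fibre. -/
theorem middleDim_assoc
    (hm : ∀ q y z, l.incl q ((m q).incl y z) = ι.incl (κ.incl q y) z) (a : S.Ball → ℤ)
    (k : T.Ball → ℕ) (q : Q.Ball) :
    middleDim (m q) (fun y => a (κ.incl q y)) (fun x => k (l.incl q x)) =
      fun y => middleDim ι a k (κ.incl q y) := by
  funext y
  unfold middleDim
  simp_rw [hm]

/-- The composition of cochains is associative up to the Koszul sign of the rearrangement of the
factors. -/
theorem compCochain_assoc
    (hm : ∀ q y z, l.incl q ((m q).incl y z) = ι.incl (κ.incl q y) z)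
    (hτ : ∀ t, τ.toFun t = ρ.toFun (σ.toFun t))
    (hθ : ∀ q x, κ.incl q ((θ q).toFun x) = σ.toFun (l.incl q x))
    (b : Q.Ball → ℤ) (a : S.Ball → ℤ) (e : Q.Ball → ℤ) (he : ∀ q, b q + ∑ y, a (κ.incl q y) = e q)
    (γ : Cochains 𝕜 Q) (β : ∀ q, Cochains 𝕜 (G q)) (α : ∀ s, condensationX 𝕜 (F s) (a s)) :
    compCochain 𝕜 ι a (compCochain 𝕜 κ b γ β) (fun μ => (α μ).1) =
      sgn 𝕜 (koszul ρ.toFun b a) • compCochain 𝕜 l e γ (fun q =>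
        compCochain 𝕜 (m q) (fun y => a (κ.incl q y)) (β q) (fun y => (α (κ.incl q y)).1)) := by
  funext s k
  rw [Pi.smul_apply, Pi.smul_apply]
  by_cases hneg : ∀ μ, 0 ≤ a μ + ∑ x, (k (ι.incl μ x) : ℤ)
  · -- no truncation occurs in the intermediate dimensions
    have hJ : ∀ μ, (middleDim ι a k μ : ℤ) = a μ + ∑ x, (k (ι.incl μ x) : ℤ) := fun μ =>
      Int.toNat_of_nonneg (hneg μ)
    have hL : middleDim l e k = middleDim κ b (middleDim ι a k) := by
      funext q
      have h1 : ∑ y, ∑ x, (k (ι.incl (κ.incl q y) x) : ℤ) = ∑ x, (k (l.incl q x) : ℤ) := by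
        rw [← (m q).sum_incl fun x => (k (l.incl q x) : ℤ)]
        simp_rw [hm]
      change (e q + _).toNat = (b q + ∑ y, (middleDim ι a k (κ.incl q y) : ℤ)).toNat
      simp_rw [hJ]
      rw [← he, Finset.sum_add_distrib, h1, add_assoc]
    have hinner : ∀ q (L : ℕ), compCochain 𝕜 (m q) (fun y => a (κ.incl q y)) (β q)
          (fun y => (α (κ.incl q y)).1) L (fun x => k (l.incl q x)) =
        sgn 𝕜 (koszul (θ q).toFun (fun y => a (κ.incl q y)) (fun x => (k (l.incl q x) : ℤ))) •
          compAt 𝕜 (m q) (fun y => middleDim ι a k (κ.incl q y)) (fun x => k (l.incl q x)) L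
            (β q L (fun y => middleDim ι a k (κ.incl q y)))
            (fun y => pushForward (Seq.pull (fibreCast hm k q y))
              ((α (κ.incl q y)).1 (middleDim ι a k (κ.incl q y))
                (fun x => k (ι.incl (κ.incl q y) x)))) := by
      intro q L
      rw [compCochain_eq_compAt]
      congr 1
      refine (compAt_congr_left (m q) (middleDim_assoc ι κ l m hm a k q) _ L (β q L)
        (fun y => (α (κ.incl q y)).1)).trans ?_
      congr 1
      funext y
      exact (pushForward_pull_eq (funext fun x => congrArg k (hm q y x).symm) (fibreCast hm k q y)
        (fun _ _ => rfl) ((α (κ.incl q y)).1 (middleDim ι a k (κ.incl q y)))).symm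
    rw [compCochain_eq_compAt, compCochain_eq_compAt κ, map_smul, _root_.smul_apply,
      compAt_assoc ι κ l m hm, compCochain_eq_compAt l, hL]
    simp_rw [hinner]
    rw [MultilinearMap.map_smul_univ, ← sgn_sum]
    simp only [smul_smul, ← sgn_add]
    congr 1
    refine sgn_congr ?_
    simp_rw [hJ, ← funext he]
    exact even_koszul_assoc ι κ l hτ hθ b a (fun t => (k t : ℤ))
  · -- there are no cells of the required degree in the component of `μ`, and both sides are zero
    push Not at hneg
    obtain ⟨μ, h₀⟩ := hneg
    obtain ⟨q, y, rfl⟩ := κ.exists_eq μ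
    rw [compCochain_eq_compAt, compCochain_eq_compAt l,
      MultilinearMap.map_coord_zero _ (κ.incl q y) (condensationX_apply_eq_zero _ _ h₀),
      MultilinearMap.map_coord_zero _ q, smul_zero, smul_zero, smul_zero]
    rw [compCochain_eq_compAt, MultilinearMap.map_coord_zero _ y, smul_zero]
    refine condensationX_apply_eq_zero _ _ ?_
    simp_rw [hm]
    exact h₀

end CochainAssoc

/-! ### The unit of the condensation -/

section Units

variable {𝕜 : Type u} [Field 𝕜]

theorem Seq.le_iff_le {U : TwoDisk} {k : U.Ball → ℕ} {s : ℕ} (w : Seq U k s) (ν : U.Ball)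
    (i j : Fin (k ν + 1)) : w.le ⟨ν, i⟩ ⟨ν, j⟩ ↔ i ≤ j := by
  refine ⟨fun h => ?_, w.le_of_le ν i j⟩
  by_contra hc
  have e := w.le_antisymm _ _ h (w.le_of_le ν j i (not_le.1 hc).le)
  rw [eq_of_heq (Sigma.mk.inj e).2] at hc
  exact hc le_rfl

/-- An element of `seq` of the one-leaf disk is determined by its monotone map. -/
theorem Seq.ext_point {k : TwoDisk.point.Ball → ℕ} {s : ℕ} {v w : Seq TwoDisk.point k s}
    (h : ∀ ν i, v.W ⟨ν, i⟩ = w.W ⟨ν, i⟩) : v = w := by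
  refine Seq.ext ?_ (funext fun x => h x.1 x.2)
  funext ⟨ν, i⟩ ⟨ν', j⟩
  obtain rfl : ν = ν' := Subsingleton.elim _ _
  rw [v.le_iff_le, w.le_iff_le]

/-- The identity map `[s] ⟶ [s]`, as an element of `seq` of the one-leaf disk. -/
def identityCell {k : TwoDisk.point.Ball → ℕ} {s : ℕ} (h : ∀ ν, k ν = s) :
    Seq TwoDisk.point k s where
  le := fun x y => x.2.val ≤ y.2.val
  le_refl := fun _ => le_rfl
  le_trans := fun _ _ _ => le_trans
  le_antisymm := fun x y h h' => elems_ext (Subsingleton.elim _ _) (le_antisymm h h')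
  le_total := fun x y => Nat.le_total _ _
  le_of_le := fun _ _ _ h => h
  same_col := fun ν₁ ν₂ _ h => absurd h (by
    rw [Subsingleton.elim ν₁ ν₂]
    exact lt_irrefl _)
  diff_col := fun ν₁ ν₂ h => absurd h (by
    rw [Subsingleton.elim ν₁ ν₂]
    exact lt_irrefl _)
  W := fun x => ⟨x.2.val, by rw [← h x.1]; exact x.2.isLt⟩
  W_mono := fun _ _ h => h

theorem condensationOne_apply {k : TwoDisk.point.Ball → ℕ} {s : ℕ} (h : ∀ ν, k ν = s) :
    (condensationOne 𝕜).1 s k = pushForward (fun _ : Unit => identityCell h) (fun _ => 1) := by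
  classical
  funext w
  have h1 : identityCell h = w ↔ (∀ ν, k ν = s) ∧ ∀ x, (w.W x).val = x.2.val := by
    constructor
    · rintro rfl
      exact ⟨h, fun _ => rfl⟩
    · exact fun h' => Seq.ext_point fun ν i => Fin.ext (h'.2 ⟨ν, i⟩).symm
  simp only [pushForward, univ_unique, sum_const, card_singleton, one_smul, h1]
  simp only [condensationOne]

theorem condensationOne_apply_eq_zero {k : TwoDisk.point.Ball → ℕ} {s : ℕ} (h : ¬ ∀ ν, k ν = s) :
    (condensationOne 𝕜).1 s k = 0 := by
  funext w
  exact if_neg fun h' => h h'.1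

theorem koszulBefore_point (k : TwoDisk.point.Ball → ℕ) (ν : TwoDisk.point.Ball) :
    koszulBefore (𝕜 := 𝕜) k ν = 1 := by
  have : ∀ ν', ¬ TwoDisk.point.Before ν' ν := fun ν' => by
    rw [Subsingleton.elim ν' ν]
    exact not_before_self ν
  simp [koszulBefore, this]

/-- The unit is a cocycle: the faces and the cofaces of the identity maps cancel. -/
theorem condensationD_one : condensationD 𝕜 TwoDisk.point 0 1 rfl (condensationOne 𝕜) = 0 := by
  refine Subtype.ext (funext fun s => funext fun k => funext fun w => ?_)
  by_contra hne
  -- the degree forces `s = k + 1`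
  have hdeg := (condensationD 𝕜 TwoDisk.point 0 1 rfl (condensationOne 𝕜)).2 s k w hne
  obtain ⟨n, rfl⟩ : ∃ n, k = fun _ => n :=
    ⟨k default, funext fun ν => congrArg k (Subsingleton.elim _ _)⟩
  obtain rfl : s = n + 1 := by
    simp [cellDeg] at hdeg
    omega
  apply hne
  have h1 : ∀ ν, raise (fun _ : TwoDisk.point.Ball => n) default ν = n + 1 := fun ν => by
    rw [Subsingleton.elim ν default, raise_self]
  have h2 : ∀ j, Seq.push (coface n j) (identityCell (k := fun _ => n) fun _ => rfl) =
      (identityCell h1).face default j := fun j => by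
    refine Seq.ext_point fun ν i => Fin.ext ?_
    change skip j i = (cofaceAt (fun _ => n) default j ν i).val
    rw [cofaceAt_val, if_pos (Subsingleton.elim _ _)]
  change (cofaceSum (condensationOne 𝕜).1 (n + 1) (fun _ => n) -
    sgn 𝕜 0 • faceSum ((condensationOne 𝕜).1 (n + 1)) (fun _ => n)) w = 0
  rw [cofaceSum_eq_of_eq_succ rfl (coface n) (fun _ _ => rfl), faceSum_eq_sum,
    Fintype.sum_unique, koszulBefore_point, one_smul, sgn_zero, one_smul,
    condensationOne_apply h1, condensationOne_apply fun _ => rfl]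
  simp_rw [pushForward_comp, h2]
  rw [sub_self]
  rfl

/-- The unit law for the identity map. -/
theorem compCochain_one {T : TwoDisk} {σ : T.Hom T} (ι : Fibres σ (fun _ => TwoDisk.point))
    (hσ : ∀ t, σ.toFun t = t) (β : Cochains 𝕜 T) :
    compCochain 𝕜 ι (fun _ => 0) β (fun _ => (condensationOne 𝕜).1) = β := by
  have hι : ∀ μ x, ι.incl μ x = μ := fun μ x => (hσ _).symm.trans (ι.map_incl μ x)
  funext s k
  have hJ : middleDim ι (fun _ => 0) k = k := by
    funext μ
    unfold middleDim
    simp_rw [hι]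
    rw [zero_add, Fintype.sum_unique]
    exact Int.toNat_natCast _
  have hk : koszul σ.toFun (fun _ => 0) (fun t => (k t : ℤ)) = 0 := by
    unfold koszul
    simp_rw [hσ]
    have : ∀ t t', ¬ (T.Before t t' ∧ T.Before t' t) := fun t t' => by
      rcases before_cases t t' with ⟨-, h, -⟩ | ⟨-, -, h⟩ | ⟨-, h, -⟩ <;> simp [h]
    simp [this]
  have h0 : ∀ μ, ∀ x, k (ι.incl μ x) = k μ := fun μ x => congrArg k (hι μ x)
  rw [compCochain_eq_compAt, hk, sgn_zero, one_smul]
  refine (compAt_congr_left ι hJ k s (β s) (fun _ => (condensationOne 𝕜).1)).trans ?_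
  simp_rw [condensationOne_apply (h0 _)]
  have h1 := compAt_pushForward (𝕜 := 𝕜) ι (fun v : Seq T k s => v)
    (fun μ (_ : Unit) => identityCell (h0 μ)) (β s k) (fun _ _ => 1)
  rw [pushForward_id] at h1
  have h2 : Function.Bijective (Prod.fst : Seq T k s × (T.Ball → Unit) → Seq T k s) :=
    ⟨fun p q h => Prod.ext h (Subsingleton.elim _ _), fun v => ⟨(v, fun _ => ()), rfl⟩⟩
  have h3 := pushForward_of_bijective h2 (fun v => v) (β s k)
  rw [pushForward_id] at h3
  refine h1.trans (Eq.trans ?_ h3)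
  congr 1
  · funext p
    refine Seq.ext_fibres ι ?_ ?_
    · intro μ x i μ' x' i'
      rw [Seq.comp_le]
      by_cases h : μ = μ'
      · subst h
        obtain rfl : x = x' := Subsingleton.elim _ _
        rw [compLe_same, Seq.le_iff_le, Seq.le_iff_le]
      · rw [compLe_diff _ _ _ _ h]
        have h4 : ∀ μ x (i : Fin (k (ι.incl μ x) + 1)), compPos (fun μ => identityCell (h0 μ))
            ⟨μ, x, i⟩ = (⟨ι.incl μ x, i⟩ : Elems T k) := fun μ x i => elems_ext (hι μ x).symm rfl
        rw [h4, h4]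
    · intro μ x i
      rw [Seq.comp_W]
      congr 1
      exact elems_ext (hι μ x).symm rfl
  · funext p
    rw [Finset.prod_const_one, mul_one]

/-- The unit law for the map to the one-leaf disk. -/
theorem one_compCochain {T : TwoDisk} {σ : T.Hom TwoDisk.point} (ι : Fibres σ (fun _ => T))
    (hι : ∀ μ t, ι.incl μ t = t) {a : ℤ} (α : condensationX 𝕜 T a) :
    compCochain 𝕜 ι (fun _ => a) (condensationOne 𝕜).1 (fun _ => α.1) = α.1 := by
  funext s k
  have hk : koszul σ.toFun (fun _ => a) (fun t => (k t : ℤ)) = 0 := by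
    have : ∀ ν ν' : TwoDisk.point.Ball, ¬ TwoDisk.point.Before ν ν' := fun ν ν' => by
      rw [Subsingleton.elim ν' ν]
      exact not_before_self ν
    simp [koszul, this]
  rw [compCochain_eq_compAt, hk, sgn_zero, one_smul]
  by_cases hs : ∀ ν, middleDim ι (fun _ => a) k ν = s
  · refine (compAt_congr_left ι (funext hs) k s ((condensationOne 𝕜).1 s) (fun _ => α.1)).trans ?_
    have h0 : ∀ μ : TwoDisk.point.Ball, α.1 s (fun x => k (ι.incl μ x)) = pushForward
        (Seq.pull fun x => finCast (congrArg k (hι μ x))) (α.1 s k) := fun μ =>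
      (pushForward_pull_eq (funext fun x => congrArg k (hι μ x).symm) _ (fun _ _ => rfl)
        (α.1 s)).symm
    simp_rw [h0]
    rw [condensationOne_apply (k := fun _ => s) fun _ => rfl, compAt_pushForward]
    have h2 : Function.Bijective (fun p : Unit × (TwoDisk.point.Ball → Seq T k s) =>
        p.2 default) :=
      ⟨fun p q h => Prod.ext rfl (funext fun μ => by rw [Subsingleton.elim μ default]; exact h),
        fun v => ⟨((), fun _ => v), rfl⟩⟩
    have h3 := pushForward_of_bijective h2 (fun v => v) (α.1 s k)
    rw [pushForward_id] at h3
    refine Eq.trans ?_ h3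
    congr 1
    · funext p
      have h4 : ∀ μ x (i : Fin (k (ι.incl μ x) + 1)), Seq.elemsMap
          (fun x => finCast (congrArg k (hι μ x))) ⟨x, i⟩ = (⟨ι.incl μ x, i⟩ : Elems T k) :=
        fun μ x i => elems_ext (hι μ x).symm rfl
      have h5 : ∀ μ, p.2 μ = p.2 default := fun μ => congrArg p.2 (Subsingleton.elim _ _)
      refine Seq.ext_fibres ι ?_ ?_
      · intro μ x i μ' x' i'
        obtain rfl : μ = μ' := Subsingleton.elim _ _
        rw [Seq.comp_le, compLe_same, Seq.pull_le_of_injective _ fun _ => finCast_injective _,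
          h4, h4, h5]
      · intro μ x i
        rw [Seq.comp_W]
        refine Fin.ext ?_
        change ((p.2 μ).W (Seq.elemsMap (k' := fun x => k (ι.incl μ x))
          (fun x => finCast (congrArg k (hι μ x))) ⟨x, i⟩)).val = _
        rw [h4, h5]
    · funext p
      rw [Fintype.prod_unique, one_mul]
  · rw [condensationOne_apply_eq_zero hs, map_zero, _root_.zero_apply]
    funext w
    by_contra hne
    have hdeg : (s : ℤ) - ∑ x, (k x : ℤ) = a := α.2 _ _ _ (Ne.symm hne)
    apply hs
    intro ν
    unfold middleDim
    simp_rw [hι]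
    rw [← hdeg, sub_add_cancel]
    exact Int.toNat_natCast _

variable (𝕜) in
/-- The condensation of `seq` is a dg 2-operad. -/
theorem condensationData_isOperad : (condensationData 𝕜).IsOperad where
  d_comp := by
    intro T S σ F ι b a n h β α
    have e1 := condensationComplex_d (𝕜 := 𝕜) (n := n) rfl (condensationComp 𝕜 ι b a n h β α)
    have e2 := condensationComplex_d (𝕜 := 𝕜) (n := b) rfl β
    refine e1.trans ((condensationData_d_comp ι b a n h β α).trans ?_)
    rw [← e2]
    rfl
  assoc := by
    intro T S Q σ ρ τ F G H ι κ l θ m hτ hθ hm c b a p n e hp hn he hn' γ β α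
    exact Subtype.ext (compCochain_assoc ι κ l m hm hτ hθ b a e he γ.1 (fun q => (β q).1) α)
  d_one := (condensationComplex_d (𝕜 := 𝕜) rfl (condensationOne 𝕜)).trans condensationD_one
  comp_one := by
    intro T σ ι hσ b β
    exact Subtype.ext (compCochain_one ι hσ β.1)
  one_comp := by
    intro T σ ι hι a n h h' α
    exact Subtype.ext ((one_compCochain ι hι α).trans (condensationComplex_XIsoOfEq h' α).symm)

end Units

/-! ### Truncation of dg 2-operads -/

section SubOperad

variable {𝕜 : Type u} [Field 𝕜]

/-- A family of graded subspaces of a dg 2-operad that is closed under the differentials and the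
compositions and contains the unit. -/
structure DGTwoOperad.SubOperad (O : DGTwoOperad 𝕜) where
  carrier : ∀ U n, Submodule 𝕜 ((O.X U).X n)
  d_mem : ∀ {U n m} {x}, x ∈ carrier U n → ((O.X U).d n m).hom x ∈ carrier U m
  comp_mem : ∀ {T S : TwoDisk} {σ : T.Hom S} {F : S.Ball → TwoDisk} (ι : Fibres σ F)
    (b : ℤ) (a : S.Ball → ℤ) (n : ℤ) (h : b + ∑ μ, a μ = n) {β} {α : ∀ μ, (O.X (F μ)).X (a μ)},
    β ∈ carrier S b → (∀ μ, α μ ∈ carrier (F μ) (a μ)) → O.comp ι b a n h β α ∈ carrier T n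
  one_mem : O.one ∈ carrier TwoDisk.point 0

namespace DGTwoOperad.SubOperad

variable {O : DGTwoOperad 𝕜} (P : O.SubOperad)

/-- The subcomplexes that form a suboperad. -/
def complex (U : TwoDisk) : CochainComplex (ModuleCat.{u} 𝕜) ℤ where
  X := fun n => ModuleCat.of 𝕜 (P.carrier U n)
  d := fun n m => ModuleCat.ofHom (((O.X U).d n m).hom.restrict fun _ => P.d_mem)
  shape := fun n m h => ModuleCat.hom_ext (LinearMap.ext fun x => Subtype.ext
    (LinearMap.congr_fun (congrArg ModuleCat.Hom.hom ((O.X U).shape n m h)) x.1))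
  d_comp_d' := fun n m p _ _ => ModuleCat.hom_ext (LinearMap.ext fun x => Subtype.ext
    (LinearMap.congr_fun (congrArg ModuleCat.Hom.hom ((O.X U).d_comp_d n m p)) x.1))

/-- The restricted compositions and the unit. -/
def data : DGTwoOperadData 𝕜 where
  X := P.complex
  comp := fun {T S _ F} ι b a n h =>
    { toFun := fun β => ((O.comp ι b a n h (β : P.carrier S b).1).compLinearMap
        (fun μ => (P.carrier (F μ) (a μ)).subtype)).codRestrict (P.carrier T n)
          (fun α => P.comp_mem ι b a n h (β : P.carrier S b).2 fun μ => (α μ).2)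
      map_add' := fun _ _ => MultilinearMap.ext fun _ => Subtype.ext
        (congrFun (congrArg DFunLike.coe ((O.comp ι b a n h).map_add _ _)) _)
      map_smul' := fun _ _ => MultilinearMap.ext fun _ => Subtype.ext
        (congrFun (congrArg DFunLike.coe ((O.comp ι b a n h).map_smul _ _)) _) }
  one := (⟨O.one, P.one_mem⟩ : P.carrier TwoDisk.point 0)

theorem coe_XIsoOfEq {U : TwoDisk} {n m : ℤ} (h : n = m) (x : P.carrier U n) :
    (((P.complex U).XIsoOfEq h).hom.hom x : P.carrier U m).1 =
      ((O.X U).XIsoOfEq h).hom.hom x.1 := by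
  subst h
  rfl

theorem coe_diffAt {I : Type} [DecidableEq I] (U : I → TwoDisk) (a : I → ℤ) (i : I)
    (α : ∀ j, P.carrier (U j) (a j)) (j : I) :
    (diffAt (fun j => P.complex (U j)) a i α j : P.carrier (U j) (bump a i j)).1 =
      diffAt (fun j => O.X (U j)) a i (fun j => (α j).1) j := by
  unfold diffAt
  split_ifs with h
  · rfl
  · exact P.coe_XIsoOfEq _ _

theorem data_isOperad : P.data.IsOperad where
  d_comp := by
    intro T S σ F ι b a n h β α
    refine Subtype.ext ((O.isOperad.d_comp ι b a n h (β : P.carrier S b).1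
      (fun μ => (α μ : P.carrier (F μ) (a μ)).1)).trans ?_)
    refine Eq.trans ?_ ((P.carrier T (n + 1)).subtype.map_add _ _).symm
    refine congrArg₂ (· + ·) rfl (Eq.trans ?_ (map_sum (P.carrier T (n + 1)).subtype _ _).symm)
    refine Finset.sum_congr rfl fun μ _ => ?_
    have h1 := funext (P.coe_diffAt F a μ α)
    exact congrArg (fun x => sgn 𝕜 _ • O.comp ι b (bump a μ) (n + 1) _ (β : P.carrier S b).1 x)
      h1.symm
  assoc := by
    intro T S Q σ ρ τ F G H ι κ l θ m hτ hθ hm c b a p n e hp hn he hn' γ β α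
    exact Subtype.ext (O.isOperad.assoc ι κ l m hτ hθ hm c b a p n e hp hn he hn'
      (γ : P.carrier Q c).1 (fun q => (β q : P.carrier (G q) (b q)).1)
      (fun s => (α s : P.carrier (F s) (a s)).1))
  d_one := Subtype.ext O.isOperad.d_one
  comp_one := by
    intro T σ ι hσ b β
    exact Subtype.ext (O.isOperad.comp_one ι hσ b (β : P.carrier T b).1)
  one_comp := by
    intro T σ ι hι a n h h' α
    exact Subtype.ext ((O.isOperad.one_comp ι hι a n h h' (α : P.carrier T a).1).trans
      (P.coe_XIsoOfEq h' α).symm)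

/-- A suboperad as a dg 2-operad. -/
def toDGTwoOperad : DGTwoOperad 𝕜 where
  toDGTwoOperadData := P.data
  isOperad := P.data_isOperad

/-- The inclusion of a suboperad. -/
def inclusion : P.toDGTwoOperad.Hom O where
  app := fun U =>
    { f := fun n => ModuleCat.ofHom (P.carrier U n).subtype
      comm' := fun _ _ _ => rfl }
  map_comp := fun _ _ _ _ _ _ _ => rfl
  map_one := rfl

end DGTwoOperad.SubOperad

theorem d_d_apply (K : CochainComplex (ModuleCat.{u} 𝕜) ℤ) (n m p : ℤ) (x : K.X n) :
    (K.d m p).hom ((K.d n m).hom x) = 0 :=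
  LinearMap.congr_fun (congrArg ModuleCat.Hom.hom (K.d_comp_d n m p)) x

/-- The truncation of a dg 2-operad: everything in negative degrees, and the cocycles in
degree `0`. -/
def DGTwoOperad.truncation (O : DGTwoOperad 𝕜) : O.SubOperad where
  carrier := fun U n =>
    { carrier := {x | 0 ≤ n → ((O.X U).d n (n + 1)).hom x = 0 ∧ (0 < n → x = 0)}
      zero_mem' := fun _ => ⟨map_zero _, fun _ => rfl⟩
      add_mem' := fun {x y} hx hy hn => ⟨by rw [map_add, (hx hn).1, (hy hn).1, add_zero],
        fun hn' => by rw [(hx hn).2 hn', (hy hn).2 hn', add_zero]⟩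
      smul_mem' := fun c x hx hn => ⟨by rw [map_smul, (hx hn).1, smul_zero],
        fun hn' => by rw [(hx hn).2 hn', smul_zero]⟩ }
  d_mem := by
    intro U n m x hx hm
    refine ⟨d_d_apply _ _ _ _ _, fun hm' => ?_⟩
    by_cases h : n + 1 = m
    · subst h
      exact (hx (by omega)).1
    · rw [(O.X U).shape n m h]
      rfl
  comp_mem := by
    intro T S σ F ι b a n h β α hβ hα hn
    by_cases hb : 0 < b
    · rw [(hβ hb.le).2 hb, map_zero, _root_.zero_apply]
      exact ⟨map_zero _, fun _ => rfl⟩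
    by_cases ha : ∃ μ, 0 < a μ
    · obtain ⟨μ, hμ⟩ := ha
      rw [MultilinearMap.map_coord_zero _ μ ((hα μ hμ.le).2 hμ)]
      exact ⟨map_zero _, fun _ => rfl⟩
    push Not at hb ha
    -- only degree `0` is left
    have hsum : ∑ μ, a μ ≤ 0 := Finset.sum_nonpos fun μ _ => ha μ
    have ha0 : ∀ μ, a μ = 0 := fun μ =>
      (Finset.sum_eq_zero_iff_of_nonpos fun μ _ => ha μ).1 (by omega) μ (mem_univ μ)
    refine ⟨?_, fun hn' => by omega⟩
    rw [O.isOperad.d_comp, (hβ (by omega)).1, map_zero, _root_.zero_apply, zero_add]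
    refine Finset.sum_eq_zero fun μ _ => ?_
    rw [MultilinearMap.map_coord_zero _ μ, smul_zero]
    unfold diffAt
    rw [dif_pos rfl]
    have h1 : bump a μ μ = a μ + 1 := by simp [bump]
    rw [h1]
    exact (hα μ (ha0 μ).ge).1
  one_mem := fun _ => ⟨O.isOperad.d_one, fun h => absurd h (lt_irrefl _)⟩

/-- The inclusion of the truncation is a quasi-isomorphism if there is no cohomology in positive
degrees. -/
theorem DGTwoOperad.quasiIso_truncation_inclusion (O : DGTwoOperad 𝕜) (U : TwoDisk)
    (hO : ∀ m n : ℤ, m + 1 = n → 0 < n → ∀ x : (O.X U).X n, ((O.X U).d n (n + 1)).hom x = 0 →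
      ∃ y : (O.X U).X m, ((O.X U).d m n).hom y = x) : QuasiIso (O.truncation.inclusion.app U) := by
  refine quasiIso_of_elements _ ?_ ?_
  · rintro m n h x - ⟨y, hy⟩
    have hx := (x : O.truncation.carrier U n).2
    by_cases hn : 0 < n
    · refine ⟨0, ?_⟩
      rw [map_zero]
      exact Subtype.ext ((hx hn.le).2 hn).symm
    · exact ⟨(⟨y, fun hm => absurd hm (by omega)⟩ : O.truncation.carrier U m), Subtype.ext hy⟩
  · intro m n h y hy
    by_cases hn : 0 < n
    · obtain ⟨z, hz⟩ := hO m n h hn y hy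
      refine ⟨0, map_zero _, z, ?_⟩
      rw [map_zero, zero_add]
      exact hz
    · refine ⟨(⟨y, fun _ => ⟨hy, fun hn' => absurd hn' hn⟩⟩ : O.truncation.carrier U n),
        Subtype.ext hy, 0, ?_⟩
      rw [map_zero, add_zero]
      rfl

end SubOperad

/-! ### The zigzag between the condensation and the constant 2-operad -/

section Zigzag

variable (𝕜 : Type u) [Field 𝕜]

/-- The dg condensation of `seq` as a dg 2-operad. -/
def condensationOperad : DGTwoOperad 𝕜 :=
  ⟨condensationData 𝕜, condensationData_isOperad 𝕜⟩

/-- The augmentation of the condensation: the augmentation of the column `s = 0`. -/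
def condensationAug (U : TwoDisk) (n : ℤ) : condensationX 𝕜 U n →ₗ[𝕜] constantX 𝕜 n where
  toFun := fun f => ⟨columnAug (f.1 0), fun h => by
    by_contra hn
    exact h (columnAug_eq_zero_of_ne f fun e => hn e.symm)⟩
  map_add' := fun f g => Subtype.ext ((columnAugHom 𝕜 U 0).map_add (f.1 0) (g.1 0))
  map_smul' := fun c f => Subtype.ext ((columnAugHom 𝕜 U 0).map_smul c (f.1 0))

variable {𝕜}

/-- The augmentation is a map of complexes to the constant complex, whose differential is zero. -/
theorem condensationAug_d {U : TwoDisk} {n m : ℤ} (h : n + 1 = m) (f : condensationX 𝕜 U n) :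
    condensationAug 𝕜 U m (condensationD 𝕜 U n m h f) = 0 :=
  Subtype.ext ((columnAug_condensationD h f 0).trans (columnAug_cofaceSum_zero f.1))

/-- The augmentation is multiplicative on elements of degree `0`. -/
theorem columnAug_compCochain {T S : TwoDisk} {σ : T.Hom S} {F : S.Ball → TwoDisk}
    (ι : Fibres σ F) (β : Cochains 𝕜 S) (α : ∀ μ, Cochains 𝕜 (F μ)) :
    columnAug (compCochain 𝕜 ι (fun _ => 0) β α 0) = columnAug (β 0) * ∏ μ, columnAug (α μ 0) := by
  classical
  have hJ : middleDim ι (fun _ => 0) 0 = 0 := by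
    funext μ
    simp [middleDim]
  have hk : koszul σ.toFun (fun _ => 0) (fun t => (((0 : T.Ball → ℕ) t : ℕ) : ℤ)) = 0 := by
    simp [koszul]
  unfold columnAug
  rw [compCochain_eq_compAt, hk, sgn_zero, one_smul]
  have h1 := compAt_congr_left ι hJ 0 0 (β 0) α
  rw [h1, compAt_apply, sum_pushForward, Fintype.sum_prod_type, Finset.prod_univ_sum,
    Finset.sum_mul_sum, Fintype.piFinset_univ]
  rfl

theorem columnAug_condensationOne : columnAug ((condensationOne 𝕜).1 0) = 1 := by
  unfold columnAug
  rw [condensationOne_apply (k := 0) (s := 0) (fun _ => rfl), sum_pushForward]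
  simp

variable (𝕜)

/-- The augmentation of the truncated condensation is a map of dg 2-operads. -/
def truncationAug : (condensationOperad 𝕜).truncation.toDGTwoOperad.Hom (constantOperad 𝕜) where
  app := fun U =>
    { f := fun n => ModuleCat.ofHom ((condensationAug 𝕜 U n).comp
        ((condensationOperad 𝕜).truncation.carrier U n).subtype)
      comm' := by
        rintro n m rfl
        refine ModuleCat.hom_ext (LinearMap.ext fun x => ?_)
        have h1 := condensationAug_d rfl
          (x : (condensationOperad 𝕜).truncation.carrier U n).1
        have h2 := condensationComplex_d rfl
          (x : (condensationOperad 𝕜).truncation.carrier U n).1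
        exact ((congrArg (condensationAug 𝕜 U (n + 1)) h2).trans h1).symm }
  map_comp := by
    intro T S σ F ι b a n h β α
    have hβ := (β : (condensationOperad 𝕜).truncation.carrier S b).2
    have hα := fun μ => (α μ : (condensationOperad 𝕜).truncation.carrier (F μ) (a μ)).2
    by_cases hn : n = 0
    · by_cases hb : 0 < b
      · obtain rfl : β = 0 := Subtype.ext ((hβ hb.le).2 hb)
        simp only [map_zero, _root_.zero_apply]
      by_cases ha : ∃ μ, 0 < a μ
      · obtain ⟨μ, hμ⟩ := ha
        have h0 : α μ = 0 := Subtype.ext ((hα μ hμ.le).2 hμ)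
        rw [MultilinearMap.map_coord_zero _ μ h0, map_zero, MultilinearMap.map_coord_zero _ μ]
        rw [h0, map_zero]
      push Not at hb ha
      have hsum : ∑ μ, a μ ≤ 0 := Finset.sum_nonpos fun μ _ => ha μ
      obtain rfl : a = fun _ => 0 := funext fun μ =>
        (Finset.sum_eq_zero_iff_of_nonpos fun μ _ => ha μ).1 (by omega) μ (mem_univ μ)
      exact Subtype.ext (columnAug_compCochain ι
        (β : (condensationOperad 𝕜).truncation.carrier S b).1.1
        fun μ => (α μ : (condensationOperad 𝕜).truncation.carrier (F μ) 0).1.1)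
    · have := subsingleton_constantX (𝕜 := 𝕜) hn
      exact Subsingleton.elim (α := constantX 𝕜 n) _ _
  map_one := Subtype.ext columnAug_condensationOne

instance quasiIso_truncationAug (U : TwoDisk) : QuasiIso ((truncationAug 𝕜).app U) := by
  refine quasiIso_of_elements _ ?_ ?_
  · rintro m n h x hx ⟨y, hy⟩
    have hmem := (x : (condensationOperad 𝕜).truncation.carrier U n).2
    by_cases hn : 0 < n
    · refine ⟨0, ?_⟩
      rw [map_zero]
      exact Subtype.ext ((hmem hn.le).2 hn).symm
    · have hx' := congrArg Subtype.val hx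
      have h0 : columnAug
          (((x : (condensationOperad 𝕜).truncation.carrier U n).1 : condensationX 𝕜 U n).1 0) = 0 :=
        (congrArg Subtype.val hy).symm
      obtain ⟨g, hg⟩ := exists_condensationD_eq h
        (x : (condensationOperad 𝕜).truncation.carrier U n).1
        ((condensationComplex_d rfl _).symm.trans hx') (fun _ => h0)
      refine ⟨(⟨g, fun hm => absurd hm (by omega)⟩ :
        (condensationOperad 𝕜).truncation.carrier U m), Subtype.ext ?_⟩
      exact (condensationComplex_d h g).trans hg
  · rintro m n h y -
    by_cases hn : n = 0
    · subst hn
      obtain ⟨e, he, he'⟩ := exists_cocycle_columnAug_eq_one 𝕜 U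
      have hd : ((condensationComplex 𝕜 U).d 0 1).hom ((y : constantX 𝕜 0).1 • e) = 0 := by
        refine (condensationComplex_d (n := 0) rfl ((y : constantX 𝕜 0).1 • e)).trans ?_
        exact ((condensationD 𝕜 U 0 1 rfl).map_smul _ e).trans ((congrArg _ he).trans (smul_zero _))
      refine ⟨(⟨(y : constantX 𝕜 0).1 • e, fun _ => ⟨hd, fun h0 => absurd h0 (lt_irrefl _)⟩⟩ :
        (condensationOperad 𝕜).truncation.carrier U 0), Subtype.ext hd, 0, ?_⟩
      rw [map_zero, add_zero]
      refine ((condensationAug 𝕜 U 0).map_smul (y : constantX 𝕜 0).1 e).trans (Subtype.ext ?_)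
      change (y : constantX 𝕜 0).1 * columnAug (e.1 0) = (y : constantX 𝕜 0).1
      rw [he', mul_one]
    · have := subsingleton_constantX (𝕜 := 𝕜) hn
      exact ⟨0, map_zero _, 0, Subsingleton.elim (α := constantX 𝕜 n) _ _⟩

theorem quasiIsomorphic_condensationOperad :
    (condensationOperad 𝕜).QuasiIsomorphic (constantOperad 𝕜) := by
  refine .trans _ (condensationOperad 𝕜).truncation.toDGTwoOperad _ (.symm _ _ (.rel _ _
    ⟨(condensationOperad 𝕜).truncation.inclusion, fun U => ?_⟩))
    (.rel _ _ ⟨truncationAug 𝕜, quasiIso_truncationAug 𝕜⟩)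
  refine (condensationOperad 𝕜).quasiIso_truncation_inclusion U fun m n h hn x hx => ?_
  obtain ⟨g, hg⟩ := exists_condensationD_eq h x
    ((condensationComplex_d rfl x).symm.trans hx) (fun h0 => absurd h0 hn.ne')
  exact ⟨g, (condensationComplex_d h g).trans hg⟩

end Zigzag

end TwoOperads

end

theorem mainTheorem1 (𝕜 : Type*) [Field 𝕜] [CharZero 𝕜] :
    (∀ U : TwoOperads.TwoDisk,
      Nonempty ((TwoOperads.norBreq 𝕜 U).homology 0 ≅ ModuleCat.of 𝕜 𝕜) ∧
        ∀ n : ℤ, n ≠ 0 → Limits.IsZero ((TwoOperads.norBreq 𝕜 U).homology n)) ∧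
    ∃ h : (TwoOperads.condensationData 𝕜).IsOperad,
      (TwoOperads.DGTwoOperad.mk (TwoOperads.condensationData 𝕜) h).QuasiIsomorphic
        (TwoOperads.constantOperad 𝕜) :=
  ⟨fun U => ⟨TwoOperads.nonempty_norBreq_homology_zero_iso 𝕜 U, fun _ hn =>
      TwoOperads.isZero_norBreq_homology 𝕜 U hn⟩,
    TwoOperads.condensationData_isOperad 𝕜, TwoOperads.quasiIsomorphic_condensationOperad 𝕜⟩
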